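/- Let $\epsilon,\delta>0$. For $n\in\mathbb Z$ let $D_{Ln}$ and $D_{Rn}$ be the open unit disks in $\mathbb R^2$ centred at $(-1-\frac\epsilon2,\,n(2+\delta))$ and $(1+\frac\epsilon2,\,n(2+\delta))$. Let $\Omega=\mathbb R\times(-1-\frac\delta2,\,1+\frac\delta2)$, and on $\partial D_{L0}$ and $\partial D_{R0}$ let $\nu$ be the unit normal pointing toward the inside of the disk. Functions below are $C^1$ up to the boundary of $\Omega\setminus\overline{D_{L0}\cup D_{R0}}$, where their normal derivatives are taken from within this domain. There exist a constant $c_0$ (depending on $\epsilon$ and $\delta$) and a harmonic function $\phi$ in $\Omega\setminus\overline{D_{L0}\cup D_{R0}}$ such that $$\begin{cases}\partial_\nu\phi=0&\text{on }\partial\Omega=\mathbb R\times\{-1-\frac\delta2,\,1+\frac\delta2\},\\ \phi=c_0&\text{on }\partial D_{R0},\\ \phi=-c_0&\text{on }\partial D_{L0},\\ \int_{\partial D_{R0}}\partial_\nu\phi\,ds=-\int_{\partial D_{L0}}\partial_\nu\phi\,ds=1,\\ \int_{\Omega\setminus\overline{D_{L0}\cup D_{R0}}}|\nabla\phi|^2\,dx\,dy<\infty,\end{cases}$$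 and such that the following holds. Let $H$ be any harmonic function in $\mathbb R^2$ with $\nabla H(x,y)=\nabla H(x,y+2+\delta)$ for all $(x,y)\in\mathbb R^2$, and let $u$ be a harmonic function in $E=\mathbb R^2\setminus\overline{\bigcup_{n\in\mathbb Z}(D_{Ln}\cup D_{Rn})}$ such that, for some constants $c_L,c_R$, $$\begin{cases}u=c_L\text{ on }\partial D_{L0},\qquad u=c_R\text{ on }\partial D_{R0},\\ \int_{\partial D_{L0}}\partial_\nu u\,ds=\int_{\partial D_{R0}}\partial_\nu u\,ds=0,\\ \int_{\Omega\setminus\overline{D_{L0}\cup D_{R0}}}|\nabla(u-H)|^2\,dx\,dy<\infty,\\ \nabla u(x,y)=\nabla u(x,y+2+\delta)\text{ for }(x,y)\in E.\end{cases}$$ Then $$u\big|_{\partial D_{R0}}-u\big|_{\partial D_{L0}}=c_R-c_L=\int_{\partial D_{L0}\cup\partial D_{R0}}H\,\partial_\nu\phi\,ds.$$ -/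

import Mathlib

open scoped Gradient

noncomputable section

namespace TwoRows

/-- The centre of the disk `D_{Ln}`. The plane `ℝ²` is `ℂ`, with `(x, y) = x + iy`. -/
def centerL (ε δ : ℝ) (n : ℤ) : ℂ := ⟨-1 - ε / 2, n * (2 + δ)⟩

/-- The centre of the disk `D_{Rn}`. -/
def centerR (ε δ : ℝ) (n : ℤ) : ℂ := ⟨1 + ε / 2, n * (2 + δ)⟩

/-- The open unit disk `D_{Ln}`. -/
def diskL (ε δ : ℝ) (n : ℤ) : Set ℂ := Metric.ball (centerL ε δ n) 1

/-- The open unit disk `D_{Rn}`. -/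
def diskR (ε δ : ℝ) (n : ℤ) : Set ℂ := Metric.ball (centerR ε δ n) 1

/-- The plane without the closure of the union of all disks. -/
def exterior (ε δ : ℝ) : Set ℂ := (closure (⋃ n : ℤ, diskL ε δ n ∪ diskR ε δ n))ᶜ

/-- The strip `Ω = ℝ × (-1 - δ/2, 1 + δ/2)`. -/
def strip (δ : ℝ) : Set ℂ := {z | -1 - δ / 2 < z.im ∧ z.im < 1 + δ / 2}

/-- The domain `Ω \ closure (D_{L0} ∪ D_{R0})`. -/
def stripDomain (ε δ : ℝ) : Set ℂ := strip δ \ closure (diskL ε δ 0 ∪ diskR ε δ 0)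

/-- The derivative in the direction `ν` at a point `z` of the boundary of `Ω \ closure (D_{L0} ∪ D_{R0})`,
taken from inside the domain. It is used only for functions that are `C¹` up to the boundary. -/
def bdryDeriv (ε δ : ℝ) (f : ℂ → ℝ) (z ν : ℂ) : ℝ :=
  fderivWithin ℝ f (closure (stripDomain ε δ)) z ν

/-- The arc length integral `∫ g ds` over the unit circle centred at `c`. -/
def circleInt (c : ℂ) (g : ℂ → ℝ) : ℝ := ∫ θ in (0 : ℝ)..(2 * Real.pi), g (circleMap c 1 θ)

/-- `∂_ν f` on the unit circle centred at `c`, where `ν = c - z` is the unit normal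
that points toward the inside of the disk. -/
def normalDeriv (ε δ : ℝ) (c : ℂ) (f : ℂ → ℝ) (z : ℂ) : ℝ := bdryDeriv ε δ f z (c - z)

/-- `∇ f` has period `2 + δ` in the `y` direction on the set `S`. -/
def PeriodicGradientOn (δ : ℝ) (f : ℂ → ℝ) (S : Set ℂ) : Prop :=
  ∀ z ∈ S, ∇ f z = ∇ f (z + ((2 + δ : ℝ) : ℂ) * Complex.I)

/-- `∫ |∇ f|² dx dy < ∞` over `Ω \ closure (D_{L0} ∪ D_{R0})`. -/
def FiniteEnergy (ε δ : ℝ) (f : ℂ → ℝ) : Prop :=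
  ∫⁻ z in stripDomain ε δ, ENNReal.ofReal (‖∇ f z‖ ^ 2) < ⊤

/-- The admissible `H`: harmonic functions in the plane whose gradient has period `2 + δ` in `y`. -/
structure Admissible (δ : ℝ) (H : ℂ → ℝ) : Prop where
  harmonic : InnerProductSpace.HarmonicOnNhd H Set.univ
  periodic : PeriodicGradientOn δ H Set.univ

/-- `u` is a (classical) solution of the two-row problem for `H`, with the value `cL` on `∂D_{L0}`
and the value `cR` on `∂D_{R0}`. -/
structure IsSolution (ε δ : ℝ) (H u : ℂ → ℝ) (cL cR : ℝ) : Prop where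
  harmonic : InnerProductSpace.HarmonicOnNhd u (exterior ε δ)
  regular : ContDiffOn ℝ 1 u (closure (stripDomain ε δ))
  valueL : ∀ z ∈ Metric.sphere (centerL ε δ 0) 1, u z = cL
  valueR : ∀ z ∈ Metric.sphere (centerR ε δ 0) 1, u z = cR
  fluxL : circleInt (centerL ε δ 0) (normalDeriv ε δ (centerL ε δ 0) u) = 0
  fluxR : circleInt (centerR ε δ 0) (normalDeriv ε δ (centerR ε δ 0) u) = 0
  energy : FiniteEnergy ε δ (fun z => u z - H z)
  periodic : PeriodicGradientOn δ u (exterior ε δ)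

/-- The conditions on `φ`: harmonic in `Ω \ closure (D_{L0} ∪ D_{R0})` and `C¹` up to the boundary,
zero Neumann data on both lines of `∂Ω`, values `∓c₀` and fluxes `∓1` on the circles
`∂D_{L0}` and `∂D_{R0}`, finite energy. -/
structure IsPotential (ε δ : ℝ) (φ : ℂ → ℝ) (c₀ : ℝ) : Prop where
  harmonic : InnerProductSpace.HarmonicOnNhd φ (stripDomain ε δ)
  regular : ContDiffOn ℝ 1 φ (closure (stripDomain ε δ))
  neumannTop : ∀ z : ℂ, z.im = 1 + δ / 2 → bdryDeriv ε δ φ z Complex.I = 0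
  neumannBottom : ∀ z : ℂ, z.im = -1 - δ / 2 → bdryDeriv ε δ φ z (-Complex.I) = 0
  valueR : ∀ z ∈ Metric.sphere (centerR ε δ 0) 1, φ z = c₀
  valueL : ∀ z ∈ Metric.sphere (centerL ε δ 0) 1, φ z = -c₀
  fluxR : circleInt (centerR ε δ 0) (normalDeriv ε δ (centerR ε δ 0) φ) = 1
  fluxL : -circleInt (centerL ε δ 0) (normalDeriv ε δ (centerL ε δ 0) φ) = 1
  energy : FiniteEnergy ε δ φ

end TwoRows

end

open Complex Set Filter Topology MeasureTheory Metric InnerProductSpace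
open scoped Real ComplexConjugate Interval Gradient

noncomputable section

namespace TwoRows

/-! ### Periodic kernels and differentiation of shifted integrals. -/

section

/-! Write P = 2 + δ and c = 1 + ε/2; the disks are the unit disks around ±c + iPℤ.

Once φ is available, the formula is Green's identity for v = u - H and φ in one period cell. Only ∇v
is periodic, not v, but the Neumann condition removes v ∂φ on the horizontal sides and the remaining
φ ∂v cancels because φ and ∇v are periodic. On suitable vertical lines far away, finite energy makes
v grow at most linearly and its normal derivative small in the mean (`exists_far_lines`), while φ is
bounded and ∇φ decays exponentially. Hence the fluxes of v ∇φ - φ ∇v through the two circles add up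
to zero (`circleFlux_greenField_add`). On the circles u and φ are constant, neither u nor the entire
harmonic function H has flux, and φ has fluxes ∓1; what remains is the claim.

The substance is the existence of φ. The ansatz is a logarithmic source array at c + iPℤ, minus the
same at -c + iPℤ, plus the real part of a holomorphic function `layer`: a superposition of coth
kernels with poles on circles of radius 1/R < 1 around the centres. With ζ = z - c, the singular
part of `layer` near c is the reflection conj (q(1/conj ζ)) of a function q holomorphic in a disk of
radius R' > R > 1, and the rest, `regPart`, is holomorphic there. On |ζ| = 1 the reflection is conj
q, so the Dirichlet condition holds as soon as q + d + `regPart` is constant, where Re d is the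
regular part of the logarithmic sources. Imposed on |ζ| = R, this is an equation p + Kp = g in
C(Circle, ℂ) with K conjugate-linear, hence real-linear, and compact.

By the Fredholm alternative, uniqueness suffices. A homogeneous solution gives a periodic
holomorphic `layer` with constant real part on each circle and limits at both ends. An extremal
argument with the open mapping theorem makes it locally constant (`deriv_eq_zero_of_re_const`); then
q has constant imaginary part on the unit circle and q(0) = 0, so q = 0 (`eqOn_zero_of_im_const`).

The potential so obtained is odd under z ↦ -z, which gives opposite values and fluxes on the two
circles. Averaging with its complex conjugate reflection makes it symmetric about the real axis;
with periodicity it is then symmetric about the lines Im z = ±P/2, which is the Neumann condition.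
-/

/-- The entire function `e^{2πw/P} - 1`, whose zeros are the points of `iPℤ`. -/
def expSub (P : ℝ) (w : ℂ) : ℂ := exp ((2 * π / P : ℝ) * w) - 1

/-- The odd `iP`-periodic function `(π/P) coth(πw/P)`. -/
def cothKernel (P : ℝ) (w : ℂ) : ℂ := (2 * π / P : ℝ) * (1 / 2 + (expSub P w)⁻¹)

theorem expSub_eq_zero_iff {P : ℝ} (hP : 0 < P) {w : ℂ} :
    expSub P w = 0 ↔ ∃ n : ℤ, w = n * P * I := by
  have hP' : (P : ℂ) ≠ 0 := by exact_mod_cast hP.ne'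
  have hpi : (π : ℂ) ≠ 0 := by exact_mod_cast Real.pi_ne_zero
  rw [expSub, sub_eq_zero, exp_eq_one_iff]
  refine exists_congr fun n => ?_
  push_cast
  constructor
  · intro h
    field_simp at h
    rw [← mul_right_inj' (mul_ne_zero two_ne_zero hpi)]
    linear_combination (2 : ℂ) * π * h
  · rintro rfl
    field_simp

theorem hasDerivAt_expSub (P : ℝ) (w : ℂ) :
    HasDerivAt (expSub P) ((2 * π / P : ℝ) * exp ((2 * π / P : ℝ) * w)) w := by
  have h := (((hasDerivAt_id w).const_mul ((2 * π / P : ℝ) : ℂ)).cexp).sub_const 1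
  convert! h using 1
  simp [mul_comm]

theorem differentiable_expSub (P : ℝ) : Differentiable ℂ (expSub P) :=
  fun w => (hasDerivAt_expSub P w).differentiableAt

theorem expSub_add_period {P : ℝ} (hP : 0 < P) (w : ℂ) : expSub P (w + P * I) = expSub P w := by
  have hP' : (P : ℂ) ≠ 0 := by exact_mod_cast hP.ne'
  have : ((2 * π / P : ℝ) : ℂ) * (w + P * I) = (2 * π / P : ℝ) * w + 2 * π * I := by
    push_cast
    field_simp
  rw [expSub, expSub, this, exp_periodic]

theorem cothKernel_add_period {P : ℝ} (hP : 0 < P) (w : ℂ) :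
    cothKernel P (w + P * I) = cothKernel P w := by
  rw [cothKernel, expSub_add_period hP, cothKernel]

theorem expSub_neg (P : ℝ) (w : ℂ) :
    expSub P (-w) = -(exp (-((2 * π / P : ℝ) * w)) * expSub P w) := by
  rw [expSub, expSub, mul_sub, ← exp_add]
  simp

theorem cothKernel_neg {P : ℝ} {w : ℂ} (hw : expSub P w ≠ 0) :
    cothKernel P (-w) = -cothKernel P w := by
  have h1 := exp_ne_zero ((2 * π / P : ℝ) * w)
  rw [cothKernel, cothKernel, expSub_neg, exp_neg]
  have : exp ((2 * π / P : ℝ) * w) = expSub P w + 1 := by simp [expSub]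
  rw [this] at h1 ⊢
  field_simp
  ring

theorem hasDerivAt_cothKernel {P : ℝ} {w : ℂ} (hw : expSub P w ≠ 0) :
    HasDerivAt (cothKernel P)
      (-((2 * π / P : ℝ) : ℂ) ^ 2 * exp ((2 * π / P : ℝ) * w) / expSub P w ^ 2) w := by
  have h := (((hasDerivAt_expSub P w).inv hw).const_add (1 / 2)).const_mul ((2 * π / P : ℝ) : ℂ)
  convert! h using 1
  ring

theorem isOpen_expSub_ne_zero (P : ℝ) : IsOpen {w | expSub P w ≠ 0} :=
  isOpen_ne_fun (differentiable_expSub P).continuous continuous_const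

theorem differentiableOn_cothKernel (P : ℝ) :
    DifferentiableOn ℂ (cothKernel P) {w | expSub P w ≠ 0} :=
  fun _ hw => (hasDerivAt_cothKernel hw).differentiableAt.differentiableWithinAt

theorem expSub_ne_zero_of_re_ne_zero {P : ℝ} (hP : 0 < P) {w : ℂ} (hw : w.re ≠ 0) :
    expSub P w ≠ 0 := by
  rw [Ne, expSub_eq_zero_iff hP]
  rintro ⟨n, rfl⟩
  simp at hw

theorem expSub_ne_zero_of_norm_lt {P : ℝ} (hP : 0 < P) {w : ℂ} (hw : w ≠ 0) (hw' : ‖w‖ < P) :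
    expSub P w ≠ 0 := by
  rw [Ne, expSub_eq_zero_iff hP]
  rintro ⟨n, rfl⟩
  have hn : n ≠ 0 := by rintro rfl; simp at hw
  have : (1 : ℝ) ≤ |(n : ℝ)| := by exact_mod_cast Int.one_le_abs hn
  simp only [norm_mul, norm_intCast, norm_real, norm_I, mul_one, Real.norm_eq_abs,
    abs_of_pos hP] at hw'
  nlinarith

theorem norm_expSub_ge (P : ℝ) (w : ℂ) : Real.exp (2 * π / P * w.re) - 1 ≤ ‖expSub P w‖ := by
  have h := norm_sub_norm_le (exp ((2 * π / P : ℝ) * w)) 1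
  rw [norm_exp, re_ofReal_mul, norm_one] at h
  exact h

/-- With l = 2π/P the derivative is -l² e^{lw}/(e^{lw} - 1)², and for Re w ≥ 1 the denominator
satisfies |e^{lw} - 1| ≥ (1 - e^{-l}) e^{l Re w}. -/
theorem norm_deriv_cothKernel_le_of_pos {P : ℝ} (hP : 0 < P) {w : ℂ} (hw : 1 ≤ w.re) :
    ‖deriv (cothKernel P) w‖ ≤
      (2 * π / P) ^ 2 / (1 - Real.exp (-(2 * π / P))) ^ 2 * Real.exp (-(2 * π / P * w.re)) := by
  have hl : 0 < 2 * π / P := by positivity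
  rw [(hasDerivAt_cothKernel (expSub_ne_zero_of_re_ne_zero hP (by linarith))).deriv]
  set l := 2 * π / P
  have h1 : Real.exp (-l) < 1 := by rw [Real.exp_lt_one_iff]; linarith
  have h2 : (1 - Real.exp (-l)) * Real.exp (l * w.re) ≤ ‖expSub P w‖ := by
    refine le_trans ?_ (norm_expSub_ge P w)
    rw [sub_mul, ← Real.exp_add]
    have : 1 ≤ Real.exp (-l + l * w.re) := Real.one_le_exp (by nlinarith)
    change 1 * Real.exp (l * w.re) - _ ≤ Real.exp (l * w.re) - 1
    linarith
  have h3 : 0 < (1 - Real.exp (-l)) * Real.exp (l * w.re) := by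
    have := Real.exp_pos (l * w.re)
    nlinarith
  rw [norm_div, norm_mul, norm_neg, norm_pow, norm_pow, norm_exp, re_ofReal_mul, norm_real,
    Real.norm_eq_abs, sq_abs]
  calc l ^ 2 * Real.exp (l * w.re) / ‖expSub P w‖ ^ 2
      ≤ l ^ 2 * Real.exp (l * w.re) / ((1 - Real.exp (-l)) * Real.exp (l * w.re)) ^ 2 := by
        gcongr
    _ = _ := by
        rw [Real.exp_neg (l * w.re)]
        have := Real.exp_pos (l * w.re)
        have : 1 - Real.exp (-l) ≠ 0 := by linarith
        field_simp

theorem deriv_cothKernel_neg {P : ℝ} {w : ℂ} (hw : expSub P w ≠ 0) :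
    deriv (cothKernel P) (-w) = deriv (cothKernel P) w := by
  have h : (fun z => cothKernel P (-z)) =ᶠ[𝓝 w] fun z => -cothKernel P z := by
    filter_upwards [(isOpen_expSub_ne_zero P).mem_nhds hw] with z hz using cothKernel_neg hz
  have h2 := h.deriv_eq
  rw [deriv_comp_neg] at h2
  have h3 : deriv (fun z => -cothKernel P z) w = -deriv (cothKernel P) w := deriv.neg
  rw [h3] at h2
  exact neg_injective h2

theorem norm_deriv_cothKernel_le {P : ℝ} (hP : 0 < P) {w : ℂ} (hw : 1 ≤ |w.re|) :
    ‖deriv (cothKernel P) w‖ ≤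
      (2 * π / P) ^ 2 / (1 - Real.exp (-(2 * π / P))) ^ 2 * Real.exp (-(2 * π / P * |w.re|)) := by
  rcases le_total 0 w.re with h | h
  · rw [abs_of_nonneg h] at hw ⊢
    exact norm_deriv_cothKernel_le_of_pos hP hw
  · rw [abs_of_nonpos h] at hw ⊢
    rw [← deriv_cothKernel_neg (expSub_ne_zero_of_re_ne_zero hP (by linarith))]
    exact norm_deriv_cothKernel_le_of_pos hP hw

theorem tendsto_cothKernel_re_atTop {P : ℝ} (hP : 0 < P) :
    Tendsto (cothKernel P) (comap re atTop) (𝓝 (π / P : ℝ)) := by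
  have hl : 0 < 2 * π / P := by positivity
  have h1 : Tendsto (fun w : ℂ => Real.exp (2 * π / P * w.re) - 1) (comap re atTop) atTop := by
    refine tendsto_atTop_add_const_right _ _ ?_
    exact Real.tendsto_exp_atTop.comp (Tendsto.const_mul_atTop hl tendsto_comap)
  have h2 : Tendsto (fun w => (expSub P w)⁻¹) (comap re atTop) (𝓝 0) :=
    tendsto_inv₀_cobounded.comp
      (tendsto_norm_atTop_iff_cobounded.1 (tendsto_atTop_mono (norm_expSub_ge P) h1))
  have h3 := (h2.const_add (1 / 2)).const_mul ((2 * π / P : ℝ) : ℂ)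
  convert! h3 using 2
  push_cast
  ring

/-- The entire function `(e^{2πw/P} - 1) / w`. -/
def expQuot (P : ℝ) : ℂ → ℂ := dslope (expSub P) 0

theorem differentiable_expQuot (P : ℝ) : Differentiable ℂ (expQuot P) := by
  rw [← differentiableOn_univ]
  exact (differentiableOn_dslope univ_mem).2 (differentiable_expSub P).differentiableOn

theorem expSub_eq_mul_expQuot (P : ℝ) (w : ℂ) : expSub P w = w * expQuot P w := by
  have h := sub_smul_dslope (expSub P) 0 w
  have h0 : expSub P 0 = 0 := by simp [expSub]
  rw [sub_zero, h0, sub_zero, smul_eq_mul] at h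
  exact h.symm

/-- The only zero of `expSub` in |w| < P is the origin, and it is simple. -/
theorem expQuot_ne_zero {P : ℝ} (hP : 0 < P) {w : ℂ} (hw : ‖w‖ < P) : expQuot P w ≠ 0 := by
  rcases eq_or_ne w 0 with rfl | h
  · rw [expQuot, dslope_same, (hasDerivAt_expSub P 0).deriv]
    simp [Real.pi_ne_zero, hP.ne']
  · have := expSub_ne_zero_of_norm_lt hP h hw
    rw [expSub_eq_mul_expQuot] at this
    exact right_ne_zero_of_mul this

/-- The regular part `(π/P) coth(πw/P) - 1/w` of `cothKernel` at the origin. -/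
def regKernel (P : ℝ) (w : ℂ) : ℂ := deriv (expQuot P) w / expQuot P w - (π / P : ℝ)

theorem differentiableOn_regKernel {P : ℝ} (hP : 0 < P) :
    DifferentiableOn ℂ (regKernel P) (ball 0 P) := by
  intro w hw
  have h1 : DifferentiableAt ℂ (deriv (expQuot P)) w := (differentiable_expQuot P).deriv w
  exact ((h1.div (differentiable_expQuot P w)
    (expQuot_ne_zero hP (by simpa using hw))).sub_const _).differentiableWithinAt

/-- `cothKernel` is the logarithmic derivative of `expSub` minus π/P, and `expSub P w` factors as w
times a function without zeros in |w| < P. -/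
theorem cothKernel_eq_inv_add_regKernel {P : ℝ} (hP : 0 < P) {w : ℂ} (hw : w ≠ 0)
    (hw' : ‖w‖ < P) : cothKernel P w = w⁻¹ + regKernel P w := by
  have hN := expQuot_ne_zero hP hw'
  have h1 : HasDerivAt (expSub P) (1 * expQuot P w + w * deriv (expQuot P) w) w := by
    have := (hasDerivAt_id w).mul (differentiable_expQuot P w).hasDerivAt
    refine this.congr_of_eventuallyEq (Eventually.of_forall fun z => ?_)
    simp [expSub_eq_mul_expQuot]
  have h2 := h1.unique (hasDerivAt_expSub P w)
  have h3 : exp ((2 * π / P : ℝ) * w) = w * expQuot P w + 1 := by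
    rw [← expSub_eq_mul_expQuot, expSub]; ring
  rw [h3] at h2
  rw [cothKernel, regKernel, expSub_eq_mul_expQuot]
  have h4 : deriv (expQuot P) w
      = (((2 * π / P : ℝ) : ℂ) * (w * expQuot P w + 1) - expQuot P w) / w := by
    field_simp
    linear_combination h2
  rw [h4]
  push_cast
  field_simp
  ring

/-- If `G` is holomorphic on the open set `V`, the set where `z ↦ ∫ m(θ) G(z + s(θ)) dθ` is
holomorphic contains `{z | ∀ θ, z + s(θ) ∈ V}`, which is open. -/
theorem eventually_forall_add_mem {V : Set ℂ} (hV : IsOpen V) {s : ℝ → ℂ} (hs : Continuous s)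
    {a b : ℝ} {z : ℂ} (hz : ∀ θ ∈ Icc a b, z + s θ ∈ V) :
    ∃ r > 0, ∃ K ⊆ V, IsCompact K ∧ ∀ x ∈ ball z r, ∀ θ ∈ Icc a b, x + s θ ∈ K := by
  have hK : IsCompact ((fun θ => z + s θ) '' Icc a b) :=
    isCompact_Icc.image (continuous_const.add hs)
  obtain ⟨r, hr, hsub⟩ := hK.exists_cthickening_subset_open hV (by rintro _ ⟨θ, hθ, rfl⟩; exact hz θ hθ)
  refine ⟨r, hr, _, hsub, hK.cthickening, fun x hx θ hθ => ?_⟩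
  refine mem_cthickening_of_dist_le _ (z + s θ) _ _ ⟨θ, hθ, rfl⟩ ?_
  rw [dist_add_right]
  exact (mem_ball.1 hx).le

/-- For x near z all points x + s(θ) stay in one compact subset of V, where `deriv G` is bounded;
this is the dominating bound. -/
theorem hasDerivAt_integral_shift {G : ℂ → ℂ} {V : Set ℂ} (hV : IsOpen V)
    (hG : DifferentiableOn ℂ G V) {m s : ℝ → ℂ} (hm : Continuous m) (hs : Continuous s)
    {a b : ℝ} (hab : a ≤ b) {z : ℂ} (hz : ∀ θ ∈ Icc a b, z + s θ ∈ V) :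
    HasDerivAt (fun z => ∫ θ in a..b, m θ * G (z + s θ))
      (∫ θ in a..b, m θ * deriv G (z + s θ)) z := by
  obtain ⟨r, hr, K, hKV, hK, hxK⟩ := eventually_forall_add_mem hV hs hz
  have hG' : ContinuousOn (deriv G) V := (hG.deriv hV).continuousOn
  obtain ⟨B, hB⟩ := hK.exists_bound_of_continuousOn (hG'.mono hKV)
  obtain ⟨B', hB'⟩ := (isCompact_Icc (a := a) (b := b)).exists_bound_of_continuousOn hm.continuousOn
  have hcont : ∀ {g : ℂ → ℂ}, ContinuousOn g V → ∀ x ∈ ball z r,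
      ContinuousOn (fun θ => m θ * g (x + s θ)) (Icc a b) := fun hg x hx =>
    hm.continuousOn.mul (hg.comp (continuous_const.add hs).continuousOn
      fun θ hθ => hKV (hxK x hx θ hθ))
  have hII : Ι a b ⊆ Icc a b := by rw [uIoc_of_le hab]; exact Ioc_subset_Icc_self
  refine (intervalIntegral.hasDerivAt_integral_of_dominated_loc_of_deriv_le
    (bound := fun _ => B' * B) (F' := fun x θ => m θ * deriv G (x + s θ))
    (ball_mem_nhds z hr) ?_ ?_ ?_ ?_ intervalIntegrable_const ?_).2
  · filter_upwards [ball_mem_nhds z hr] with x hx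
    exact ((hcont hG.continuousOn x hx).mono hII).aestronglyMeasurable measurableSet_uIoc
  · refine ContinuousOn.intervalIntegrable ?_
    rw [uIcc_of_le hab]
    exact hcont hG.continuousOn z (mem_ball_self hr)
  · exact ((hcont hG' z (mem_ball_self hr)).mono hII).aestronglyMeasurable measurableSet_uIoc
  · refine Eventually.of_forall fun θ hθ x hx => ?_
    rw [norm_mul]
    have h1 := hB' θ (hII hθ)
    have h2 := hB _ (hxK x hx θ (hII hθ))
    exact mul_le_mul h1 h2 (norm_nonneg _) ((norm_nonneg _).trans h1)
  · refine Eventually.of_forall fun θ hθ x hx => ?_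
    have h1 := (hG.differentiableAt (hV.mem_nhds (hKV (hxK x hx θ (hII hθ))))).hasDerivAt
    exact (h1.comp_add_const x (s θ)).const_mul (m θ)

theorem analyticAt_integral_shift {G : ℂ → ℂ} {V : Set ℂ} (hV : IsOpen V)
    (hG : DifferentiableOn ℂ G V) {m s : ℝ → ℂ} (hm : Continuous m) (hs : Continuous s)
    {a b : ℝ} (hab : a ≤ b) {z : ℂ} (hz : ∀ θ ∈ Icc a b, z + s θ ∈ V) :
    AnalyticAt ℂ (fun z => ∫ θ in a..b, m θ * G (z + s θ)) z := by
  obtain ⟨r, hr, K, hKV, hK, hxK⟩ := eventually_forall_add_mem hV hs hz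
  refine DifferentiableOn.analyticAt (s := ball z r) (fun x hx => ?_) (ball_mem_nhds z hr)
  exact (hasDerivAt_integral_shift hV hG hm hs hab
    fun θ hθ => hKV (hxK x hx θ hθ)).differentiableAt.differentiableWithinAt

end

/-! ### Compact conjugate-linear integral operators on the circle and the Fredholm alternative. -/

section

/-- The modulus of continuity, with respect to the first variable, of a kernel. -/
def kernelModulus (κ : C(Circle × ℝ, ℂ)) (w w' : Circle) : ℝ :=
  ∫ θ in (0 : ℝ)..(2 * π), ‖κ (w, θ) - κ (w', θ)‖

theorem continuous_kernelModulus (κ : C(Circle × ℝ, ℂ)) (w : Circle) :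
    Continuous (kernelModulus κ w) := by
  unfold kernelModulus
  refine intervalIntegral.continuous_parametric_intervalIntegral_of_continuous'
    (f := fun w' θ => ‖κ (w, θ) - κ (w', θ)‖) ?_ 0 (2 * π)
  fun_prop

theorem exists_norm_kernel_le (κ : C(Circle × ℝ, ℂ)) :
    ∃ M, 0 ≤ M ∧ ∀ w, ∀ θ ∈ Icc (0 : ℝ) (2 * π), ‖κ (w, θ)‖ ≤ M := by
  obtain ⟨M, hM⟩ := ((isCompact_univ (X := Circle)).prod
    (isCompact_Icc (a := (0 : ℝ)) (b := 2 * π))).exists_bound_of_continuousOn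
    κ.continuous.continuousOn
  exact ⟨max M 0, le_max_right _ _, fun w θ hθ =>
    (hM (w, θ) ⟨mem_univ _, hθ⟩).trans (le_max_left _ _)⟩

/-- The function `w ↦ ∫ conj (p(e^{iθ})) κ(w, θ) dθ`. -/
def conjIntegral (κ : C(Circle × ℝ, ℂ)) (p : C(Circle, ℂ)) : C(Circle, ℂ) where
  toFun w := ∫ θ in (0 : ℝ)..(2 * π), conj (p (Circle.exp θ)) * κ (w, θ)
  continuous_toFun := by
    refine intervalIntegral.continuous_parametric_intervalIntegral_of_continuous'
      (f := fun w θ => conj (p (Circle.exp θ)) * κ (w, θ)) ?_ 0 (2 * π)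
    have : Continuous fun q : Circle × ℝ => conj (p (Circle.exp q.2)) :=
      continuous_conj.comp (p.continuous.comp (Circle.exp.continuous.comp continuous_snd))
    exact this.mul (by fun_prop)

theorem continuous_conj_comp_exp (p : C(Circle, ℂ)) :
    Continuous fun θ : ℝ => conj (p (Circle.exp θ)) :=
  continuous_conj.comp (p.continuous.comp Circle.exp.continuous)

theorem norm_conjIntegral_apply_le {κ : C(Circle × ℝ, ℂ)} {M : ℝ}
    (hM : ∀ w, ∀ θ ∈ Icc (0 : ℝ) (2 * π), ‖κ (w, θ)‖ ≤ M) (p : C(Circle, ℂ)) (w : Circle) :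
    ‖conjIntegral κ p w‖ ≤ M * (2 * π) * ‖p‖ := by
  have h := intervalIntegral.norm_integral_le_of_norm_le_const (a := 0) (b := 2 * π)
    (f := fun θ => conj (p (Circle.exp θ)) * κ (w, θ)) (C := ‖p‖ * M) fun θ hθ => by
      rw [uIoc_of_le Real.two_pi_pos.le] at hθ
      rw [norm_mul, RCLike.norm_conj]
      exact mul_le_mul (p.norm_coe_le_norm _) (hM w θ (Ioc_subset_Icc_self hθ)) (norm_nonneg _)
        (norm_nonneg _)
  rw [sub_zero, abs_of_pos Real.two_pi_pos] at h
  exact h.trans (le_of_eq (by ring))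

theorem dist_conjIntegral_apply_le (κ : C(Circle × ℝ, ℂ)) (p : C(Circle, ℂ)) (w w' : Circle) :
    dist (conjIntegral κ p w) (conjIntegral κ p w') ≤ ‖p‖ * kernelModulus κ w w' := by
  have hc : ∀ w, Continuous fun θ => conj (p (Circle.exp θ)) * κ (w, θ) := fun w =>
    (continuous_conj_comp_exp p).mul (by fun_prop)
  have hκ : Continuous fun θ => ‖κ (w, θ) - κ (w', θ)‖ := by fun_prop
  change dist (∫ θ in (0 : ℝ)..(2 * π), _) (∫ θ in (0 : ℝ)..(2 * π), _) ≤ _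
  rw [dist_eq_norm, ← intervalIntegral.integral_sub ((hc w).intervalIntegrable _ _)
    ((hc w').intervalIntegrable _ _), kernelModulus, ← intervalIntegral.integral_const_mul]
  refine intervalIntegral.norm_integral_le_of_norm_le Real.two_pi_pos.le
    (Eventually.of_forall fun θ _ => ?_) ((continuous_const.mul hκ).intervalIntegrable _ _)
  rw [← mul_sub, norm_mul, RCLike.norm_conj]
  exact mul_le_mul_of_nonneg_right (p.norm_coe_le_norm _) (norm_nonneg _)

/-- `conjIntegral` as a real-linear operator. -/
def conjIntegralOp (κ : C(Circle × ℝ, ℂ)) : C(Circle, ℂ) →L[ℝ] C(Circle, ℂ) :=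
  LinearMap.mkContinuousOfExistsBound
    { toFun := conjIntegral κ
      map_add' := fun p q => by
        ext w
        have hc : ∀ p : C(Circle, ℂ), Continuous fun θ => conj (p (Circle.exp θ)) * κ (w, θ) :=
          fun p => (continuous_conj_comp_exp p).mul (by fun_prop)
        simp only [conjIntegral, ContinuousMap.coe_mk, ContinuousMap.add_apply]
        rw [← intervalIntegral.integral_add ((hc p).intervalIntegrable _ _)
          ((hc q).intervalIntegrable _ _)]
        simp [add_mul]
      map_smul' := fun a p => by
        ext w
        simp only [conjIntegral, ContinuousMap.coe_mk, ContinuousMap.smul_apply, RingHom.id_apply]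
        rw [← intervalIntegral.integral_smul]
        simp [mul_assoc] }
    (by
      obtain ⟨M, hM0, hM⟩ := exists_norm_kernel_le κ
      exact ⟨M * (2 * π), fun p => (ContinuousMap.norm_le _ (by positivity)).2
        (norm_conjIntegral_apply_le hM p)⟩)

theorem conjIntegralOp_apply (κ : C(Circle × ℝ, ℂ)) (p : C(Circle, ℂ)) (w : Circle) :
    conjIntegralOp κ p w = ∫ θ in (0 : ℝ)..(2 * π), conj (p (Circle.exp θ)) * κ (w, θ) := rfl

/-- Arzelà–Ascoli: the images of the unit ball are uniformly bounded and share the modulus of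
continuity `kernelModulus`. -/
theorem isCompactOperator_conjIntegralOp (κ : C(Circle × ℝ, ℂ)) :
    IsCompactOperator (conjIntegralOp κ) := by
  obtain ⟨M, hM0, hM⟩ := exists_norm_kernel_le κ
  let S' : Set (Circle → ℂ) := {g | (∀ w, g w ∈ closedBall (0 : ℂ) (M * (2 * π))) ∧
    ∀ w w', dist (g w) (g w') ≤ kernelModulus κ w w'}
  let S : Set C(Circle, ℂ) := {f | ⇑f ∈ S'}
  have hmod : ∀ w, Tendsto (kernelModulus κ w) (𝓝 w) (𝓝 0) := fun w => by
    have := (continuous_kernelModulus κ w).tendsto w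
    simpa [kernelModulus] using this
  have hS' : IsCompact S' := by
    refine (isCompact_univ_pi fun _ : Circle =>
      isCompact_closedBall (0 : ℂ) (M * (2 * π))).of_isClosed_subset ?_
      fun g hg w _ => hg.1 w
    simp only [S', ofPred_and, ofPred_forall]
    refine IsClosed.inter (isClosed_iInter fun w => ?_)
      (isClosed_iInter fun w => isClosed_iInter fun w' => ?_)
    · exact isClosed_closedBall.preimage (continuous_apply w)
    · exact isClosed_le ((continuous_apply w).dist (continuous_apply w')) continuous_const
  have hcont : ∀ g ∈ S', Continuous g := fun g hg => by
    rw [continuous_iff_continuousAt]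
    intro w
    rw [ContinuousAt, tendsto_iff_dist_tendsto_zero]
    refine squeeze_zero (fun _ => dist_nonneg) (fun w' => ?_) (hmod w)
    rw [dist_comm]
    exact hg.2 w w'
  -- The bound and the modulus are closed conditions, so they define a compact set in the topology
  -- of pointwise convergence. The modulus makes its members continuous, so nothing is lost in
  -- passing to C(Circle, ℂ), where equicontinuity upgrades compactness to the uniform topology.
  have himg : ContinuousMap.toFun '' S = S' := by
    ext g
    constructor
    · rintro ⟨f, hf, rfl⟩
      exact hf
    · exact fun hg => ⟨⟨g, hcont g hg⟩, hg, rfl⟩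
  have hS : IsCompact S := by
    refine ArzelaAscoli.isCompact_of_equicontinuous S (himg ▸ hS') fun w => ?_
    refine Metric.equicontinuousAt_of_continuity_modulus _ (hmod w) _ ?_
    exact Eventually.of_forall fun w' f => f.2.2 w w'
  refine ⟨S, hS, mem_of_superset (closedBall_mem_nhds 0 one_pos) fun p hp => ?_⟩
  rw [mem_closedBall_zero_iff] at hp
  refine ⟨fun w => ?_, fun w w' => ?_⟩
  · rw [mem_closedBall_zero_iff]
    refine (norm_conjIntegral_apply_le hM p w).trans ?_
    exact mul_le_of_le_one_right (by positivity) hp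
  · refine (dist_conjIntegral_apply_le κ p w w').trans ?_
    refine mul_le_of_le_one_left ?_ hp
    exact intervalIntegral.integral_nonneg Real.two_pi_pos.le fun _ _ => norm_nonneg _

/-- The Fredholm alternative for `1 + conjIntegralOp κ`. -/
theorem exists_add_conjIntegralOp_eq (κ : C(Circle × ℝ, ℂ))
    (hκ : ∀ p, p + conjIntegralOp κ p = 0 → p = 0) (g : C(Circle, ℂ)) :
    ∃ p, p + conjIntegralOp κ p = g := by
  -- The operator is only real-linear, so the spectral alternative is used over ℝ, at the point -1.
  rcases (isCompactOperator_conjIntegralOp κ).hasEigenvalue_or_mem_resolventSet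
    (μ := (-1 : ℝ)) (by norm_num) with h | h
  · obtain ⟨p, hp⟩ := h.exists_hasEigenvector
    refine absurd (hκ p ?_) hp.2
    have := hp.apply_eq_smul
    rw [neg_one_smul] at this
    change conjIntegralOp κ p = -p at this
    rw [this, add_neg_cancel]
  · rw [spectrum.mem_resolventSet_iff] at h
    obtain ⟨S, hS⟩ := h.exists_right_inv
    -- S is a right inverse of -1 - K, hence the sign.
    refine ⟨-(S g), ?_⟩
    have := congrArg (fun A : C(Circle, ℂ) →L[ℝ] C(Circle, ℂ) => A g) hS
    simp only [map_neg, map_one, mul_apply_eq_comp, sub_apply, neg_apply,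
      one_apply_eq_self] at this
    rw [map_neg, ← sub_eq_add_neg]
    exact this

end

/-! ### The layer potential and its boundary integral equation. -/

section

/-- Radii `1 < R < R'` for which sources on the circle of radius `1/R` and field points in the disk of
radius `R'` stay away from all image poles. -/
structure Radii (P c R R' : ℝ) : Prop where
  one_lt : 1 < R
  lt : R < R'
  lt_period : R' + R⁻¹ < P
  lt_gap : R' + R⁻¹ < 2 * c

namespace Radii

variable {P c R R' : ℝ}

theorem pos (h : Radii P c R R') : 0 < R := one_pos.trans h.one_lt

theorem inv_lt_one (h : Radii P c R R') : R⁻¹ < 1 := inv_lt_one_of_one_lt₀ h.one_lt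

theorem inv_pos (h : Radii P c R R') : 0 < R⁻¹ := _root_.inv_pos.2 h.pos

theorem period_pos (h : Radii P c R R') : 0 < P := by
  linarith [h.lt_period, h.inv_pos, h.pos, h.lt]

end Radii

/-- The source density `conj (p(e^{iθ})) s` at the point `s = e^{iθ}/R`. -/
def density (R : ℝ) (p : C(Circle, ℂ)) (θ : ℝ) : ℂ :=
  conj (p (Circle.exp θ)) * circleMap 0 R⁻¹ θ

/-- The holomorphic potential of the `iP`-periodic arrays of sources around `c` and `-c`. -/
def layer (P c R : ℝ) (p : C(Circle, ℂ)) (z : ℂ) : ℂ :=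
  (2 * π : ℂ)⁻¹ *
    ((∫ θ in (0 : ℝ)..(2 * π), density R p θ * cothKernel P (z + -(c + circleMap 0 R⁻¹ θ))) +
      ∫ θ in (0 : ℝ)..(2 * π), density R p θ * cothKernel P (z + (c + circleMap 0 R⁻¹ θ)))

/-- The part of the potential `layer`, as a function of `ζ = z - c`, that is regular in the
disk around `c`. -/
def regPart (P c R : ℝ) (p : C(Circle, ℂ)) (ζ : ℂ) : ℂ :=
  (2 * π : ℂ)⁻¹ *
    ((∫ θ in (0 : ℝ)..(2 * π), density R p θ * regKernel P (ζ + -circleMap 0 R⁻¹ θ)) +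
      ∫ θ in (0 : ℝ)..(2 * π), density R p θ * cothKernel P (ζ + (2 * c + circleMap 0 R⁻¹ θ)))

variable {P c R R' : ℝ}

theorem continuous_density (R : ℝ) (p : C(Circle, ℂ)) : Continuous (density R p) :=
  (continuous_conj_comp_exp p).mul (continuous_circleMap _ _)

theorem norm_circleMap_inv (h : Radii P c R R') (θ : ℝ) : ‖circleMap 0 R⁻¹ θ‖ = R⁻¹ := by
  rw [norm_circleMap_zero, abs_of_pos h.inv_pos]

theorem sub_mem_ball (h : Radii P c R R') {ζ : ℂ} (hζ : ζ ∈ ball (0 : ℂ) R') (θ : ℝ) :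
    ζ + -circleMap 0 R⁻¹ θ ∈ ball (0 : ℂ) P := by
  rw [mem_ball_zero_iff] at hζ ⊢
  have := norm_add_le ζ (-circleMap 0 R⁻¹ θ)
  rw [norm_neg, norm_circleMap_inv h] at this
  linarith [h.lt_period]

theorem expSub_add_gap_ne_zero (h : Radii P c R R') {ζ : ℂ} (hζ : ζ ∈ ball (0 : ℂ) R') (θ : ℝ) :
    expSub P (ζ + (2 * c + circleMap 0 R⁻¹ θ)) ≠ 0 := by
  refine expSub_ne_zero_of_re_ne_zero h.period_pos (ne_of_gt ?_)
  rw [mem_ball_zero_iff] at hζ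
  have h1 := abs_re_le_norm ζ
  have h2 := abs_re_le_norm (circleMap 0 R⁻¹ θ)
  rw [norm_circleMap_inv h] at h2
  have h3 := neg_abs_le ζ.re
  have h4 := neg_abs_le (circleMap 0 R⁻¹ θ).re
  have h5 : (ζ + (2 * c + circleMap 0 R⁻¹ θ)).re = ζ.re + (2 * c + (circleMap 0 R⁻¹ θ).re) := by
    simp
  rw [h5]
  linarith [h.lt_gap]

theorem differentiableOn_regPart (h : Radii P c R R') (p : C(Circle, ℂ)) :
    DifferentiableOn ℂ (regPart P c R p) (ball 0 R') := by
  intro ζ hζ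
  have h1 := analyticAt_integral_shift isOpen_ball (differentiableOn_regKernel h.period_pos)
    (continuous_density R p) (continuous_circleMap 0 R⁻¹).neg Real.two_pi_pos.le
    (fun θ _ => sub_mem_ball h hζ θ)
  have h2 := analyticAt_integral_shift (isOpen_expSub_ne_zero P) (differentiableOn_cothKernel P)
    (continuous_density R p) (continuous_const.add (continuous_circleMap 0 R⁻¹))
    Real.two_pi_pos.le (fun θ _ => expSub_add_gap_ne_zero h hζ θ)
  exact ((h1.differentiableAt.add h2.differentiableAt).const_mul _).differentiableWithinAt

theorem mul_circle_mem_ball (h : Radii P c R R') (w : Circle) :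
    (R * w : ℂ) ∈ ball (0 : ℂ) R' := by
  rw [mem_ball_zero_iff, norm_mul, Circle.norm_coe, mul_one, norm_real, Real.norm_eq_abs,
    abs_of_pos h.pos]
  exact h.lt

theorem zero_mem_ball (h : Radii P c R R') : (0 : ℂ) ∈ ball (0 : ℂ) R' :=
  mem_ball_self (h.pos.trans h.lt)

theorem continuous_fieldKernel (h : Radii P c R R') {X : Type*} [TopologicalSpace X]
    {ζ : X → ℂ} (hζ : Continuous ζ) (hm : ∀ x, ζ x ∈ ball (0 : ℂ) R') :
    Continuous fun q : X × ℝ => regKernel P (ζ q.1 + -circleMap 0 R⁻¹ q.2) +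
      cothKernel P (ζ q.1 + (2 * c + circleMap 0 R⁻¹ q.2)) := by
  have hc := (continuous_circleMap 0 R⁻¹).comp (continuous_snd (X := X) (Y := ℝ))
  have hz := hζ.comp (continuous_fst (X := X) (Y := ℝ))
  refine Continuous.add ?_ ?_
  · exact (differentiableOn_regKernel h.period_pos).continuousOn.comp_continuous
      (hz.add hc.neg) fun q => sub_mem_ball h (hm q.1) q.2
  · exact (differentiableOn_cothKernel P).continuousOn.comp_continuous
      (hz.add (continuous_const.add hc)) fun q => expSub_add_gap_ne_zero h (hm q.1) q.2

/-- The kernel of the boundary integral operator on the circle of radius `R`. -/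
def boundaryKernel (h : Radii P c R R') : C(Circle × ℝ, ℂ) where
  toFun q := (2 * π : ℂ)⁻¹ * circleMap 0 R⁻¹ q.2 *
    ((regKernel P (R * q.1 + -circleMap 0 R⁻¹ q.2) +
        cothKernel P (R * q.1 + (2 * c + circleMap 0 R⁻¹ q.2))) -
      (regKernel P (0 + -circleMap 0 R⁻¹ q.2) + cothKernel P (0 + (2 * c + circleMap 0 R⁻¹ q.2))))
  continuous_toFun := by
    refine (continuous_const.mul ((continuous_circleMap 0 R⁻¹).comp continuous_snd)).mul
      (Continuous.sub ?_ ?_)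
    · exact continuous_fieldKernel h (ζ := fun w : Circle => (R * w : ℂ))
        (continuous_const.mul continuous_subtype_val) (mul_circle_mem_ball h)
    · exact continuous_fieldKernel h (ζ := fun _ : Circle => (0 : ℂ)) continuous_const
        fun _ => zero_mem_ball h

theorem regPart_eq_integral (h : Radii P c R R') (p : C(Circle, ℂ)) {ζ : ℂ}
    (hζ : ζ ∈ ball (0 : ℂ) R') :
    regPart P c R p ζ = ∫ θ in (0 : ℝ)..(2 * π), (2 * π : ℂ)⁻¹ * (density R p θ *
      (regKernel P (ζ + -circleMap 0 R⁻¹ θ) +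
        cothKernel P (ζ + (2 * c + circleMap 0 R⁻¹ θ)))) := by
  have hc := continuous_circleMap 0 R⁻¹
  have h1 : Continuous fun θ => density R p θ * regKernel P (ζ + -circleMap 0 R⁻¹ θ) :=
    (continuous_density R p).mul ((differentiableOn_regKernel h.period_pos).continuousOn.comp_continuous
      (continuous_const.add hc.neg) fun θ => sub_mem_ball h hζ θ)
  have h2 : Continuous fun θ => density R p θ * cothKernel P (ζ + (2 * c + circleMap 0 R⁻¹ θ)) :=
    (continuous_density R p).mul ((differentiableOn_cothKernel P).continuousOn.comp_continuous
      (continuous_const.add (continuous_const.add hc)) fun θ => expSub_add_gap_ne_zero h hζ θ)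
  rw [regPart, intervalIntegral.integral_const_mul,
    ← intervalIntegral.integral_add (h1.intervalIntegrable _ _) (h2.intervalIntegrable _ _)]
  simp only [mul_add]

/-- Identifies the boundary integral equation with p + Kp = g: the values at the origin are
subtracted so that the extension q vanishes at 0, as the reflection formula requires. -/
theorem conjIntegralOp_boundaryKernel (h : Radii P c R R') (p : C(Circle, ℂ)) (w : Circle) :
    conjIntegralOp (boundaryKernel h) p w = regPart P c R p (R * w) - regPart P c R p 0 := by
  have hcont : ∀ ζ ∈ ball (0 : ℂ) R', Continuous fun θ : ℝ => (2 * π : ℂ)⁻¹ * (density R p θ *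
      (regKernel P (ζ + -circleMap 0 R⁻¹ θ) +
        cothKernel P (ζ + (2 * c + circleMap 0 R⁻¹ θ)))) := fun ζ hζ => by
    have := (continuous_fieldKernel h (ζ := fun _ : Unit => ζ) continuous_const
      fun _ => hζ).comp (Continuous.prodMk_right ())
    exact continuous_const.mul ((continuous_density R p).mul this)
  rw [conjIntegralOp_apply, regPart_eq_integral h p (mul_circle_mem_ball h w),
    regPart_eq_integral h p (zero_mem_ball h), ← intervalIntegral.integral_sub
      ((hcont _ (mul_circle_mem_ball h w)).intervalIntegrable _ _)
      ((hcont _ (zero_mem_ball h)).intervalIntegrable _ _)]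
  refine intervalIntegral.integral_congr fun θ _ => ?_
  simp only [boundaryKernel, ContinuousMap.coe_mk, density]
  ring

/-- The Cauchy integral formula outside the circle of radius `1/R`, for the reflection
`ζ ↦ conj (q(1/conj ζ))` of a function holomorphic in the disk of radius `R`. -/
theorem integral_conj_mul_div_sub {q : ℂ → ℂ} (hR : 0 < R) {U : Set ℂ} (hU : IsOpen U)
    (hsub : closedBall 0 R ⊆ U) (hq : DifferentiableOn ℂ q U) (hq0 : q 0 = 0) {ζ : ℂ}
    (hζ : R⁻¹ < ‖ζ‖) :
    ∫ θ in (0 : ℝ)..(2 * π), conj (q (circleMap 0 R θ)) * circleMap 0 R⁻¹ θ *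
      (ζ + -circleMap 0 R⁻¹ θ)⁻¹ = 2 * π * conj (q ((conj ζ)⁻¹)) := by
  have hζ0 : ζ ≠ 0 := by
    rintro rfl
    rw [norm_zero] at hζ
    exact absurd (inv_pos.2 hR) hζ.not_gt
  -- The reflection of ζ in the unit circle; |ζ| > 1/R puts it inside the disk of radius R.
  set w : ℂ := (conj ζ)⁻¹ with hw
  have hζc : conj ζ ≠ 0 := by simpa using hζ0
  have hwn : w ∈ ball (0 : ℂ) R := by
    rw [mem_ball_zero_iff, hw, norm_inv, RCLike.norm_conj]
    exact inv_lt_of_inv_lt₀ hR hζ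
  have hw0 : w ≠ 0 := inv_ne_zero hζc
  have hU0 : (0 : ℂ) ∈ U := hsub (mem_closedBall_self hR.le)
  -- Since q(0) = 0, the quotient q(t)/t is holomorphic. Cauchy's formula is applied to it, so that
  -- the factor t in dt = i t dθ cancels.
  have hd : DifferentiableOn ℂ (dslope q 0) U :=
    (differentiableOn_dslope (hU.mem_nhds hU0)).2 hq
  have hdq : ∀ t ≠ 0, dslope q 0 t = q t / t := fun t ht => by
    rw [dslope_of_ne _ ht, slope_def_field, hq0, sub_zero, sub_zero]
  have hC := (hd.mono hsub).circleIntegral_sub_inv_smul hwn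
  rw [circleIntegral, hdq w hw0] at hC
  have hcongr : ∀ θ : ℝ, deriv (circleMap 0 R) θ • ((circleMap 0 R θ - w)⁻¹ •
      dslope q 0 (circleMap 0 R θ)) = I * (q (circleMap 0 R θ) * (circleMap 0 R θ - w)⁻¹) := by
    intro θ
    have ht : circleMap 0 R θ ≠ 0 := circleMap_ne_center hR.ne'
    rw [hdq _ ht, deriv_circleMap, smul_eq_mul, smul_eq_mul]
    field_simp
  simp only [hcongr] at hC
  rw [intervalIntegral.integral_const_mul, smul_eq_mul] at hC
  have hC' : ∫ θ in (0 : ℝ)..(2 * π), q (circleMap 0 R θ) * (circleMap 0 R θ - w)⁻¹ =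
      2 * π * (q w / w) := by
    apply mul_left_cancel₀ I_ne_zero
    rw [hC]
    ring
  -- The source e^{iθ}/R is the reflection of the point R e^{iθ}; conjugation therefore turns the
  -- integrand into the Cauchy kernel at w.
  have hs : ∀ θ : ℝ, conj (circleMap 0 R⁻¹ θ) = (circleMap 0 R θ)⁻¹ := by
    intro θ
    simp only [circleMap, zero_add, map_mul, conj_ofReal, mul_inv, ofReal_inv, ← exp_neg, ← exp_conj]
    simp
  have hpt : ∀ θ : ℝ, conj (q (circleMap 0 R θ)) * circleMap 0 R⁻¹ θ *
      (ζ + -circleMap 0 R⁻¹ θ)⁻¹ =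
      conj (w * (q (circleMap 0 R θ) * (circleMap 0 R θ - w)⁻¹)) := by
    intro θ
    have ht : circleMap 0 R θ ≠ 0 := circleMap_ne_center hR.ne'
    have htw : circleMap 0 R θ - w ≠ 0 := by
      intro h0
      rw [sub_eq_zero] at h0
      rw [← h0, mem_ball_zero_iff, norm_circleMap_zero, abs_of_pos hR] at hwn
      exact lt_irrefl _ hwn
    have h3 : circleMap 0 R⁻¹ θ * (ζ + -circleMap 0 R⁻¹ θ)⁻¹ =
        conj (w * (circleMap 0 R θ - w)⁻¹) := by
      apply (starRingEnd ℂ).injective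
      have hζw : conj ζ = w⁻¹ := by rw [hw, inv_inv]
      rw [conj_conj, map_mul, map_inv₀, map_add, map_neg, hs, hζw]
      have : w⁻¹ + -(circleMap 0 R θ)⁻¹ = (circleMap 0 R θ - w) / (w * circleMap 0 R θ) := by
        field_simp
        ring
      rw [this]
      field_simp
    rw [mul_assoc, h3, ← map_mul]
    congr 1
    ring
  simp only [hpt]
  have hconj : ∀ f : ℝ → ℂ, ∫ θ in (0 : ℝ)..(2 * π), conj (f θ) =
      conj (∫ θ in (0 : ℝ)..(2 * π), f θ) := fun f => by
    rw [intervalIntegral.integral_of_le Real.two_pi_pos.le,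
      intervalIntegral.integral_of_le Real.two_pi_pos.le]
    exact integral_conj
  rw [hconj, intervalIntegral.integral_const_mul, hC', ← mul_assoc, map_mul]
  rw [show conj (w * (2 * π)) * conj (q w / w) = conj (w * (2 * π) * (q w / w)) from (map_mul _ _ _).symm,
    show w * (2 * π) * (q w / w) = 2 * π * q w by field_simp, map_mul]
  simp [conj_ofNat]

/-- The holomorphic extension to the disk of radius `R'` of a solution `p` of the boundary
integral equation with data `d`. -/
def extension (P c R : ℝ) (d : ℂ → ℂ) (p : C(Circle, ℂ)) (ζ : ℂ) : ℂ :=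
  -(d ζ - d 0) - (regPart P c R p ζ - regPart P c R p 0)

theorem extension_zero (d : ℂ → ℂ) (p : C(Circle, ℂ)) : extension P c R d p 0 = 0 := by
  simp [extension]

theorem differentiableOn_extension (h : Radii P c R R') {d : ℂ → ℂ}
    (hd : DifferentiableOn ℂ d (ball 0 R')) (p : C(Circle, ℂ)) :
    DifferentiableOn ℂ (extension P c R d p) (ball 0 R') :=
  (hd.sub_const _).neg.sub ((differentiableOn_regPart h p).sub_const _)

/-- The boundary integral equation with data `d`. -/
def IsDensity (P c R : ℝ) (d : ℂ → ℂ) (p : C(Circle, ℂ)) : Prop :=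
  ∀ w : Circle, p w = extension P c R d p (R * w)

/-- Near c only the pole 1/(ζ - s) of the array around c is singular. The density consists of the
boundary values of q on |ζ| = R, so the exterior Cauchy formula sums these poles to the reflection
of q; everything else is `regPart`. -/
theorem layer_eq_conj_extension_add_regPart (h : Radii P c R R') {d : ℂ → ℂ}
    (hd : DifferentiableOn ℂ d (ball 0 R')) {p : C(Circle, ℂ)} (hp : IsDensity P c R d p)
    {ζ : ℂ} (hζ : R⁻¹ < ‖ζ‖) (hζ' : ‖ζ‖ < R') :
    layer P c R p (c + ζ) = conj (extension P c R d p ((conj ζ)⁻¹)) + regPart P c R p ζ := by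
  have hζb : ζ ∈ ball (0 : ℂ) R' := by simpa using hζ'
  have hcm := continuous_circleMap 0 R⁻¹
  have hne : ∀ θ, ζ + -circleMap 0 R⁻¹ θ ≠ 0 := fun θ h0 => by
    have : ζ = circleMap 0 R⁻¹ θ := by linear_combination h0
    rw [this, norm_circleMap_inv h] at hζ
    exact lt_irrefl _ hζ
  have h1 : ∀ θ, density R p θ * cothKernel P (c + ζ + -(c + circleMap 0 R⁻¹ θ)) =
      conj (extension P c R d p (circleMap 0 R θ)) * circleMap 0 R⁻¹ θ *
        (ζ + -circleMap 0 R⁻¹ θ)⁻¹ + density R p θ * regKernel P (ζ + -circleMap 0 R⁻¹ θ) := by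
    intro θ
    have e1 : (c : ℂ) + ζ + -(c + circleMap 0 R⁻¹ θ) = ζ + -circleMap 0 R⁻¹ θ := by ring
    have e2 : circleMap 0 R θ = R * (Circle.exp θ : ℂ) := by simp [circleMap]
    rw [e1, cothKernel_eq_inv_add_regKernel h.period_pos (hne θ)
      (by simpa using sub_mem_ball h hζb θ), e2, ← hp, density]
    ring
  have h2 : ∀ θ, (c : ℂ) + ζ + (c + circleMap 0 R⁻¹ θ) = ζ + (2 * c + circleMap 0 R⁻¹ θ) :=
    fun θ => by ring
  have hsub : closedBall (0 : ℂ) R ⊆ ball 0 R' := closedBall_subset_ball h.lt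
  have hcont : Continuous fun θ => conj (extension P c R d p (circleMap 0 R θ)) *
      circleMap 0 R⁻¹ θ * (ζ + -circleMap 0 R⁻¹ θ)⁻¹ := by
    refine ((continuous_conj.comp ?_).mul hcm).mul ((continuous_const.add hcm.neg).inv₀ hne)
    refine (differentiableOn_extension h hd p).continuousOn.comp_continuous
      (continuous_circleMap 0 R) fun θ => hsub ?_
    simp [abs_of_pos h.pos]
  have hcont2 : Continuous fun θ => density R p θ * regKernel P (ζ + -circleMap 0 R⁻¹ θ) :=
    (continuous_density R p).mul ((differentiableOn_regKernel h.period_pos).continuousOn.comp_continuous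
      (continuous_const.add hcm.neg) fun θ => sub_mem_ball h hζb θ)
  rw [layer, regPart]
  simp only [h1, h2]
  rw [intervalIntegral.integral_add (hcont.intervalIntegrable _ _)
    (hcont2.intervalIntegrable _ _), integral_conj_mul_div_sub h.pos isOpen_ball hsub
    (differentiableOn_extension h hd p) (extension_zero d p) hζ]
  have hpi : (π : ℂ) ≠ 0 := by exact_mod_cast Real.pi_ne_zero
  field_simp
  ring

/-- The unit circle is fixed by the reflection, and the definition of `extension` eliminates
`regPart` in favour of q and d. -/
theorem layer_on_circle (h : Radii P c R R') {d : ℂ → ℂ}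
    (hd : DifferentiableOn ℂ d (ball 0 R')) {p : C(Circle, ℂ)} (hp : IsDensity P c R d p)
    {ζ : ℂ} (hζ : ‖ζ‖ = 1) :
    layer P c R p (c + ζ) = conj (extension P c R d p ζ) - extension P c R d p ζ - d ζ +
      (d 0 + regPart P c R p 0) := by
  have hinv : (conj ζ)⁻¹ = ζ := by
    rw [inv_eq_iff_eq_inv, inv_def, normSq_eq_norm_sq, hζ]
    simp
  rw [layer_eq_conj_extension_add_regPart h hd hp (by rw [hζ]; exact h.inv_lt_one)
    (by rw [hζ]; exact h.one_lt.trans h.lt), hinv]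
  simp only [extension]
  ring

/-- The difference conj q - q is purely imaginary. This is the Dirichlet condition that the integral
equation was designed for. -/
theorem re_layer_on_circle (h : Radii P c R R') {d : ℂ → ℂ}
    (hd : DifferentiableOn ℂ d (ball 0 R')) {p : C(Circle, ℂ)} (hp : IsDensity P c R d p)
    {ζ : ℂ} (hζ : ‖ζ‖ = 1) :
    (layer P c R p (c + ζ)).re + (d ζ).re = (d 0 + regPart P c R p 0).re := by
  rw [layer_on_circle h hd hp hζ]
  simp

/-- Fredholm alternative with right side -(d - d(0)) on the circle of radius R. -/
theorem exists_isDensity (h : Radii P c R R')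
    (hinj : ∀ p, IsDensity P c R 0 p → p = 0) {d : ℂ → ℂ}
    (hd : DifferentiableOn ℂ d (ball 0 R')) : ∃ p, IsDensity P c R d p := by
  let g : C(Circle, ℂ) := ⟨fun w => -(d (R * w) - d 0), by
    have : Continuous fun w : Circle => d (R * w) := hd.continuousOn.comp_continuous
      (continuous_const.mul continuous_subtype_val) (mul_circle_mem_ball h)
    exact (this.sub continuous_const).neg⟩
  obtain ⟨p, hp⟩ := exists_add_conjIntegralOp_eq (boundaryKernel h) (fun p hp => hinj p fun w => by
    have := congrArg (fun f : C(Circle, ℂ) => f w) hp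
    simp only [ContinuousMap.add_apply, conjIntegralOp_boundaryKernel,
      ContinuousMap.zero_apply] at this
    rw [extension, eq_sub_iff_add_eq, this]
    simp) g
  refine ⟨p, fun w => ?_⟩
  have := congrArg (fun f : C(Circle, ℂ) => f w) hp
  simp only [ContinuousMap.add_apply, conjIntegralOp_boundaryKernel] at this
  rw [extension, eq_sub_iff_add_eq]
  exact this

end

/-! ### Uniqueness for the boundary integral equation. -/

section

variable {P c R R' : ℝ}

/-- A closed part of the plane, wider than one period, outside the open unit disks
around `c` and `-c`. -/
def wideCell (P c : ℝ) : Set ℂ := {z | |z.im| ≤ P - 1 ∧ 1 ≤ ‖z - c‖ ∧ 1 ≤ ‖z + c‖}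

/-- The points at distance greater than `r` from `±c + iPℤ`. -/
def farSet (P c r : ℝ) : Set ℂ :=
  {z | ∀ n : ℤ, r < ‖z - c - n * P * I‖ ∧ r < ‖z + c - n * P * I‖}

/-- The bound P - 1 on |Im z| keeps a vertical distance of at least 1 to every centre with n ≠ 0. -/
theorem wideCell_subset_farSet (hP : 0 < P) {r : ℝ} (hr : r < 1) :
    wideCell P c ⊆ farSet P c r := by
  rintro z ⟨hz, h1, h2⟩ n
  rcases eq_or_ne n 0 with rfl | hn
  · simp only [Int.cast_zero, zero_mul, sub_zero]
    exact ⟨hr.trans_le h1, hr.trans_le h2⟩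
  · have hn' : (1 : ℝ) ≤ |(n : ℝ)| := by exact_mod_cast Int.one_le_abs hn
    have h3 : 1 ≤ |z.im - n * P| := by
      have := abs_sub_abs_le_abs_sub (n * P) z.im
      rw [abs_mul, abs_of_pos hP, abs_sub_comm] at this
      nlinarith
    constructor
    · refine hr.trans_le (h3.trans (le_trans (le_of_eq ?_) (abs_im_le_norm _)))
      simp
    · refine hr.trans_le (h3.trans (le_trans (le_of_eq ?_) (abs_im_le_norm _)))
      simp

theorem expSub_ne_zero_of_mem_farSet (h : Radii P c R R') {z : ℂ} (hz : z ∈ farSet P c R⁻¹)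
    (θ : ℝ) : expSub P (z + -(c + circleMap 0 R⁻¹ θ)) ≠ 0 ∧
      expSub P (z + (c + circleMap 0 R⁻¹ θ)) ≠ 0 := by
  simp only [Ne, expSub_eq_zero_iff h.period_pos]
  constructor
  · rintro ⟨n, hn⟩
    have h1 : z - c - n * P * I = circleMap 0 R⁻¹ θ := by linear_combination hn
    have h2 := (hz n).1
    rw [h1, norm_circleMap_inv h] at h2
    exact lt_irrefl _ h2
  · rintro ⟨n, hn⟩
    have h1 : z + c - n * P * I = -circleMap 0 R⁻¹ θ := by linear_combination hn
    have h2 := (hz n).2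
    rw [h1, norm_neg, norm_circleMap_inv h] at h2
    exact lt_irrefl _ h2

theorem analyticAt_layer (h : Radii P c R R') (p : C(Circle, ℂ)) {z : ℂ}
    (hz : z ∈ farSet P c R⁻¹) : AnalyticAt ℂ (layer P c R p) z := by
  have hs : Continuous fun θ => (c : ℂ) + circleMap 0 R⁻¹ θ :=
    continuous_const.add (continuous_circleMap 0 R⁻¹)
  have h1 := analyticAt_integral_shift (isOpen_expSub_ne_zero P) (differentiableOn_cothKernel P)
    (continuous_density R p) hs.neg Real.two_pi_pos.le
    (fun θ _ => (expSub_ne_zero_of_mem_farSet h hz θ).1)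
  have h2 := analyticAt_integral_shift (isOpen_expSub_ne_zero P) (differentiableOn_cothKernel P)
    (continuous_density R p) hs Real.two_pi_pos.le
    (fun θ _ => (expSub_ne_zero_of_mem_farSet h hz θ).2)
  exact analyticAt_const.mul (h1.add h2)

theorem deriv_layer (h : Radii P c R R') (p : C(Circle, ℂ)) {z : ℂ}
    (hz : z ∈ farSet P c R⁻¹) : deriv (layer P c R p) z = (2 * π : ℂ)⁻¹ *
    ((∫ θ in (0 : ℝ)..(2 * π), density R p θ *
        deriv (cothKernel P) (z + -(c + circleMap 0 R⁻¹ θ))) +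
      ∫ θ in (0 : ℝ)..(2 * π), density R p θ *
        deriv (cothKernel P) (z + (c + circleMap 0 R⁻¹ θ))) := by
  have hs : Continuous fun θ => (c : ℂ) + circleMap 0 R⁻¹ θ :=
    continuous_const.add (continuous_circleMap 0 R⁻¹)
  have h1 := hasDerivAt_integral_shift (isOpen_expSub_ne_zero P) (differentiableOn_cothKernel P)
    (continuous_density R p) hs.neg Real.two_pi_pos.le
    (fun θ _ => (expSub_ne_zero_of_mem_farSet h hz θ).1)
  have h2 := hasDerivAt_integral_shift (isOpen_expSub_ne_zero P) (differentiableOn_cothKernel P)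
    (continuous_density R p) hs Real.two_pi_pos.le
    (fun θ _ => (expSub_ne_zero_of_mem_farSet h hz θ).2)
  exact ((h1.add h2).const_mul _).deriv

theorem layer_add_period (hP : 0 < P) (p : C(Circle, ℂ)) (z : ℂ) :
    layer P c R p (z + P * I) = layer P c R p z := by
  simp only [layer, add_right_comm z (P * I : ℂ), cothKernel_add_period hP]

/-- The source at c + s and the source at -(c + s) carry the same density and the coth kernel is
odd, so z ↦ -z exchanges the two arrays with a sign. -/
theorem layer_neg (h : Radii P c R R') (p : C(Circle, ℂ)) {z : ℂ}
    (hz : z ∈ farSet P c R⁻¹) : layer P c R p (-z) = -layer P c R p z := by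
  have h1 : ∀ θ, cothKernel P (-z + -(c + circleMap 0 R⁻¹ θ)) =
      -cothKernel P (z + (c + circleMap 0 R⁻¹ θ)) := fun θ => by
    rw [← neg_add, cothKernel_neg (expSub_ne_zero_of_mem_farSet h hz θ).2]
  have h2 : ∀ θ, cothKernel P (-z + (c + circleMap 0 R⁻¹ θ)) =
      -cothKernel P (z + -(c + circleMap 0 R⁻¹ θ)) := fun θ => by
    rw [← cothKernel_neg (expSub_ne_zero_of_mem_farSet h hz θ).1]
    congr 1
    ring
  simp only [layer, h1, h2, mul_neg, intervalIntegral.integral_neg]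
  ring

/-- If `G` converges as `re → ±∞`, so does `z ↦ ∫ m(θ) G(z + s(θ)) dθ`. -/
theorem tendsto_integral_shift {G : ℂ → ℂ} {L : ℂ} {l : Filter ℝ} [l.IsCountablyGenerated]
    (hG : Tendsto G (comap re l) (𝓝 L)) {m s : ℝ → ℂ} (hm : Continuous m)
    {a b : ℝ} (hmeas : ∀ᶠ z in comap re l, Continuous fun θ => G (z + s θ))
    (hl : ∀ V ∈ l, ∀ᶠ x in l, ∀ θ, x + (s θ).re ∈ V) :
    Tendsto (fun z => ∫ θ in a..b, m θ * G (z + s θ)) (comap re l)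
      (𝓝 (∫ θ in a..b, m θ * L)) := by
  have hshift : ∀ U ∈ comap re l, ∀ᶠ z in comap re l, ∀ θ, z + s θ ∈ U := by
    rintro U ⟨V, hV, hVU⟩
    have := (hl V hV)
    filter_upwards [tendsto_comap.eventually this] with z hz θ
    exact hVU (by simpa using hz θ)
  have hb : ∀ᶠ w in comap re l, ‖G w‖ ≤ ‖L‖ + 1 := by
    have := hG.norm.eventually (gt_mem_nhds (lt_add_one ‖L‖))
    filter_upwards [this] with w hw using hw.le
  refine intervalIntegral.tendsto_integral_filter_of_dominated_convergence
    (fun θ => ‖m θ‖ * (‖L‖ + 1)) ?_ ?_ ?_ ?_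
  · filter_upwards [hmeas] with z hz
    exact (hm.mul hz).aestronglyMeasurable
  · filter_upwards [hshift _ hb] with z hz
    refine Eventually.of_forall fun θ _ => ?_
    rw [norm_mul]
    exact mul_le_mul_of_nonneg_left (hz θ) (norm_nonneg _)
  · exact (hm.norm.mul continuous_const).intervalIntegrable _ _
  · refine Eventually.of_forall fun θ _ => ?_
    refine Tendsto.const_mul _ (hG.comp ?_)
    refine fun U hU => mem_map.2 ?_
    filter_upwards [hshift U hU] with z hz using hz θ

theorem exists_tendsto_layer_atTop (h : Radii P c R R') (p : C(Circle, ℂ)) :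
    ∃ L, Tendsto (layer P c R p) (comap re atTop) (𝓝 L) := by
  have hs : Continuous fun θ => (c : ℂ) + circleMap 0 R⁻¹ θ :=
    continuous_const.add (continuous_circleMap 0 R⁻¹)
  have hre : ∀ θ, |((c : ℂ) + circleMap 0 R⁻¹ θ).re| ≤ |c| + R⁻¹ := fun θ => by
    refine (abs_re_le_norm _).trans ((norm_add_le _ _).trans ?_)
    rw [norm_circleMap_inv h, norm_real, Real.norm_eq_abs]
  have key : ∀ s : ℝ → ℂ, Continuous s → (∀ θ, |(s θ).re| ≤ |c| + R⁻¹) →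
      ∃ L, Tendsto (fun z => ∫ θ in (0 : ℝ)..(2 * π), density R p θ * cothKernel P (z + s θ))
        (comap re atTop) (𝓝 L) := fun s hs hre => by
    refine ⟨_, tendsto_integral_shift (tendsto_cothKernel_re_atTop h.period_pos)
      (continuous_density R p) ?_ ?_⟩
    · filter_upwards [tendsto_comap.eventually (eventually_gt_atTop (|c| + R⁻¹))] with z hz
      refine (differentiableOn_cothKernel P).continuousOn.comp_continuous
        (continuous_const.add hs) fun θ => expSub_ne_zero_of_re_ne_zero h.period_pos ?_
      have := (abs_le.1 (hre θ)).1
      rw [add_re]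
      linarith
    · intro V hV
      obtain ⟨A, hA⟩ := mem_atTop_sets.1 hV
      filter_upwards [eventually_ge_atTop (A + (|c| + R⁻¹))] with x hx θ
      have := (abs_le.1 (hre θ)).1
      exact hA _ (by linarith)
  obtain ⟨L₁, h1⟩ := key _ hs.neg (fun θ => by
    rw [Pi.neg_apply, neg_re, abs_neg]
    exact hre θ)
  obtain ⟨L₂, h2⟩ := key _ hs hre
  exact ⟨_, (h1.add h2).const_mul _⟩

theorem mem_farSet_of_abs_re {r : ℝ} (hr : r ≤ 1) {z : ℂ} (hz : |c| + 1 < |z.re|) :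
    z ∈ farSet P c r := by
  intro n
  have h1 := abs_sub_abs_le_abs_sub z.re c
  have h2 := abs_sub_abs_le_abs_sub z.re (-c)
  rw [abs_neg] at h2
  constructor
  · refine lt_of_lt_of_le ?_ (abs_re_le_norm _)
    have : (z - c - n * P * I).re = z.re - c := by simp
    rw [this]
    linarith
  · refine lt_of_lt_of_le ?_ (abs_re_le_norm _)
    have : (z + c - n * P * I).re = z.re - -c := by simp
    rw [this]
    linarith

theorem exists_tendsto_layer_atBot (h : Radii P c R R') (p : C(Circle, ℂ)) :
    ∃ L, Tendsto (layer P c R p) (comap re atBot) (𝓝 L) := by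
  obtain ⟨L, hL⟩ := exists_tendsto_layer_atTop h p
  have h1 : Tendsto (fun w : ℂ => -w) (comap re atBot) (comap re atTop) := by
    rw [tendsto_comap_iff]
    exact tendsto_neg_atBot_atTop.comp tendsto_comap
  refine ⟨-L, ((hL.comp h1).neg).congr' ?_⟩
  filter_upwards [tendsto_comap.eventually (eventually_lt_atBot (-(|c| + 1)))] with z hz
  rw [Function.comp_apply, layer_neg h p (mem_farSet_of_abs_re h.inv_lt_one.le ?_), neg_neg]
  rw [abs_of_neg (a := z.re) (by linarith [abs_nonneg c])]
  linarith

/-- A periodic holomorphic function outside two disks, bounded at infinity, whose real part is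
constant on each of the two circles, is locally constant. -/
theorem deriv_eq_zero_of_re_const {F : ℂ → ℂ} (hP : 2 < P)
    (hper : ∀ z, F (z + P * I) = F z) (han : ∀ z ∈ wideCell P c, AnalyticAt ℂ F z)
    {b b' : ℝ} (hb : ∀ z : ℂ, ‖z - c‖ = 1 → (F z).re = b)
    (hb' : ∀ z : ℂ, ‖z + c‖ = 1 → (F z).re = b')
    {L L' : ℂ} (hL : Tendsto F (comap re atTop) (𝓝 L)) (hL' : Tendsto F (comap re atBot) (𝓝 L'))
    {z : ℂ} (hz : |z.im| < P - 1) (hzc : 1 < ‖z - c‖) (hzc' : 1 < ‖z + c‖) : deriv F z = 0 := by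
  set O : Set ℂ := {z | |z.im| < P - 1 ∧ 1 < ‖z - c‖ ∧ 1 < ‖z + c‖} with hO
  set A : Set ℂ := {z | |z.im| ≤ P / 2 ∧ 1 ≤ ‖z - c‖ ∧ 1 ≤ ‖z + c‖} with hA
  have hOopen : IsOpen O := by
    refine (isOpen_lt (continuous_im.abs) continuous_const).inter
      ((isOpen_lt continuous_const (continuous_id.sub continuous_const).norm).inter
        (isOpen_lt continuous_const (continuous_id.add continuous_const).norm))
  have hAclosed : IsClosed A := by
    refine (isClosed_le (continuous_im.abs) continuous_const).inter
      ((isClosed_le continuous_const (continuous_id.sub continuous_const).norm).inter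
        (isClosed_le continuous_const (continuous_id.add continuous_const).norm))
  have hOW : O ⊆ wideCell P c := fun z hz => ⟨hz.1.le, hz.2.1.le, hz.2.2.le⟩
  have hAW : A ⊆ wideCell P c := fun z hz => ⟨hz.1.trans (by linarith), hz.2⟩
  have hFA : ContinuousOn F A := fun z hz => (han z (hAW hz)).continuousAt.continuousWithinAt
  -- A translation by one period brings points of the wide cell back into the closed cell. The
  -- translated points have |Im| ≥ 1, so they avoid the open disks.
  have htrans : ∀ z ∈ O, ∃ z' ∈ A, F z' = F z := by
    have him : ∀ z : ℂ, 1 ≤ |z.im| → 1 ≤ ‖z - c‖ ∧ 1 ≤ ‖z + c‖ := fun z hz =>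
      ⟨hz.trans (by simpa using abs_im_le_norm (z - c)),
        hz.trans (by simpa using abs_im_le_norm (z + c))⟩
    rintro z ⟨h1, h2, h3⟩
    rw [abs_lt] at h1
    by_cases hc1 : P / 2 < z.im
    · refine ⟨z - P * I, ⟨?_, him _ ?_⟩, ?_⟩
      · simp only [sub_im, mul_im, ofReal_re, I_im, mul_one, ofReal_im, I_re, mul_zero, add_zero]
        rw [abs_le]; constructor <;> linarith
      · simp only [sub_im, mul_im, ofReal_re, I_im, mul_one, ofReal_im, I_re, mul_zero, add_zero]
        rw [abs_of_neg (by linarith)]; linarith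
      · rw [← hper, sub_add_cancel]
    by_cases hc2 : z.im < -(P / 2)
    · refine ⟨z + P * I, ⟨?_, him _ ?_⟩, hper z⟩
      · simp only [add_im, mul_im, ofReal_re, I_im, mul_one, ofReal_im, I_re, mul_zero, add_zero]
        rw [abs_le]; constructor <;> linarith
      · simp only [add_im, mul_im, ofReal_re, I_im, mul_one, ofReal_im, I_re, mul_zero, add_zero]
        rw [abs_of_pos (by linarith)]; linarith
    · exact ⟨z, ⟨abs_le.2 ⟨by linarith, by linarith⟩, h2.le, h3.le⟩, rfl⟩
  -- The claim is that Re F takes only these four values. The open mapping theorem then excludes a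
  -- nonconstant F.
  set V : Set ℝ := {b, b', L.re, L'.re} with hV
  have hVfin : V.Finite := by simp [hV]
  have hOV : ∀ z ∈ O, (F z).re ∈ V := by
    intro z₀ hz₀
    by_contra hw
    set w := (F z₀).re
    simp only [hV, mem_insert_iff, mem_singleton_iff, not_or] at hw
    obtain ⟨hw1, hw2, hw3, hw4⟩ := hw
    have hAO : ∀ z ∈ A, (F z).re = w → z ∈ O := by
      rintro z ⟨h1, h2, h3⟩ hzw
      refine ⟨h1.trans_lt (by linarith), h2.lt_of_ne fun h => ?_, h3.lt_of_ne fun h => ?_⟩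
      · exact hw1 (hzw.symm.trans (hb z h.symm))
      · exact hw2 (hzw.symm.trans (hb' z h.symm))
    set K : Set ℂ := {z ∈ A | (F z).re = w} with hK
    have hKclosed : IsClosed K :=
      (continuous_re.comp_continuousOn hFA).preimage_isClosed_of_isClosed hAclosed
        (isClosed_singleton (x := w))
    -- A value w outside V is not attained far out, since Re F tends to other values at both ends;
    -- so the level set in the cell is compact, and it avoids both circles.
    have hKb : Bornology.IsBounded K := by
      have e1 : ∀ᶠ z in comap re atTop, (F z).re ≠ w :=
        ((continuous_re.tendsto L).comp hL).eventually_ne (Ne.symm hw3)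
      have e2 : ∀ᶠ z in comap re atBot, (F z).re ≠ w :=
        ((continuous_re.tendsto L').comp hL').eventually_ne (Ne.symm hw4)
      rw [eventually_comap] at e1 e2
      obtain ⟨x1, hx1⟩ := eventually_atTop.1 e1
      obtain ⟨x2, hx2⟩ := eventually_atBot.1 e2
      refine (((isCompact_Icc (a := x2) (b := x1)).reProdIm
        (isCompact_Icc (a := -(P / 2)) (b := P / 2))).isBounded).subset fun z hz => ?_
      refine ⟨⟨?_, ?_⟩, abs_le.1 hz.1.1⟩
      · by_contra! hlt
        exact hx2 z.re hlt.le z rfl hz.2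
      · by_contra! hlt
        exact hx1 z.re hlt.le z rfl hz.2
    have hKc : IsCompact K := isCompact_of_isClosed_isBounded hKclosed hKb
    have hKne : K.Nonempty := by
      obtain ⟨z', hz', hF⟩ := htrans z₀ hz₀
      exact ⟨z', hz', by rw [hF]⟩
    have hKA : K ⊆ A := fun z hz => hz.1
    obtain ⟨zm, hzm, hmax⟩ := hKc.exists_isMaxOn hKne
      (continuous_im.comp_continuousOn (hFA.mono hKA))
    -- Two successive maximizations: first Im F on the level set, then Re z among the maximizers.
    set K₂ : Set ℂ := {z ∈ K | (F z).im = (F zm).im} with hK₂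
    have hK₂c : IsCompact K₂ := by
      refine hKc.of_isClosed_subset ?_ fun z hz => hz.1
      exact (continuous_im.comp_continuousOn (hFA.mono hKA)).preimage_isClosed_of_isClosed hKclosed
        (isClosed_singleton (x := (F zm).im))
    obtain ⟨z₁, hz₁, hmax₁⟩ := hK₂c.exists_isMaxOn ⟨zm, hzm, rfl⟩ continuous_re.continuousOn
    have hz₁O : z₁ ∈ O := hAO z₁ hz₁.1.1 hz₁.1.2
    -- If F is constant near z₁, a small step to the right contradicts the maximality of Re z. If F
    -- is open at z₁, the value F(z₁) + it is attained, after translation on the same level set,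
    -- against the maximality of Im F.
    rcases (han z₁ (hOW hz₁O)).eventually_constant_or_nhds_le_map_nhds with hconst | hopen
    · have hev : ∀ᶠ t : ℝ in 𝓝[>] 0, F (z₁ + t) = F z₁ ∧ z₁ + t ∈ O := by
        have ht : Tendsto (fun t : ℝ => z₁ + t) (𝓝[>] 0) (𝓝 z₁) := by
          have : Continuous fun t : ℝ => z₁ + (t : ℂ) := by fun_prop
          simpa using (this.tendsto 0).mono_left nhdsWithin_le_nhds
        exact ht.eventually (hconst.and (hOopen.mem_nhds hz₁O))
      obtain ⟨t, ⟨hFt, hOt⟩, htpos⟩ := (hev.and self_mem_nhdsWithin).exists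
      have htA : z₁ + t ∈ A := ⟨by simpa using hz₁.1.1.1, hOt.2.1.le, hOt.2.2.le⟩
      have : z₁ + (t : ℂ) ∈ K₂ := ⟨⟨htA, by rw [hFt]; exact hz₁.1.2⟩, by rw [hFt]; exact hz₁.2⟩
      have h5 : (z₁ + (t : ℂ)).re ≤ z₁.re := hmax₁ this
      simp only [add_re, ofReal_re] at h5
      linarith [htpos]
    · have h1 : F '' O ∈ 𝓝 (F z₁) := hopen (image_mem_map (hOopen.mem_nhds hz₁O))
      have ht : Tendsto (fun t : ℝ => F z₁ + t * I) (𝓝[>] 0) (𝓝 (F z₁)) := by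
        have : Continuous fun t : ℝ => F z₁ + (t : ℂ) * I := by fun_prop
        simpa using (this.tendsto 0).mono_left nhdsWithin_le_nhds
      obtain ⟨t, ⟨z₂, hz₂, hF₂⟩, htpos⟩ := ((ht.eventually h1).and self_mem_nhdsWithin).exists
      obtain ⟨z₃, hz₃, hF₃⟩ := htrans z₂ hz₂
      have hK₃ : z₃ ∈ K := ⟨hz₃, by rw [hF₃, hF₂]; simpa using hz₁.1.2⟩
      have h5 : (F z₃).im ≤ (F zm).im := hmax hK₃
      rw [hF₃, hF₂, ← hz₁.2] at h5
      simp only [add_im, mul_im, ofReal_re, I_im, mul_one, ofReal_im, I_re, mul_zero,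
        add_zero] at h5
      linarith [htpos]
  have hzO : z ∈ O := ⟨hz, hzc, hzc'⟩
  rcases (han z (hOW hzO)).eventually_constant_or_nhds_le_map_nhds with hconst | hopen
  · have : F =ᶠ[𝓝 z] fun _ => F z := hconst
    rw [this.deriv_eq, deriv_const]
  -- An open image would contain a horizontal segment, on which the real part takes infinitely many
  -- values.
  · exfalso
    have h1 : {w : ℂ | w.re ∈ V} ∈ 𝓝 (F z) :=
      hopen (mem_map.2 (mem_of_superset (hOopen.mem_nhds hzO) hOV))
    have h2 : {t : ℝ | ((t : ℂ) + (F z).im * I).re ∈ V} ∈ 𝓝 (F z).re := by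
      have : Continuous fun t : ℝ => (t : ℂ) + (F z).im * I := by fun_prop
      exact (this.tendsto' _ (F z) (re_add_im _)) h1
    simp only [add_re, ofReal_re, mul_re, I_re, mul_zero, ofReal_im, I_im, mul_one, sub_self,
      add_zero] at h2
    exact infinite_of_mem_nhds _ h2 hVfin

/-- A holomorphic function that vanishes at the centre of a disk and has constant imaginary part on
a concentric circle is zero. -/
theorem eqOn_zero_of_im_const {q : ℂ → ℂ} {r : ℝ} (hr : 1 < r)
    (hq : DifferentiableOn ℂ q (ball 0 r)) (hq0 : q 0 = 0) {b : ℝ}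
    (hb : ∀ ζ, ‖ζ‖ = 1 → (q ζ).im = b) : EqOn q 0 (ball 0 r) := by
  have hcirc : ∀ θ : ℝ, ‖circleMap 0 1 θ‖ = 1 := fun θ => by simp
  have hsub : closedBall (0 : ℂ) 1 ⊆ ball 0 r := closedBall_subset_ball hr
  -- On the circle f = (Re q)² ≥ 0, while its mean is f(0) = -b². Hence b = 0 and Re q vanishes on
  -- the circle.
  set f : ℂ → ℂ := fun ζ => (q ζ - b * I) ^ 2 with hf
  have hfd : DifferentiableOn ℂ f (ball 0 r) := (hq.sub_const _).pow 2
  have hmean : ∫ θ in (0 : ℝ)..(2 * π), f (circleMap 0 1 θ) = 2 * π * f 0 := by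
    have h1 : DiffContOnCl ℂ f (ball 0 |(1 : ℝ)|) := by
      rw [abs_one]
      exact hfd.diffContOnCl_ball hsub
    have h2 := DiffContOnCl.circleAverage h1
    rw [Real.circleAverage_def, real_smul] at h2
    rw [← h2]
    have hpi : (π : ℂ) ≠ 0 := by exact_mod_cast Real.pi_ne_zero
    push_cast
    field_simp
  have hreal : ∀ θ : ℝ, f (circleMap 0 1 θ) = (((q (circleMap 0 1 θ)).re ^ 2 : ℝ) : ℂ) := by
    intro θ
    have : q (circleMap 0 1 θ) - b * I = ((q (circleMap 0 1 θ)).re : ℂ) := by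
      rw [← hb _ (hcirc θ), sub_eq_iff_eq_add, re_add_im]
    simp only [hf, this]
    push_cast
    rfl
  simp only [hreal] at hmean
  rw [intervalIntegral.integral_ofReal] at hmean
  have hf0 : f 0 = ((-b ^ 2 : ℝ) : ℂ) := by
    simp only [hf, hq0, zero_sub, neg_sq, mul_pow, I_sq]
    push_cast
    ring
  rw [hf0] at hmean
  have hmean' : ∫ θ in (0 : ℝ)..(2 * π), (q (circleMap 0 1 θ)).re ^ 2 = 2 * π * (-b ^ 2) := by
    exact_mod_cast hmean
  have hcont : Continuous fun θ : ℝ => (q (circleMap 0 1 θ)).re ^ 2 := by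
    refine (continuous_re.comp ?_).pow 2
    exact hq.continuousOn.comp_continuous (continuous_circleMap 0 1) fun θ => hsub (by simp)
  have hnn : 0 ≤ ∫ θ in (0 : ℝ)..(2 * π), (q (circleMap 0 1 θ)).re ^ 2 :=
    intervalIntegral.integral_nonneg Real.two_pi_pos.le fun _ _ => sq_nonneg _
  have hb0 : b = 0 := by
    rw [hmean'] at hnn
    have := Real.pi_pos
    have : b ^ 2 ≤ 0 := by nlinarith
    exact pow_eq_zero_iff two_ne_zero |>.1 (le_antisymm this (sq_nonneg b))
  have hre : ∀ θ ∈ Icc (0 : ℝ) (2 * π), (q (circleMap 0 1 θ)).re = 0 := by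
    intro θ hθ
    by_contra hne
    have hpos : 0 < ∫ θ in (0 : ℝ)..(2 * π), (q (circleMap 0 1 θ)).re ^ 2 :=
      intervalIntegral.integral_pos Real.two_pi_pos hcont.continuousOn
        (fun _ _ => sq_nonneg _) ⟨θ, hθ, by positivity⟩
    rw [hmean', hb0] at hpos
    simp at hpos
  have hqz : ∀ ζ ∈ sphere (0 : ℂ) 1, q ζ = 0 := by
    intro ζ hζ
    obtain ⟨θ, hθ, rfl⟩ : ζ ∈ circleMap 0 1 '' Ioc 0 (2 * π) := by
      rw [image_circleMap_Ioc, abs_one]; exact hζ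
    exact Complex.ext (hre θ (Ioc_subset_Icc_self hθ)) (by rw [hb _ (hcirc θ), hb0]; rfl)
  have hball : ∀ ζ ∈ ball (0 : ℂ) 1, q ζ = 0 := by
    intro ζ hζ
    have h1 : DiffContOnCl ℂ q (ball 0 1) := hq.diffContOnCl_ball hsub
    have h2 := Complex.norm_le_of_forall_mem_frontier_norm_le isBounded_ball h1 (C := 0)
      (fun z hz => by
        rw [frontier_ball _ one_ne_zero] at hz
        rw [hqz z hz, norm_zero]) (subset_closure hζ)
    exact norm_le_zero_iff.1 h2
  refine (hq.analyticOnNhd isOpen_ball).eqOn_zero_of_preconnected_of_eventuallyEq_zero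
    (convex_ball 0 r).isPreconnected (mem_ball_self (by linarith)) ?_
  filter_upwards [ball_mem_nhds (0 : ℂ) one_pos] with ζ hζ using hball ζ hζ

/-- The layer of a homogeneous solution has constant real part on the circle around c and, by
oddness, on that around -c; so its derivative vanishes and it is constant on the circle around c.
There it equals conj q - q plus a constant, hence Im q is constant and q = 0. -/
theorem isDensity_zero_eq_zero (h : Radii P c R R') (hP : 2 < P) (hc : 1 < c)
    {p : C(Circle, ℂ)} (hp : IsDensity P c R 0 p) : p = 0 := by
  have hd : DifferentiableOn ℂ (0 : ℂ → ℂ) (ball 0 R') := differentiableOn_const 0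
  have hfar : wideCell P c ⊆ farSet P c R⁻¹ := wideCell_subset_farSet h.period_pos h.inv_lt_one
  have hcircle : ∀ ζ : ℂ, ‖ζ‖ = 1 → ∀ t : ℝ, 1 ≤ t → t < P - 1 → t < 2 * c - 1 →
      |((c : ℂ) + t * ζ).im| < P - 1 ∧ t ≤ ‖(c : ℂ) + t * ζ - c‖ ∧ 1 < ‖(c : ℂ) + t * ζ + c‖ := by
    intro ζ hζ t ht1 htP htc
    have hn : ‖(t : ℂ) * ζ‖ = t := by
      rw [norm_mul, hζ, mul_one, norm_real, Real.norm_eq_abs, abs_of_pos (by linarith)]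
    have e1 := abs_im_le_norm ((t : ℂ) * ζ)
    have e2 := abs_re_le_norm ((t : ℂ) * ζ)
    rw [hn] at e1 e2
    refine ⟨?_, ?_, ?_⟩
    · rw [add_im, ofReal_im, zero_add]
      exact e1.trans_lt htP
    · rw [add_sub_cancel_left, hn]
    · refine lt_of_lt_of_le ?_ (re_le_norm _)
      have := (abs_le.1 e2).1
      rw [add_re, add_re, ofReal_re]
      linarith
  have hcW : ∀ z : ℂ, ‖z - c‖ = 1 → z ∈ wideCell P c := fun z hz => by
    obtain ⟨h1, h2, h3⟩ := hcircle (z - c) hz 1 le_rfl (by linarith) (by linarith)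
    have e : (c : ℂ) + (1 : ℝ) * (z - c) = z := by push_cast; ring
    rw [e] at h1 h2 h3
    exact ⟨h1.le, h2, h3.le⟩
  have hb : ∀ z : ℂ, ‖z - c‖ = 1 → (layer P c R p z).re = (regPart P c R p 0).re := fun z hz => by
    have := re_layer_on_circle h hd hp hz
    simpa using this
  have hb' : ∀ z : ℂ, ‖z + c‖ = 1 → (layer P c R p z).re = -(regPart P c R p 0).re := fun z hz => by
    have hz' : ‖-z - c‖ = 1 := by rw [← hz, ← norm_neg]; congr 1; ring
    rw [← hb (-z) hz', ← neg_neg z, layer_neg h p (hfar (hcW _ hz')), neg_re, neg_neg]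
  obtain ⟨L, hL⟩ := exists_tendsto_layer_atTop h p
  obtain ⟨L', hL'⟩ := exists_tendsto_layer_atBot h p
  have han : ∀ z ∈ wideCell P c, AnalyticAt ℂ (layer P c R p) z := fun z hz =>
    analyticAt_layer h p (hfar hz)
  -- The vanishing of the derivative is known only strictly outside the disks; it reaches the circle
  -- by continuity along the rays c + tζ as t decreases to 1.
  have hderiv : ∀ ζ : ℂ, ‖ζ‖ = 1 → deriv (layer P c R p) (c + ζ) = 0 := by
    intro ζ hζ
    have hcont : ContinuousAt (deriv (layer P c R p)) (c + ζ) :=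
      (han _ (hcW _ (by simpa using hζ))).deriv.continuousAt
    have ht : Tendsto (fun t : ℝ => (c : ℂ) + t * ζ) (𝓝[>] 1) (𝓝 (c + ζ)) := by
      have : Continuous fun t : ℝ => (c : ℂ) + t * ζ := by fun_prop
      simpa using (this.tendsto 1).mono_left nhdsWithin_le_nhds
    refine tendsto_nhds_unique (hcont.tendsto.comp ht) (tendsto_const_nhds.congr' ?_)
    have hm : (1 : ℝ) < min (P - 1) (2 * c - 1) := lt_min (by linarith) (by linarith)
    filter_upwards [Ioo_mem_nhdsGT hm] with t ht
    obtain ⟨h1, h2, h3⟩ := hcircle ζ hζ t ht.1.le (ht.2.trans_le (min_le_left _ _))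
      (ht.2.trans_le (min_le_right _ _))
    exact (deriv_eq_zero_of_re_const hP (layer_add_period h.period_pos p) han hb hb' hL hL' h1
      (ht.1.trans_le h2) h3).symm
  have hconst : ∀ ζ : ℂ, ‖ζ‖ = 1 → layer P c R p (c + ζ) = layer P c R p (c + 1) := by
    intro ζ hζ
    obtain ⟨θ, rfl⟩ : ∃ θ : ℝ, circleMap 0 1 θ = ζ := by
      have : ζ ∈ range (circleMap 0 1) := by rw [range_circleMap]; simpa using hζ
      exact this
    have hd0 : ∀ t : ℝ, HasDerivAt (fun t => layer P c R p (c + circleMap 0 1 t)) 0 t := fun t => by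
      have hn : ‖circleMap 0 1 t‖ = 1 := by simp
      have h1 := (han _ (hcW (c + circleMap 0 1 t)
        (by rw [add_sub_cancel_left, hn]))).differentiableAt.hasDerivAt
      rw [hderiv _ hn] at h1
      have := h1.scomp t ((hasDerivAt_circleMap 0 1 t).const_add (c : ℂ))
      rw [smul_zero] at this
      exact this
    have := is_const_of_deriv_eq_zero (fun t => (hd0 t).differentiableAt) (fun t => (hd0 t).deriv) θ 0
    have h0 : circleMap 0 1 0 = 1 := by simp [circleMap]
    rwa [h0] at this
  have hq := eqOn_zero_of_im_const (h.one_lt.trans h.lt) (differentiableOn_extension h hd p)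
    (extension_zero 0 p) (b := -((layer P c R p (c + 1)) - regPart P c R p 0).im / 2) fun ζ hζ => by
      have h1 := layer_on_circle h hd hp hζ
      rw [hconst ζ hζ] at h1
      rw [h1]
      simp
  ext w
  rw [hp w, hq (mul_circle_mem_ball h w)]
  rfl

end

/-! ### Construction of the real periodic potential. -/

section

variable {P c R R' : ℝ}

/-- The real-linear functional `h ↦ Re (g h)`. -/
def reMul (g : ℂ) : ℂ →L[ℝ] ℝ := reCLM.comp (ContinuousLinearMap.mul ℝ ℂ g)

theorem reMul_apply (g h : ℂ) : reMul g h = (g * h).re := rfl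

theorem reMul_injective : Function.Injective reMul := by
  intro a b hab
  have h1 := congrArg (fun l : ℂ →L[ℝ] ℝ => l 1) hab
  have h2 := congrArg (fun l : ℂ →L[ℝ] ℝ => l I) hab
  simp only [reMul_apply, mul_one, mul_I_re, neg_inj] at h1 h2
  exact Complex.ext h1 h2

theorem hasFDerivAt_re_of_hasDerivAt {f : ℂ → ℂ} {f' z : ℂ} (hf : HasDerivAt f f' z) :
    HasFDerivAt (fun z => (f z).re) (reMul f') z := by
  have h1 := reCLM.hasFDerivAt.comp z (hf.hasFDerivAt.restrictScalars ℝ)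
  refine h1.congr_fderiv (ContinuousLinearMap.ext fun h => ?_)
  simp [reMul_apply, mul_comm]

/-- Near z the quotient f(w)/f(z) is close to 1, where the principal logarithm is holomorphic; its
real part is log |f(w)| up to a constant. -/
theorem hasFDerivAt_log_norm {f : ℂ → ℂ} {f' z : ℂ} (hf : HasDerivAt f f' z) (hz : f z ≠ 0) :
    HasFDerivAt (fun z => Real.log ‖f z‖) (reMul (f' / f z)) z := by
  have h1 : HasDerivAt (fun w => Complex.log (f w / f z)) (f' / f z) z := by
    have := (hf.div_const (f z)).clog (by rw [div_self hz]; exact one_mem_slitPlane)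
    rwa [div_self hz, div_one] at this
  have h2 := (hasFDerivAt_re_of_hasDerivAt h1).add_const (Real.log ‖f z‖)
  refine h2.congr_of_eventuallyEq ?_
  filter_upwards [hf.continuousAt.eventually_ne hz] with w hw
  rw [log_re, norm_div, Real.log_div (norm_ne_zero_iff.2 hw) (norm_ne_zero_iff.2 hz)]
  ring

/-- The `iP`-periodic fundamental solution `log |2 sinh(πw/P)|`. -/
def logKernel (P : ℝ) (w : ℂ) : ℝ := Real.log ‖expSub P w‖ - π / P * w.re

theorem logKernel_add_period (hP : 0 < P) (w : ℂ) :
    logKernel P (w + P * I) = logKernel P w := by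
  rw [logKernel, expSub_add_period hP, logKernel]
  simp

theorem logKernel_neg {w : ℂ} (hw : expSub P w ≠ 0) : logKernel P (-w) = logKernel P w := by
  rw [logKernel, logKernel, expSub_neg, norm_neg, norm_mul, norm_exp,
    Real.log_mul (Real.exp_ne_zero _) (norm_ne_zero_iff.2 hw), Real.log_exp, neg_re,
    re_ofReal_mul, neg_re]
  ring

theorem hasFDerivAt_logKernel {w : ℂ} (hw : expSub P w ≠ 0) :
    HasFDerivAt (logKernel P) (reMul (cothKernel P w)) w := by
  have h1 := hasFDerivAt_log_norm (hasDerivAt_expSub P w) hw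
  have h2 : HasFDerivAt (fun w : ℂ => π / P * w.re) ((π / P) • reCLM) w :=
    reCLM.hasFDerivAt.const_mul (π / P)
  refine (h1.sub h2).congr_fderiv (ContinuousLinearMap.ext fun h => ?_)
  have e : ((2 * π / P : ℝ) : ℂ) * exp ((2 * π / P : ℝ) * w) / expSub P w =
      cothKernel P w + (π / P : ℝ) := by
    have : exp ((2 * π / P : ℝ) * w) = expSub P w + 1 := by simp [expSub]
    rw [this, cothKernel]
    push_cast
    field_simp
    ring
  rw [e]
  simp only [sub_apply, smul_apply, reMul_apply, add_mul,
    add_re, re_ofReal_mul, reCLM_apply, smul_eq_mul]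
  ring

theorem harmonicAt_logKernel {w : ℂ} (hw : expSub P w ≠ 0) : HarmonicAt (logKernel P) w := by
  have h1 : HarmonicAt (fun w => Real.log ‖expSub P w‖) w :=
    ((differentiable_expSub P).analyticAt w).harmonicAt_log_norm hw
  have h2 : HarmonicAt (fun w : ℂ => (((π / P : ℝ) : ℂ) * w).re) w :=
    (analyticAt_const.mul analyticAt_id).harmonicAt_re
  simp only [re_ofReal_mul] at h2
  exact h1.sub h2

theorem harmonicAt_comp_add_const {f : ℂ → ℝ} {z a : ℂ} (hf : HarmonicAt f (z + a)) :
    HarmonicAt (fun w => f (w + a)) z := by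
  obtain ⟨r, hr, hball⟩ := Metric.eventually_nhds_iff_ball.1 hf.eventually
  obtain ⟨F, hF, hFf⟩ := HarmonicOnNhd.exists_analyticOnNhd_ball_re_eq (f := f) hball
  have h1 : AnalyticAt ℂ (fun w => F (w + a)) z :=
    (hF _ (mem_ball_self hr)).fun_comp (f := fun w => w + a) (analyticAt_id.add analyticAt_const)
  refine (harmonicAt_congr_nhds ?_).1 h1.harmonicAt_re
  have hc : Tendsto (fun w => w + a) (𝓝 z) (𝓝 (z + a)) := (continuous_add_const a).tendsto z
  filter_upwards [hc (ball_mem_nhds _ hr)] with w hw using hFf hw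

/-- Locally f = Re F with F holomorphic, and w ↦ conj (F(conj w)) is holomorphic with real part
f(conj w). -/
theorem harmonicAt_comp_conj {f : ℂ → ℝ} {z : ℂ} (hf : HarmonicAt f (conj z)) :
    HarmonicAt (fun w => f (conj w)) z := by
  obtain ⟨r, hr, hball⟩ := Metric.eventually_nhds_iff_ball.1 hf.eventually
  obtain ⟨F, hF, hFf⟩ := HarmonicOnNhd.exists_analyticOnNhd_ball_re_eq (f := f) hball
  have hc : Tendsto (fun w : ℂ => conj w) (𝓝 z) (𝓝 (conj z)) := continuous_conj.tendsto z
  have h1 : AnalyticAt ℂ (fun w => conj (F (conj w))) z := by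
    rw [analyticAt_iff_eventually_differentiableAt]
    filter_upwards [hc (ball_mem_nhds _ hr)] with w hw
    have h2 := (hF _ hw).differentiableAt.hasDerivAt.conj_conj
    rw [conj_conj] at h2
    exact h2.differentiableAt
  refine (harmonicAt_congr_nhds ?_).1 h1.harmonicAt_re
  filter_upwards [hc (ball_mem_nhds _ hr)] with w hw
  rw [conj_re]
  exact hFf hw

/-- A periodic potential, odd under `z ↦ -z`, outside the unit disks around `±c + iPℤ`. Its
differential is `h ↦ Re (g h)`. -/
structure PeriodicPotential (P c : ℝ) (φ : ℂ → ℝ) (g : ℂ → ℂ) (b : ℝ) : Prop where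
  harmonic : ∀ z ∈ wideCell P c, HarmonicAt φ z
  hasFDerivAt : ∀ z ∈ wideCell P c, HasFDerivAt φ (reMul (g z)) z
  periodic : ∀ z, φ (z + P * I) = φ z
  odd : ∀ z ∈ wideCell P c, φ (-z) = -φ z
  value : ∀ z : ℂ, ‖z - c‖ = 1 → φ z = b
  flux : ∫ θ in (0 : ℝ)..(2 * π), (g (circleMap c 1 θ) * (circleMap c 1 θ - c)).re = -1
  decay : ∃ B X κ, 0 < κ ∧ ∀ z : ℂ, X ≤ |z.re| → ‖g z‖ ≤ B * Real.exp (-(κ * |z.re|))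

/-- The sum of logarithmic sources at `±c + iPℤ` and the potential of the density `p`. -/
def rawPotential (P c R : ℝ) (p : C(Circle, ℂ)) (z : ℂ) : ℝ :=
  -(2 * π)⁻¹ * (logKernel P (z + -c) - logKernel P (z + c)) + (layer P c R p z).re

/-- The complex derivative of `rawPotential`. -/
def rawGrad (P c R : ℝ) (p : C(Circle, ℂ)) (z : ℂ) : ℂ :=
  ((-(2 * π)⁻¹ : ℝ) : ℂ) * (cothKernel P (z + -c) - cothKernel P (z + c)) +
    deriv (layer P c R p) z

theorem expSub_sub_center_ne_zero (hP : 0 < P) {r : ℝ} (hr : 0 ≤ r) {z : ℂ}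
    (hz : z ∈ farSet P c r) : expSub P (z + -c) ≠ 0 ∧ expSub P (z + c) ≠ 0 := by
  simp only [Ne, expSub_eq_zero_iff hP]
  constructor
  · rintro ⟨n, hn⟩
    have := (hz n).1
    rw [← sub_eq_add_neg] at hn
    rw [hn, sub_self, norm_zero] at this
    linarith
  · rintro ⟨n, hn⟩
    have := (hz n).2
    rw [hn, sub_self, norm_zero] at this
    linarith

theorem hasFDerivAt_rawPotential (h : Radii P c R R') (p : C(Circle, ℂ)) {z : ℂ}
    (hz : z ∈ farSet P c R⁻¹) :
    HasFDerivAt (rawPotential P c R p) (reMul (rawGrad P c R p z)) z := by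
  obtain ⟨h1, h2⟩ := expSub_sub_center_ne_zero h.period_pos h.inv_pos.le hz
  have e1 := (hasFDerivAt_comp_add_right (-c : ℂ)).2 (hasFDerivAt_logKernel h1)
  have e2 := (hasFDerivAt_comp_add_right (c : ℂ)).2 (hasFDerivAt_logKernel h2)
  have e3 := hasFDerivAt_re_of_hasDerivAt (analyticAt_layer h p hz).differentiableAt.hasDerivAt
  refine (((e1.sub e2).const_mul (-(2 * π)⁻¹)).add e3).congr_fderiv
    (ContinuousLinearMap.ext fun v => ?_)
  simp only [rawGrad, reMul_apply, add_apply, smul_apply, sub_apply, smul_eq_mul, add_mul,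
    add_re, mul_assoc, re_ofReal_mul, sub_mul, sub_re]

theorem harmonicAt_rawPotential (h : Radii P c R R') (p : C(Circle, ℂ)) {z : ℂ}
    (hz : z ∈ farSet P c R⁻¹) : HarmonicAt (rawPotential P c R p) z := by
  obtain ⟨h1, h2⟩ := expSub_sub_center_ne_zero h.period_pos h.inv_pos.le hz
  have e1 := harmonicAt_comp_add_const (harmonicAt_logKernel h1)
  have e2 := harmonicAt_comp_add_const (harmonicAt_logKernel h2)
  have e3 := (analyticAt_layer h p hz).harmonicAt_re
  exact ((e1.sub e2).const_smul (c := -(2 * π)⁻¹)).add e3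

theorem exists_norm_density_le (R : ℝ) (p : C(Circle, ℂ)) :
    ∃ D, ∀ θ ∈ Icc (0 : ℝ) (2 * π), ‖density R p θ‖ ≤ D :=
  isCompact_Icc.exists_bound_of_continuousOn (continuous_density R p).continuousOn

/-- The layer contributes integrals of the exponentially small derivative of the coth kernel. The
coth terms of the logarithmic sources do not decay one by one, but the sources have opposite signs
and the difference does. -/
theorem exists_norm_rawGrad_le (h : Radii P c R R') (p : C(Circle, ℂ)) :
    ∃ B X κ, 0 < κ ∧
      ∀ z : ℂ, X ≤ |z.re| → ‖rawGrad P c R p z‖ ≤ B * Real.exp (-(κ * |z.re|)) := by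
  obtain ⟨D, hD⟩ := exists_norm_density_le R p
  have hP := h.period_pos
  set κ := 2 * π / P with hκ
  have hκ0 : 0 < κ := by positivity
  set A := κ ^ 2 / (1 - Real.exp (-κ)) ^ 2 with hA
  have hA0 : 0 ≤ A := by positivity
  have hcoth : ∀ z v : ℂ, |c| + 2 ≤ |z.re| → |v.re| ≤ |c| + 1 →
      ‖deriv (cothKernel P) (z + v)‖ ≤
        A * Real.exp (κ * (|c| + 1)) * Real.exp (-(κ * |z.re|)) := by
    intro z v hz hv
    have h1 : |z.re| - (|c| + 1) ≤ |(z + v).re| := by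
      have := abs_sub_abs_le_abs_sub z.re (-v.re)
      rw [abs_neg, sub_neg_eq_add] at this
      rw [add_re]
      linarith
    refine (norm_deriv_cothKernel_le hP (by linarith)).trans ?_
    rw [mul_assoc, ← Real.exp_add]
    refine mul_le_mul_of_nonneg_left (Real.exp_le_exp.2 ?_) hA0
    change -(κ * |(z + v).re|) ≤ _
    nlinarith
  have hne : ∀ z v : ℂ, |c| + 2 ≤ |z.re| → |v.re| ≤ |c| + 1 → expSub P (z + v) ≠ 0 := by
    intro z v hz hv
    refine expSub_ne_zero_of_re_ne_zero hP fun h0 => ?_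
    rw [add_re] at h0
    have : z.re = -v.re := by linarith
    rw [this, abs_neg] at hz
    linarith
  set M := A * Real.exp (κ * (|c| + 1)) with hM
  have hM0 : 0 ≤ M := by positivity
  refine ⟨(2 * π)⁻¹ * (M * (2 * |c|)) + (2 * π)⁻¹ * (D * M * (2 * π) + D * M * (2 * π)),
    |c| + 2, κ, hκ0, fun z hz => ?_⟩
  set e := Real.exp (-(κ * |z.re|)) with he
  have hz' : z ∈ farSet P c R⁻¹ := mem_farSet_of_abs_re h.inv_lt_one.le (by linarith)
  -- Mean value inequality on the segment from z + c to z - c, which stays far out when z does.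
  have hpart1 : ‖cothKernel P (z + -c) - cothKernel P (z + c)‖ ≤ M * e * (2 * |c|) := by
    have hv : ∀ w ∈ segment ℝ (z + (c : ℂ)) (z + -(c : ℂ)), ∃ v : ℂ, w = z + v ∧
        |v.re| ≤ |c| + 1 := by
      rintro w ⟨a, b, ha, hb, hab, rfl⟩
      refine ⟨(a - b) * c, ?_, ?_⟩
      · have : (a : ℂ) + b = 1 := by exact_mod_cast hab
        simp only [real_smul]
        linear_combination z * this
      · have h3 : ((a - b : ℂ) * c).re = (a - b) * c := by
          rw [← ofReal_sub, re_ofReal_mul, ofReal_re]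
        rw [h3, abs_mul]
        have : |a - b| ≤ 1 := abs_le.2 ⟨by linarith, by linarith⟩
        nlinarith [abs_nonneg c]
    have h1 := Convex.norm_image_sub_le_of_norm_deriv_le (𝕜 := ℂ) (f := cothKernel P)
      (C := M * e) (s := segment ℝ (z + (c : ℂ)) (z + -(c : ℂ)))
      (fun w hw => by
        obtain ⟨v, rfl, hv⟩ := hv w hw
        exact (hasDerivAt_cothKernel (hne z v hz hv)).differentiableAt)
      (fun w hw => by
        obtain ⟨v, rfl, hv⟩ := hv w hw
        exact hcoth z v hz hv)
      (convex_segment _ _) (left_mem_segment _ _ _) (right_mem_segment _ _ _)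
    refine h1.trans (le_of_eq ?_)
    have : z + -(c : ℂ) - (z + c) = ((-(2 * c) : ℝ) : ℂ) := by push_cast; ring
    rw [this, norm_real, Real.norm_eq_abs, abs_neg, abs_mul, abs_two]
  have hre : ∀ θ, |((c : ℂ) + circleMap 0 R⁻¹ θ).re| ≤ |c| + 1 := fun θ => by
    refine (abs_re_le_norm _).trans ((norm_add_le _ _).trans ?_)
    rw [norm_circleMap_inv h, norm_real, Real.norm_eq_abs]
    linarith [h.inv_lt_one]
  have hInt : ∀ s : ℝ → ℂ, (∀ θ, |(s θ).re| ≤ |c| + 1) →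
      ‖∫ θ in (0 : ℝ)..(2 * π), density R p θ * deriv (cothKernel P) (z + s θ)‖ ≤
        D * M * (2 * π) * e := fun s hs => by
    have := intervalIntegral.norm_integral_le_of_norm_le_const (a := 0) (b := 2 * π)
      (f := fun θ => density R p θ * deriv (cothKernel P) (z + s θ)) (C := D * (M * e))
      fun θ hθ => by
        rw [uIoc_of_le Real.two_pi_pos.le] at hθ
        have h1 := hD θ (Ioc_subset_Icc_self hθ)
        rw [norm_mul]
        exact mul_le_mul h1 (hcoth z _ hz (hs θ)) (norm_nonneg _) ((norm_nonneg _).trans h1)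
    rw [sub_zero, abs_of_pos Real.two_pi_pos] at this
    exact this.trans (le_of_eq (by ring))
  have hi1 := hInt (fun θ => -(c + circleMap 0 R⁻¹ θ)) fun θ => by
    rw [neg_re, abs_neg]; exact hre θ
  have hi2 := hInt (fun θ => c + circleMap 0 R⁻¹ θ) hre
  have hpi : ‖(2 * π : ℂ)⁻¹‖ = (2 * π)⁻¹ := by
    rw [norm_inv, norm_mul, norm_real, Real.norm_eq_abs, abs_of_pos Real.pi_pos]
    simp
  have hpi' : ‖((-(2 * π)⁻¹ : ℝ) : ℂ)‖ = (2 * π)⁻¹ := by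
    rw [norm_real, norm_neg, Real.norm_eq_abs, abs_of_pos (by positivity)]
  rw [rawGrad, deriv_layer h p hz', add_mul]
  refine (norm_add_le _ _).trans (add_le_add ?_ ?_)
  · rw [norm_mul, hpi', mul_assoc]
    refine mul_le_mul_of_nonneg_left (hpart1.trans (le_of_eq (by ring))) (by positivity)
  · rw [norm_mul, hpi, mul_assoc]
    refine mul_le_mul_of_nonneg_left ?_ (by positivity)
    rw [add_mul]
    exact (norm_add_le _ _).trans (add_le_add hi1 hi2)

/-- The regular part, in the disk around `c`, of the logarithmic sources. -/
def regLog (P c : ℝ) (ζ : ℂ) : ℝ :=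
  -(2 * π)⁻¹ * (Real.log ‖expQuot P ζ‖ - π / P * ζ.re - logKernel P (ζ + 2 * c))

theorem harmonicAt_regLog (h : Radii P c R R') {ζ : ℂ} (hζ : ζ ∈ ball (0 : ℂ) R') :
    HarmonicAt (regLog P c) ζ := by
  rw [mem_ball_zero_iff] at hζ
  have h1 : HarmonicAt (fun w => Real.log ‖expQuot P w‖) ζ :=
    ((differentiable_expQuot P).analyticAt ζ).harmonicAt_log_norm
      (expQuot_ne_zero h.period_pos (by linarith [h.lt_period, h.inv_pos]))
  have h2 : HarmonicAt (fun w : ℂ => (((π / P : ℝ) : ℂ) * w).re) ζ :=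
    (analyticAt_const.mul analyticAt_id).harmonicAt_re
  simp only [re_ofReal_mul] at h2
  have hne : expSub P (ζ + 2 * c) ≠ 0 := by
    refine expSub_ne_zero_of_re_ne_zero h.period_pos (ne_of_gt ?_)
    have := (abs_le.1 ((abs_re_le_norm ζ).trans hζ.le)).1
    have e : (ζ + 2 * c).re = ζ.re + 2 * c := by simp
    rw [e]
    linarith [h.lt_gap, h.inv_pos]
  have h3 := harmonicAt_comp_add_const (harmonicAt_logKernel hne)
  exact ((h1.sub h2).sub h3).const_smul (c := -(2 * π)⁻¹)

theorem rawPotential_center_add (h : Radii P c R R') (p : C(Circle, ℂ)) {ζ : ℂ} (h0 : ζ ≠ 0)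
    (hζ : ζ ∈ ball (0 : ℂ) R') : rawPotential P c R p (c + ζ) =
      -(2 * π)⁻¹ * Real.log ‖ζ‖ + (regLog P c ζ + (layer P c R p (c + ζ)).re) := by
  rw [mem_ball_zero_iff] at hζ
  have hN := expQuot_ne_zero h.period_pos (w := ζ) (by linarith [h.lt_period, h.inv_pos])
  have e1 : (c : ℂ) + ζ + -c = ζ := by ring
  have e2 : (c : ℂ) + ζ + c = ζ + 2 * c := by ring
  rw [rawPotential, e1, e2, regLog, logKernel, expSub_eq_mul_expQuot, norm_mul,
    Real.log_mul (norm_ne_zero_iff.2 h0) (norm_ne_zero_iff.2 hN)]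
  ring

theorem circle_subset_wideCell (hP : 2 < P) (hc : 1 < c) {z : ℂ} (hz : ‖z - c‖ = 1) :
    z ∈ wideCell P c := by
  have e1 := abs_im_le_norm (z - c)
  have e2 := abs_re_le_norm (z - c)
  rw [hz] at e1 e2
  simp only [sub_im, ofReal_im, sub_zero, sub_re, ofReal_re] at e1 e2
  refine ⟨by linarith, hz.ge, le_trans ?_ (re_le_norm _)⟩
  rw [add_re, ofReal_re]
  linarith [(abs_le.1 e2).1]

theorem exists_radii (hP : 2 < P) (hc : 1 < c) : ∃ R R', Radii P c R R' := by
  have hm : 0 < min (P - 2) (2 * c - 2) := lt_min (by linarith) (by linarith)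
  set m := min (P - 2) (2 * c - 2)
  have h1 : m ≤ P - 2 := min_le_left _ _
  have h2 : m ≤ 2 * c - 2 := min_le_right _ _
  have h3 : (1 + m / 2)⁻¹ < 1 := inv_lt_one_of_one_lt₀ (by linarith)
  -- As 1/R < 1, both conditions follow from 2 + m ≤ min P (2c).
  exact ⟨1 + m / 2, 1 + m, by linarith, by linarith, by linarith, by linarith⟩

theorem integral_deriv_mul_circleMap {f f' : ℂ → ℂ}
    (hf : ∀ ζ ∈ sphere (0 : ℂ) 1, HasDerivAt f (f' ζ) ζ) :
    ∫ θ in (0 : ℝ)..(2 * π), f' (circleMap 0 1 θ) * circleMap 0 1 θ = 0 := by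
  have h1 := circleIntegral.integral_eq_zero_of_hasDerivWithinAt (c := 0) (R := 1) zero_le_one
    fun z hz => (hf z hz).hasDerivWithinAt
  rw [circleIntegral] at h1
  have : ∀ θ : ℝ, deriv (circleMap 0 1) θ • f' (circleMap 0 1 θ) =
      I * (f' (circleMap 0 1 θ) * circleMap 0 1 θ) := fun θ => by
    rw [deriv_circleMap, smul_eq_mul]
    ring
  simp only [this] at h1
  rw [intervalIntegral.integral_const_mul] at h1
  exact (mul_eq_zero.1 h1).resolve_left I_ne_zero

/-- Near the circle the potential is -(1/2π) log |ζ| plus the real part of a single-valued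
holomorphic function. The derivative of the latter integrates to zero around the circle, so only the
logarithm has flux. -/
theorem flux_rawGrad (h : Radii P c R R') (hP : 2 < P) (hc : 1 < c) (p : C(Circle, ℂ))
    {d : ℂ → ℂ} (hd : DifferentiableOn ℂ d (ball 0 R'))
    (hdre : EqOn (fun z => (d z).re) (regLog P c) (ball 0 R')) :
    ∫ θ in (0 : ℝ)..(2 * π), (rawGrad P c R p (circleMap c 1 θ) * (circleMap c 1 θ - c)).re =
      -1 := by
  have hfar : ∀ ζ : ℂ, ‖ζ‖ = 1 → (c : ℂ) + ζ ∈ farSet P c R⁻¹ := fun ζ hζ =>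
    wideCell_subset_farSet h.period_pos h.inv_lt_one
      (circle_subset_wideCell hP hc (by simpa using hζ))
  have hball : ∀ ζ : ℂ, ‖ζ‖ = 1 → ζ ∈ ball (0 : ℂ) R' := fun ζ hζ => by
    rw [mem_ball_zero_iff, hζ]
    exact h.one_lt.trans h.lt
  have hdd : ∀ ζ : ℂ, ‖ζ‖ = 1 → HasDerivAt (fun ζ => d ζ + layer P c R p (c + ζ))
      (deriv d ζ + deriv (layer P c R p) (c + ζ)) ζ := fun ζ hζ =>
    (hd.differentiableAt (isOpen_ball.mem_nhds (hball ζ hζ))).hasDerivAt.add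
      ((analyticAt_layer h p (hfar ζ hζ)).differentiableAt.hasDerivAt.comp_const_add _ _)
  have hgrad : ∀ ζ : ℂ, ‖ζ‖ = 1 → rawGrad P c R p (c + ζ) =
      ((-(2 * π)⁻¹ : ℝ) : ℂ) * ζ⁻¹ + (deriv d ζ + deriv (layer P c R p) (c + ζ)) := by
    intro ζ hζ
    have h0 : ζ ≠ 0 := by
      rintro rfl
      simp at hζ
    -- Both sides are complex derivatives of the same real function near c + ζ, and the real
    -- differential determines the complex number.
    apply reMul_injective
    have e1 := (hasFDerivAt_comp_add_left (c : ℂ)).2 (hasFDerivAt_rawPotential h p (hfar ζ hζ))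
    have e2 : HasFDerivAt (fun ζ : ℂ => -(2 * π)⁻¹ * Real.log ‖ζ‖ +
        (d ζ + layer P c R p (c + ζ)).re) _ ζ :=
      ((hasFDerivAt_log_norm (hasDerivAt_id ζ) h0).const_mul _).add
        (hasFDerivAt_re_of_hasDerivAt (hdd ζ hζ))
    refine (e1.congr_of_eventuallyEq ?_).unique (e2.congr_fderiv ?_)
    · filter_upwards [isOpen_ball.mem_nhds (hball ζ hζ), isOpen_ne.mem_nhds h0] with w hw hw0
      rw [rawPotential_center_add h p hw0 hw, ← hdre hw, add_re]
    · refine ContinuousLinearMap.ext fun v => ?_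
      simp only [add_apply, smul_apply, reMul_apply, smul_eq_mul, add_mul, mul_assoc, add_re,
        re_ofReal_mul, one_div, id]
  have hn : ∀ θ : ℝ, ‖circleMap 0 1 θ‖ = 1 := fun θ => by simp
  have hcm : ∀ θ : ℝ, circleMap (c : ℂ) 1 θ = c + circleMap 0 1 θ := fun θ => by simp [circleMap]
  have hpt : ∀ θ : ℝ, (rawGrad P c R p (circleMap c 1 θ) * (circleMap c 1 θ - c)).re =
      -(2 * π)⁻¹ + ((deriv d (circleMap 0 1 θ) + deriv (layer P c R p) (c + circleMap 0 1 θ)) *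
        circleMap 0 1 θ).re := fun θ => by
    have h0 : circleMap 0 1 θ ≠ 0 := circleMap_ne_center one_ne_zero
    rw [hcm, hgrad _ (hn θ), add_sub_cancel_left, add_mul, mul_assoc, inv_mul_cancel₀ h0, mul_one,
      add_re, ofReal_re]
  simp only [hpt]
  have hcont : Continuous fun θ : ℝ => (deriv d (circleMap 0 1 θ) +
      deriv (layer P c R p) (c + circleMap 0 1 θ)) * circleMap 0 1 θ := by
    refine Continuous.mul (Continuous.add ?_ ?_) (continuous_circleMap 0 1)
    · exact (hd.deriv isOpen_ball).continuousOn.comp_continuous (continuous_circleMap 0 1)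
        fun θ => hball _ (hn θ)
    · rw [continuous_iff_continuousAt]
      intro θ
      have := (analyticAt_layer h p (hfar _ (hn θ))).deriv.continuousAt
      exact this.comp' (f := fun θ : ℝ => (c : ℂ) + circleMap 0 1 θ)
        (continuous_const.add (continuous_circleMap 0 1)).continuousAt
  have hz := integral_deriv_mul_circleMap (f := fun ζ => d ζ + layer P c R p (c + ζ))
    (f' := fun ζ => deriv d ζ + deriv (layer P c R p) (c + ζ))
    fun ζ hζ => hdd ζ (by simpa using hζ)
  have hre : ∫ θ in (0 : ℝ)..(2 * π), ((deriv d (circleMap 0 1 θ) +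
      deriv (layer P c R p) (c + circleMap 0 1 θ)) * circleMap 0 1 θ).re = 0 := by
    have := reCLM.intervalIntegral_comp_comm (μ := volume) (hcont.intervalIntegrable 0 (2 * π))
    rw [hz] at this
    simpa using this
  have hcont' := continuous_re.comp hcont
  simp only [Function.comp_def] at hcont'
  rw [intervalIntegral.integral_add intervalIntegrable_const
    (hcont'.intervalIntegrable _ _), hre, intervalIntegral.integral_const]
  have := Real.pi_ne_zero
  simp only [sub_zero, smul_eq_mul, add_zero]
  field_simp

/-- The data d are a holomorphic function whose real part is `regLog`; solving the integral equation
for d makes the sum of the logarithmic sources and the layer constant on the circle around c. -/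
theorem exists_rawPotential (hP : 2 < P) (hc : 1 < c) :
    ∃ φ g b, PeriodicPotential P c φ g b := by
  obtain ⟨R, R', h⟩ := exists_radii hP hc
  obtain ⟨d, hd, hdre⟩ := HarmonicOnNhd.exists_analyticOnNhd_ball_re_eq (f := regLog P c) (z := 0)
    (R := R') fun ζ hζ => harmonicAt_regLog h hζ
  have hd' : DifferentiableOn ℂ d (ball 0 R') := hd.differentiableOn
  obtain ⟨p, hp⟩ := exists_isDensity h (fun p => isDensity_zero_eq_zero h hP hc) hd'
  have hfar : wideCell P c ⊆ farSet P c R⁻¹ := wideCell_subset_farSet h.period_pos h.inv_lt_one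
  refine ⟨rawPotential P c R p, rawGrad P c R p, (d 0 + regPart P c R p 0).re, ?_, ?_, ?_, ?_, ?_,
    flux_rawGrad h hP hc p hd' hdre, exists_norm_rawGrad_le h p⟩
  · exact fun z hz => harmonicAt_rawPotential h p (hfar hz)
  · exact fun z hz => hasFDerivAt_rawPotential h p (hfar hz)
  · intro z
    rw [rawPotential, rawPotential, layer_add_period h.period_pos, add_right_comm,
      logKernel_add_period h.period_pos, add_right_comm, logKernel_add_period h.period_pos]
  · intro z hz
    obtain ⟨h1, h2⟩ := expSub_sub_center_ne_zero h.period_pos h.inv_pos.le (hfar hz)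
    have e1 : -z + -(c : ℂ) = -(z + c) := by ring
    have e2 : -z + (c : ℂ) = -(z + -c) := by ring
    rw [rawPotential, rawPotential, layer_neg h p (hfar hz), e1, e2, logKernel_neg h1,
      logKernel_neg h2, neg_re]
    ring
  · intro z hz
    have h0 : z - c ≠ 0 := by
      intro h0
      rw [h0, norm_zero] at hz
      exact zero_ne_one hz
    have hb : z - c ∈ ball (0 : ℂ) R' := by
      rw [mem_ball_zero_iff, hz]
      exact h.one_lt.trans h.lt
    have e := rawPotential_center_add h p h0 hb
    rw [hz, Real.log_one, mul_zero, zero_add, ← hdre hb, add_comm (d (z - c)).re,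
      re_layer_on_circle h hd' hp hz] at e
    rwa [add_sub_cancel] at e

theorem conj_mem_wideCell {z : ℂ} (hz : z ∈ wideCell P c) : conj z ∈ wideCell P c := by
  obtain ⟨h1, h2, h3⟩ := hz
  refine ⟨by simpa using h1, ?_, ?_⟩
  · rw [← RCLike.norm_conj, map_sub, conj_conj, conj_ofReal]
    exact h2
  · rw [← RCLike.norm_conj, map_add, conj_conj, conj_ofReal]
    exact h3

theorem complexPartial_eq_of_hasFDerivAt {φ : ℂ → ℝ} {g z : ℂ} (h : HasFDerivAt φ (reMul g) z) :
    (fderiv ℝ φ z 1 : ℂ) - I * fderiv ℝ φ z I = g := by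
  rw [h.fderiv, reMul_apply, reMul_apply, mul_one, mul_I_re]
  apply Complex.ext <;> simp

/-- The differential determines g as ∂ₓφ - i ∂ᵧφ, which is holomorphic for harmonic φ. -/
theorem PeriodicPotential.continuousOn_grad {φ : ℂ → ℝ} {g : ℂ → ℂ} {b : ℝ}
    (h : PeriodicPotential P c φ g b) : ContinuousOn g (wideCell P c) := fun z hz =>
  (HarmonicAt.analyticAt_complex_partial (h.harmonic z hz)).continuousAt.continuousWithinAt.congr
    (fun w hw => (complexPartial_eq_of_hasFDerivAt (h.hasFDerivAt w hw)).symm)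
    (complexPartial_eq_of_hasFDerivAt (h.hasFDerivAt z hz)).symm

/-- Existence of the potential, symmetric under complex conjugation. -/
theorem exists_periodicPotential (hP : 2 < P) (hc : 1 < c) :
    ∃ φ g b, PeriodicPotential P c φ g b ∧ ∀ z, φ (conj z) = φ z := by
  obtain ⟨φ, g, b, h⟩ := exists_rawPotential hP hc
  -- The complex derivative of φ(conj z) is conj (g(conj z)). The symmetrization keeps all the other
  -- properties, because the configuration is invariant under conjugation.
  refine ⟨fun z => (2 : ℝ)⁻¹ * (φ z + φ (conj z)),
    fun z => ((2 : ℝ)⁻¹ : ℝ) * (g z + conj (g (conj z))), b, ⟨?_, ?_, ?_, ?_, ?_, ?_, ?_⟩, ?_⟩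
  · intro z hz
    exact ((h.harmonic z hz).add (harmonicAt_comp_conj
      (h.harmonic _ (conj_mem_wideCell hz)))).const_smul (c := (2 : ℝ)⁻¹)
  · intro z hz
    have e1 := h.hasFDerivAt z hz
    have e2 : HasFDerivAt (fun z => φ (conj z)) _ z :=
      (h.hasFDerivAt _ (conj_mem_wideCell hz)).comp z
        (conjCLE.toContinuousLinearMap.hasFDerivAt (x := z))
    refine ((e1.add e2).const_mul (2 : ℝ)⁻¹).congr_fderiv (ContinuousLinearMap.ext fun v => ?_)
    have e3 : (conj (g (conj z)) * v).re = (g (conj z) * conj v).re := by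
      rw [← conj_re, map_mul, conj_conj]
    simp only [smul_apply, add_apply, ContinuousLinearMap.comp_apply, reMul_apply, smul_eq_mul,
      mul_assoc, re_ofReal_mul, add_mul, add_re, e3]
    rfl
  · intro z
    have : conj (z + P * I) + P * I = conj z := by simp
    rw [h.periodic, ← h.periodic (conj (z + P * I)), this]
  · intro z hz
    rw [h.odd z hz, map_neg, h.odd _ (conj_mem_wideCell hz)]
    ring
  · intro z hz
    have hz' : ‖conj z - c‖ = 1 := by
      rw [← RCLike.norm_conj, map_sub, conj_conj, conj_ofReal]
      exact hz
    rw [h.value z hz, h.value _ hz']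
    ring
  · have hcont := h.continuousOn_grad
    set f : ℝ → ℝ := fun θ => (g (circleMap c 1 θ) * (circleMap c 1 θ - c)).re with hf
    have hfc : Continuous f := by
      refine continuous_re.comp (Continuous.mul ?_ ((continuous_circleMap _ _).sub continuous_const))
      exact hcont.comp_continuous (continuous_circleMap _ _)
        fun θ => circle_subset_wideCell hP hc (by simp [circleMap])
    have hconj : ∀ θ, conj (circleMap (c : ℂ) 1 θ) = circleMap c 1 (2 * π - θ) := fun θ => by
      have e : ((2 * π - θ : ℝ) : ℂ) * I = 2 * π * I + -(θ * I) := by push_cast; ring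
      simp only [circleMap, map_add, map_mul, conj_ofReal, ← exp_conj, conj_I, e, exp_add,
        exp_two_pi_mul_I, one_mul, mul_neg]
    have hpt : ∀ θ, (((2 : ℝ)⁻¹ : ℝ) * (g (circleMap c 1 θ) + conj (g (conj (circleMap c 1 θ)))) *
        (circleMap c 1 θ - c)).re = (2 : ℝ)⁻¹ * (f θ + f (2 * π - θ)) := fun θ => by
      have e3 : (conj (g (conj (circleMap (c : ℂ) 1 θ))) * (circleMap c 1 θ - c)).re =
          (g (conj (circleMap (c : ℂ) 1 θ)) * (conj (circleMap (c : ℂ) 1 θ) - c)).re := by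
        rw [← conj_re, map_mul, conj_conj, map_sub, conj_ofReal]
      rw [mul_assoc, re_ofReal_mul, add_mul, add_re, e3, hconj]
    have hfc' := hfc.comp (continuous_sub_left (2 * π))
    simp only [Function.comp_def] at hfc'
    simp only [hpt]
    rw [intervalIntegral.integral_const_mul, intervalIntegral.integral_add
      (hfc.intervalIntegrable _ _) (hfc'.intervalIntegrable _ _),
      intervalIntegral.integral_comp_sub_left f (2 * π), sub_self, sub_zero]
    have : ∫ θ in (0 : ℝ)..(2 * π), f θ = -1 := h.flux
    rw [this]
    norm_num
  · obtain ⟨B, X, κ, hκ, hB⟩ := h.decay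
    refine ⟨B, X, κ, hκ, fun z hz => ?_⟩
    have e1 := hB z hz
    have e2 := hB (conj z) (by simpa using hz)
    rw [conj_re] at e2
    rw [norm_mul, norm_real, Real.norm_eq_abs, abs_of_pos (by norm_num : (0 : ℝ) < 2⁻¹)]
    have e3 := norm_add_le (g z) (conj (g (conj z)))
    rw [RCLike.norm_conj] at e3
    linarith
  · intro z
    simp only [conj_conj, add_comm]

end

/-! ### Geometry of the period cell; boundary conditions and energy of the potential. -/

section

variable {P c : ℝ} {ε δ : ℝ}

/-- The closed period cell outside the open unit disks around `±c`. -/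
def closedCell (P c : ℝ) : Set ℂ := {z | |z.im| ≤ P / 2 ∧ 1 ≤ ‖z - c‖ ∧ 1 ≤ ‖z + c‖}

/-- The interior of `closedCell`. -/
def openCell (P c : ℝ) : Set ℂ := {z | |z.im| < P / 2 ∧ 1 < ‖z - c‖ ∧ 1 < ‖z + c‖}

theorem isClosed_closedCell (P c : ℝ) : IsClosed (closedCell P c) :=
  (isClosed_le (continuous_im.abs) continuous_const).inter
    ((isClosed_le continuous_const (continuous_id.sub continuous_const).norm).inter
      (isClosed_le continuous_const (continuous_id.add continuous_const).norm))

theorem isOpen_openCell (P c : ℝ) : IsOpen (openCell P c) :=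
  (isOpen_lt (continuous_im.abs) continuous_const).inter
    ((isOpen_lt continuous_const (continuous_id.sub continuous_const).norm).inter
      (isOpen_lt continuous_const (continuous_id.add continuous_const).norm))

theorem openCell_subset_closedCell (P c : ℝ) : openCell P c ⊆ closedCell P c :=
  fun _ hz => ⟨hz.1.le, hz.2.1.le, hz.2.2.le⟩

theorem closedCell_subset_wideCell (hP : 2 < P) : closedCell P c ⊆ wideCell P c :=
  fun _ hz => ⟨hz.1.trans (by linarith), hz.2⟩

theorem neg_mem_openCell {z : ℂ} (hz : z ∈ openCell P c) : -z ∈ openCell P c := by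
  obtain ⟨h1, h2, h3⟩ := hz
  refine ⟨by simpa using h1, ?_, ?_⟩
  · rwa [← norm_neg, neg_sub, sub_neg_eq_add, add_comm]
  · rwa [← norm_neg, neg_add, neg_neg, ← sub_eq_add_neg]

theorem neg_mem_closedCell {z : ℂ} (hz : z ∈ closedCell P c) : -z ∈ closedCell P c := by
  obtain ⟨h1, h2, h3⟩ := hz
  refine ⟨by simpa using h1, ?_, ?_⟩
  · rwa [← norm_neg, neg_sub, sub_neg_eq_add, add_comm]
  · rwa [← norm_neg, neg_add, neg_neg, ← sub_eq_add_neg]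

theorem norm_sub_ge_abs_im (z : ℂ) (c : ℝ) : |z.im| ≤ ‖z - c‖ := by
  simpa using abs_im_le_norm (z - c)

theorem norm_add_ge_abs_im (z : ℂ) (c : ℝ) : |z.im| ≤ ‖z + c‖ := by
  simpa using abs_im_le_norm (z + c)

/-- Every point of the closed cell is touched by a disk inside the open cell. -/
theorem exists_ball_subset_openCell (hP : 2 < P) (hc : 1 < c) {z : ℂ} (hz : z ∈ closedCell P c) :
    ∃ w t, 0 < t ∧ dist z w = t ∧ ball w t ⊆ openCell P c := by
  have key_circle : ∀ z : ℂ, ‖z - c‖ = 1 →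
      ∃ w t, 0 < t ∧ dist z w = t ∧ ball w t ⊆ openCell P c := by
    intro z hz
    have hm : 0 < min (P - 2) (2 * c - 2) := lt_min (by linarith) (by linarith)
    set m := min (P - 2) (2 * c - 2)
    have hm1 : m ≤ P - 2 := min_le_left _ _
    have hm2 : m ≤ 2 * c - 2 := min_le_right _ _
    -- The touching disk lies in the annulus 1 < |x - c| < 1 + m/2, which stays inside the strip and
    -- outside the other disk.
    set t := m / 4 with ht
    have ht0 : 0 < t := by positivity
    have e1 := abs_im_le_norm (z - c)
    have e2 := abs_re_le_norm (z - c)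
    rw [hz] at e1 e2
    simp only [sub_im, ofReal_im, sub_zero, sub_re, ofReal_re] at e1 e2
    refine ⟨z + t * (z - c), t, ht0, ?_, fun x hx => ?_⟩
    · rw [dist_eq_norm, sub_add_cancel_left, norm_neg, norm_mul, hz, mul_one, norm_real,
        Real.norm_eq_abs, abs_of_pos ht0]
    · rw [mem_ball, dist_eq_norm] at hx
      set w := z + t * (z - c) with hw
      have hwim : w.im = (1 + t) * z.im := by simp [hw]; ring
      have hwre : w.re = c + (1 + t) * (z.re - c) := by simp [hw]; ring
      have hwc : ‖w - c‖ = 1 + t := by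
        have : w - c = ((1 + t : ℝ) : ℂ) * (z - c) := by rw [hw]; push_cast; ring
        rw [this, norm_mul, hz, mul_one, norm_real, Real.norm_eq_abs, abs_of_pos (by linarith)]
      have f1 := (abs_im_le_norm (x - w)).trans_lt hx
      have f2 := (abs_re_le_norm (x - w)).trans_lt hx
      rw [sub_im, abs_lt] at f1
      rw [sub_re, abs_lt] at f2
      rw [abs_le] at e1 e2
      refine ⟨?_, ?_, ?_⟩
      · rw [abs_lt]
        constructor <;> nlinarith
      · have := norm_sub_norm_le (w - c) (w - x)
        rw [sub_sub_sub_cancel_left, hwc, norm_sub_rev w x] at this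
        linarith
      · refine lt_of_lt_of_le ?_ (re_le_norm _)
        rw [add_re, ofReal_re]
        nlinarith
  have key_top : ∀ z : ℂ, z.im = P / 2 →
      ∃ w t, 0 < t ∧ dist z w = t ∧ ball w t ⊆ openCell P c := by
    intro z hz
    set t := (P - 2) / 4 with ht
    have ht0 : 0 < t := by rw [ht]; linarith
    refine ⟨z - t * I, t, ht0, ?_, fun x hx => ?_⟩
    · rw [dist_eq_norm, sub_sub_cancel, norm_mul, norm_I, mul_one, norm_real, Real.norm_eq_abs,
        abs_of_pos ht0]
    · rw [mem_ball, dist_eq_norm] at hx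
      have f1 := (abs_im_le_norm _).trans_lt hx
      simp only [sub_im, mul_im, ofReal_re, I_im, mul_one, ofReal_im, I_re, mul_zero, add_zero,
        hz, abs_lt] at f1
      have h1 : 1 < x.im := by linarith
      have h2 : 1 < |x.im| := h1.trans_le (le_abs_self _)
      exact ⟨abs_lt.2 ⟨by linarith, by linarith⟩, h2.trans_le (norm_sub_ge_abs_im x c),
        h2.trans_le (norm_add_ge_abs_im x c)⟩
  have key_neg : ∀ z : ℂ, (∃ w t, 0 < t ∧ dist (-z) w = t ∧ ball w t ⊆ openCell P c) →
      ∃ w t, 0 < t ∧ dist z w = t ∧ ball w t ⊆ openCell P c := by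
    rintro z ⟨w, t, ht, hd, hs⟩
    refine ⟨-w, t, ht, by rw [← dist_neg_neg, neg_neg]; exact hd, fun x hx => ?_⟩
    rw [← neg_neg x]
    refine neg_mem_openCell (hs ?_)
    rw [mem_ball, ← dist_neg_neg, neg_neg]
    exact hx
  obtain ⟨h1, h2, h3⟩ := hz
  rcases h2.eq_or_lt with h2' | h2'
  · exact key_circle z h2'.symm
  rcases h3.eq_or_lt with h3' | h3'
  · refine key_neg z (key_circle (-z) ?_)
    rw [← norm_neg, neg_sub, sub_neg_eq_add, add_comm, h3']
  rcases h1.eq_or_lt with h1' | h1'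
  · rcases abs_cases z.im with ⟨e, _⟩ | ⟨e, _⟩
    · exact key_top z (by rw [← e, h1'])
    · exact key_neg z (key_top (-z) (by rw [neg_im, ← e, h1']))
  · obtain ⟨r, hr, hball⟩ := Metric.isOpen_iff.1 (isOpen_openCell P c) z ⟨h1', h2', h3'⟩
    refine ⟨z + (r / 2 : ℝ), r / 2, by positivity, ?_, fun x hx => hball ?_⟩
    · rw [dist_eq_norm, sub_add_cancel_left, norm_neg, norm_real, Real.norm_eq_abs,
        abs_of_pos (by positivity)]
    · rw [mem_ball] at hx ⊢
      have := dist_triangle x (z + (r / 2 : ℝ)) z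
      have e : dist (z + ((r / 2 : ℝ) : ℂ)) z = r / 2 := by
        rw [dist_eq_norm, add_sub_cancel_left, norm_real, Real.norm_eq_abs,
          abs_of_pos (by positivity)]
      linarith

theorem closure_openCell (hP : 2 < P) (hc : 1 < c) : closure (openCell P c) = closedCell P c := by
  refine (closure_minimal (openCell_subset_closedCell P c) (isClosed_closedCell P c)).antisymm
    fun z hz => ?_
  obtain ⟨w, t, ht, hd, hs⟩ := exists_ball_subset_openCell hP hc hz
  refine closure_mono hs ?_
  rw [closure_ball _ ht.ne', mem_closedBall, hd]

/-- A disk inside the cell touching each boundary point supplies enough directions. With this,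
`fderivWithin` on the closed cell, and so `bdryDeriv`, is the actual differential where one exists.
-/
theorem uniqueDiffOn_closedCell (hP : 2 < P) (hc : 1 < c) : UniqueDiffOn ℝ (closedCell P c) := by
  intro z hz
  obtain ⟨w, t, ht, hd, hs⟩ := exists_ball_subset_openCell hP hc hz
  have h1 : UniqueDiffWithinAt ℝ (ball w t) z := by
    refine uniqueDiffWithinAt_convex (convex_ball w t) ?_ ?_
    · rw [isOpen_ball.interior_eq]
      exact nonempty_ball.2 ht
    · rw [closure_ball _ ht.ne', mem_closedBall, hd]
  exact h1.mono (hs.trans (openCell_subset_closedCell P c))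

theorem centerR_zero (ε δ : ℝ) : centerR ε δ 0 = ((1 + ε / 2 : ℝ) : ℂ) := by
  apply Complex.ext <;> simp [centerR]

theorem centerL_zero (ε δ : ℝ) : centerL ε δ 0 = -((1 + ε / 2 : ℝ) : ℂ) := by
  apply Complex.ext <;> simp [centerL]
  ring

theorem stripDomain_eq (ε δ : ℝ) : stripDomain ε δ = openCell (2 + δ) (1 + ε / 2) := by
  ext z
  rw [stripDomain, closure_union, diskL, diskR, closure_ball _ one_ne_zero,
    closure_ball _ one_ne_zero, centerL_zero, centerR_zero, openCell, strip]
  simp only [Set.mem_sdiff, mem_ofPred_eq, mem_union, mem_closedBall, dist_eq_norm, sub_neg_eq_add, not_or,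
    not_le]
  have : (-1 - δ / 2 < z.im ∧ z.im < 1 + δ / 2) ↔ |z.im| < (2 + δ) / 2 := by
    rw [abs_lt]
    constructor <;> rintro ⟨h1, h2⟩ <;> constructor <;> linarith
  rw [this, and_comm (a := 1 < ‖z + ((1 + ε / 2 : ℝ) : ℂ)‖)]

theorem closure_stripDomain (hε : 0 < ε) (hδ : 0 < δ) :
    closure (stripDomain ε δ) = closedCell (2 + δ) (1 + ε / 2) := by
  rw [stripDomain_eq, closure_openCell (by linarith) (by linarith)]

theorem bdryDeriv_eq (hε : 0 < ε) (hδ : 0 < δ) {f : ℂ → ℝ} {g z : ℂ}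
    (hf : HasFDerivAt f (reMul g) z) (hz : z ∈ closedCell (2 + δ) (1 + ε / 2)) (v : ℂ) :
    bdryDeriv ε δ f z v = (g * v).re := by
  rw [bdryDeriv, closure_stripDomain hε hδ, hf.hasFDerivWithinAt.fderivWithin
    (uniqueDiffOn_closedCell (by linarith) (by linarith) z hz), reMul_apply]

theorem circle_subset_closedCell (hP : 2 < P) (hc : 1 < c) {z : ℂ} (hz : ‖z - c‖ = 1) :
    z ∈ closedCell P c := by
  have h1 := circle_subset_wideCell hP hc hz
  have := norm_sub_ge_abs_im z c
  exact ⟨by linarith, h1.2⟩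

theorem circle_neg_subset_closedCell (hP : 2 < P) (hc : 1 < c) {z : ℂ} (hz : ‖z + c‖ = 1) :
    z ∈ closedCell P c := by
  rw [← neg_neg z]
  refine neg_mem_closedCell (circle_subset_closedCell hP hc ?_)
  rw [← norm_neg, neg_sub, sub_neg_eq_add, add_comm, hz]

theorem line_subset_closedCell (hP : 2 < P) {z : ℂ} (hz : |z.im| = P / 2) :
    z ∈ closedCell P c :=
  ⟨hz.le, by linarith [norm_sub_ge_abs_im z c], by linarith [norm_add_ge_abs_im z c]⟩

namespace PeriodicPotential

variable {φ : ℂ → ℝ} {g : ℂ → ℂ} {b : ℝ}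

/-- Differentiation of the oddness relation. The relation is used only on the closed cell, so
derivatives are compared within that set. -/
theorem grad_neg (h : PeriodicPotential P c φ g b) (hP : 2 < P) (hc : 1 < c) {z : ℂ}
    (hz : z ∈ closedCell P c) : g (-z) = g z := by
  have hW := closedCell_subset_wideCell (c := c) hP
  have h1 := (h.hasFDerivAt _ (hW (neg_mem_closedCell hz))).comp z (hasFDerivAt_id z).neg
  have h2 := (h.hasFDerivAt z (hW hz)).neg
  have h3 : HasFDerivWithinAt (fun z => -φ z) _ (closedCell P c) z :=
    h1.hasFDerivWithinAt.congr (fun w hw => (h.odd w (hW hw)).symm) (h.odd z (hW hz)).symm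
  have h4 := (uniqueDiffOn_closedCell hP hc z hz).eq h3 h2.hasFDerivWithinAt
  apply reMul_injective
  refine ContinuousLinearMap.ext fun v => ?_
  have h5 := congrArg (fun l : ℂ →L[ℝ] ℝ => l v) h4
  simp only [ContinuousLinearMap.comp_apply, neg_apply, map_neg] at h5
  simpa using h5

theorem value_neg (h : PeriodicPotential P c φ g b) (hP : 2 < P) (hc : 1 < c) {z : ℂ}
    (hz : ‖z + c‖ = 1) : φ z = -b := by
  have hz' : ‖-z - c‖ = 1 := by rw [← norm_neg, neg_sub, sub_neg_eq_add, add_comm, hz]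
  have := h.odd (-z) (circle_subset_wideCell hP hc hz')
  rw [neg_neg, h.value _ hz'] at this
  exact this

/-- Zero Neumann data on a line about which `φ` is symmetric. -/
theorem grad_mul_I_re_eq_zero (h : PeriodicPotential P c φ g b) {z : ℂ}
    (hz : z ∈ wideCell P c) (hsymm : ∀ t : ℝ, φ (z + t * I) = φ (z - t * I)) :
    (g z * I).re = 0 := by
  have e : ∀ s : ℂ, HasDerivAt (fun t : ℝ => z + t * s) s 0 := fun s => by
    have := ((hasDerivAt_id (0 : ℝ)).ofReal_comp.mul_const s).const_add z
    simpa using this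
  have hs : ∀ s : ℂ, HasDerivAt (fun t : ℝ => φ (z + t * s)) ((g z * s).re) 0 := fun s => by
    have h0 : z + ((0 : ℝ) : ℂ) * s = z := by simp
    have := (h0.symm ▸ h.hasFDerivAt z hz :
      HasFDerivAt φ (reMul (g z)) (z + ((0 : ℝ) : ℂ) * s)).comp_hasDerivAt (0 : ℝ) (e s)
    exact this
  have h1 := hs I
  have h2 := hs (-I)
  have h3 : (fun t : ℝ => φ (z + t * I)) = fun t : ℝ => φ (z + t * -I) := by
    funext t
    rw [hsymm, mul_neg, sub_eq_add_neg]
  rw [h3] at h1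
  have := h1.unique h2
  rw [mul_neg, neg_re] at this
  linarith

/-- Exponential decay of the gradient in the whole cell. -/
theorem exists_norm_grad_le (h : PeriodicPotential P c φ g b) (hP : 2 < P) :
    ∃ K κ, 0 < κ ∧ 0 ≤ K ∧ ∀ z ∈ closedCell P c, ‖g z‖ ≤ K * Real.exp (-(κ * |z.re|)) := by
  obtain ⟨B, X, κ, hκ, hB⟩ := h.decay
  have hcomp : IsCompact (closedCell P c ∩ {z | |z.re| ≤ X}) := by
    refine ((isCompact_Icc (a := -X) (b := X)).reProdIm
      (isCompact_Icc (a := -(P / 2)) (b := P / 2))).of_isClosed_subset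
      ((isClosed_closedCell P c).inter (isClosed_le continuous_re.abs continuous_const)) ?_
    exact fun z hz => ⟨abs_le.1 hz.2, abs_le.1 hz.1.1⟩
  obtain ⟨M, hM⟩ := hcomp.exists_bound_of_continuousOn
    (h.continuousOn_grad.mono (inter_subset_left.trans (closedCell_subset_wideCell hP)))
  refine ⟨max (max B 0) (max M 0 * Real.exp (κ * X)), κ, hκ, by positivity, fun z hz => ?_⟩
  rcases le_total X |z.re| with hx | hx
  · refine (hB z hx).trans (mul_le_mul_of_nonneg_right ?_ (Real.exp_pos _).le)
    exact (le_max_left _ _).trans (le_max_left _ _)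
  · refine ((hM z ⟨hz, hx⟩).trans (le_max_left M 0)).trans ?_
    calc max M 0 ≤ max M 0 * Real.exp (κ * X) * Real.exp (-(κ * |z.re|)) := by
          rw [mul_assoc, ← Real.exp_add]
          refine le_mul_of_one_le_right (le_max_right _ _) (Real.one_le_exp ?_)
          nlinarith
      _ ≤ _ := mul_le_mul_of_nonneg_right (le_max_right _ _) (Real.exp_pos _).le

/-- `φ` is bounded in the cell. -/
theorem exists_abs_le (h : PeriodicPotential P c φ g b) (hP : 2 < P) (hc : 1 < c) :
    ∃ B, 0 ≤ B ∧ ∀ z ∈ closedCell P c, |φ z| ≤ B := by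
  obtain ⟨K, κ, hκ, hK, hg⟩ := h.exists_norm_grad_le hP
  have hW := closedCell_subset_wideCell (c := c) hP
  have hφc : ContinuousOn φ (closedCell P c) := fun z hz =>
    (h.hasFDerivAt z (hW hz)).continuousAt.continuousWithinAt
  -- Beyond this abscissa whole horizontal lines of the strip lie in the cell.
  set X := c + 1 with hX
  have hcomp : IsCompact (closedCell P c ∩ {z | |z.re| ≤ X}) := by
    refine ((isCompact_Icc (a := -X) (b := X)).reProdIm
      (isCompact_Icc (a := -(P / 2)) (b := P / 2))).of_isClosed_subset
      ((isClosed_closedCell P c).inter (isClosed_le continuous_re.abs continuous_const)) ?_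
    exact fun z hz => ⟨abs_le.1 hz.2, abs_le.1 hz.1.1⟩
  obtain ⟨M, hM⟩ := hcomp.exists_bound_of_continuousOn (hφc.mono inter_subset_left)
  have hfar : ∀ x y : ℝ, X ≤ x → |y| ≤ P / 2 → ((x : ℂ) + y * I) ∈ closedCell P c := by
    intro x y hx hy
    have e1 : ((x : ℂ) + y * I).re = x := by simp
    refine ⟨by simpa using hy, le_trans ?_ (re_le_norm _), le_trans ?_ (re_le_norm _)⟩
    · rw [sub_re, e1, ofReal_re]; linarith
    · rw [add_re, e1, ofReal_re]; linarith
  have hright : ∀ z ∈ closedCell P c, X ≤ z.re → |φ z| ≤ max M 0 + K / κ := by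
    intro z hz hx
    have hd : ∀ x, X ≤ x → HasDerivAt (fun x : ℝ => φ (x + z.im * I)) (g (x + z.im * I)).re x := by
      intro x hx
      have e : HasDerivAt (fun t : ℝ => (t : ℂ) + z.im * I) 1 x := by
        simpa using (hasDerivAt_id x).ofReal_comp.add_const ((z.im : ℂ) * I)
      have := (h.hasFDerivAt _ (hW (hfar x z.im hx hz.1))).comp_hasDerivAt x e
      rw [reMul_apply, mul_one] at this
      exact this
    -- A majorant of |φ| along the horizontal line: its slope is the decay bound for the gradient
    -- and its total growth is at most K/κ.
    have hB : ∀ x : ℝ, HasDerivAt (fun x => max M 0 + K / κ * (1 - Real.exp (-(κ * x))))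
        (K * Real.exp (-(κ * x))) x := by
      intro x
      have := ((((hasDerivAt_id x).const_mul κ).neg.exp.const_sub 1).const_mul (K / κ)).const_add
        (max M 0)
      convert! this using 1
      simp only [Pi.neg_apply, id, mul_one]
      field_simp
    have hmem0 : ((X : ℂ) + z.im * I) ∈ closedCell P c := hfar X z.im le_rfl hz.1
    have := image_norm_le_of_norm_deriv_right_le_deriv_boundary (a := X) (b := z.re)
      (f := fun x : ℝ => φ (x + z.im * I)) (f' := fun x : ℝ => (g (x + z.im * I)).re)
      (fun x hx => (hd x hx.1).continuousAt.continuousWithinAt)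
      (fun x hx => (hd x hx.1).hasDerivWithinAt) (B := fun x => max M 0 +
        K / κ * (1 - Real.exp (-(κ * x)))) (B' := fun x => K * Real.exp (-(κ * x))) ?_ hB ?_
      (right_mem_Icc.2 hx)
    · rw [re_add_im] at this
      refine this.trans ?_
      have e0 := Real.exp_pos (-(κ * z.re))
      have : K / κ * (1 - Real.exp (-(κ * z.re))) ≤ K / κ * 1 :=
        mul_le_mul_of_nonneg_left (by linarith) (by positivity)
      linarith
    · refine (hM _ ⟨hmem0, ?_⟩).trans ((le_max_left M 0).trans (le_add_of_nonneg_right ?_))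
      · simp [abs_of_pos (show 0 < X by linarith)]
      · refine mul_nonneg (by positivity) (sub_nonneg.2 (Real.exp_le_one_iff.2 ?_))
        have : 0 < κ * X := mul_pos hκ (by linarith)
        linarith
    · intro x hx
      have := hg _ (hfar x z.im hx.1 hz.1)
      have e1 : ((x : ℂ) + z.im * I).re = x := by simp
      rw [e1, abs_of_pos (by linarith [hx.1] : 0 < x)] at this
      exact (abs_re_le_norm _).trans this
  refine ⟨max M 0 + K / κ, by positivity, fun z hz => ?_⟩
  rcases le_total |z.re| X with hx | hx
  · refine (hM z ⟨hz, hx⟩).trans ((le_max_left M 0).trans (le_add_of_nonneg_right (by positivity)))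
  · rcases abs_cases z.re with ⟨e, _⟩ | ⟨e, _⟩
    · exact hright z hz (e ▸ hx)
    · have := hright (-z) (neg_mem_closedCell hz) (by rw [neg_re]; exact e ▸ hx)
      rwa [h.odd z (hW hz), abs_neg] at this

end PeriodicPotential

/-- Comparison with 1/(1 + x²), through the quadratic lower bound for the exponential. -/
theorem integrable_exp_neg_mul_abs {κ : ℝ} (hκ : 0 < κ) :
    Integrable fun x : ℝ => Real.exp (-(κ * |x|)) := by
  have h1 := integrable_inv_one_add_sq.const_mul (max 1 (2 / κ ^ 2))
  refine h1.mono' (by fun_prop) (Eventually.of_forall fun x => ?_)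
  rw [Real.norm_eq_abs, abs_of_pos (Real.exp_pos _), Real.exp_neg, ← div_eq_mul_inv,
    inv_eq_one_div, div_le_div_iff₀ (Real.exp_pos _) (by positivity)]
  have h2 := Real.quadratic_le_exp_of_nonneg (x := κ * |x|) (by positivity)
  have h3 : 1 + (κ * |x|) ^ 2 / 2 ≤ Real.exp (κ * |x|) := by
    have : 0 ≤ κ * |x| := by positivity
    linarith
  rw [mul_pow, sq_abs] at h3
  have h4 : (2 / κ ^ 2) * (κ ^ 2 * x ^ 2 / 2) = x ^ 2 := by field_simp
  calc 1 * (1 + x ^ 2) = 1 + (2 / κ ^ 2) * (κ ^ 2 * x ^ 2 / 2) := by rw [h4]; ring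
    _ ≤ max 1 (2 / κ ^ 2) * 1 + max 1 (2 / κ ^ 2) * (κ ^ 2 * x ^ 2 / 2) := by
        refine add_le_add ?_ (mul_le_mul_of_nonneg_right (le_max_right _ _) (by positivity))
        rw [mul_one]
        exact le_max_left _ _
    _ = max 1 (2 / κ ^ 2) * (1 + κ ^ 2 * x ^ 2 / 2) := by ring
    _ ≤ _ := mul_le_mul_of_nonneg_left h3 (by positivity)

theorem norm_gradient_eq (f : ℂ → ℝ) (z : ℂ) : ‖∇ f z‖ = ‖fderiv ℝ f z‖ :=
  (toDual ℝ ℂ).symm.norm_map _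

theorem norm_reMul_le (g : ℂ) : ‖reMul g‖ ≤ ‖g‖ := by
  refine ContinuousLinearMap.opNorm_le_bound _ (norm_nonneg _) fun v => ?_
  rw [reMul_apply, ← norm_mul]
  exact abs_re_le_norm _

/-- In the cell |∇φ|² is at most K² e^{-2κ|x|}, and the strip has bounded height; Tonelli separates
the two factors. -/
theorem PeriodicPotential.finiteEnergy {φ : ℂ → ℝ} {g : ℂ → ℂ} {b : ℝ} (hδ : 0 < δ)
    (h : PeriodicPotential (2 + δ) (1 + ε / 2) φ g b) : FiniteEnergy ε δ φ := by
  obtain ⟨K, κ, hκ, hK, hg⟩ := h.exists_norm_grad_le (by linarith)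
  have hW := closedCell_subset_wideCell (P := 2 + δ) (c := 1 + ε / 2) (by linarith)
  rw [FiniteEnergy, stripDomain_eq]
  set F : ℝ → ENNReal := fun x => ENNReal.ofReal (K ^ 2 * Real.exp (-(2 * κ * |x|))) with hF
  set G : ℝ → ENNReal := (Icc (-((2 + δ) / 2)) ((2 + δ) / 2)).indicator 1 with hG
  have hFm : Measurable F := by fun_prop
  have hGm : Measurable G := measurable_one.indicator measurableSet_Icc
  calc ∫⁻ z in openCell (2 + δ) (1 + ε / 2), ENNReal.ofReal (‖∇ φ z‖ ^ 2)
      ≤ ∫⁻ z in openCell (2 + δ) (1 + ε / 2), F z.re * G z.im := by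
        refine setLIntegral_mono' (isOpen_openCell _ _).measurableSet fun z hz => ?_
        have hz' := openCell_subset_closedCell _ _ hz
        have e1 : G z.im = 1 := indicator_of_mem (mem_Icc.2 (abs_le.1 hz'.1)) _
        rw [e1, mul_one]
        refine ENNReal.ofReal_le_ofReal ?_
        rw [norm_gradient_eq, (h.hasFDerivAt z (hW hz')).fderiv]
        calc ‖reMul (g z)‖ ^ 2 ≤ (K * Real.exp (-(κ * |z.re|))) ^ 2 := by
              gcongr
              exact (norm_reMul_le _).trans (hg z hz')
          _ = _ := by
              rw [mul_pow, ← Real.exp_nat_mul]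
              congr 2
              push_cast
              ring
    _ ≤ ∫⁻ z : ℂ, F z.re * G z.im := setLIntegral_le_lintegral _ _
    _ = ∫⁻ q : ℝ × ℝ, F q.1 * G q.2 := by
        rw [← volume_preserving_equiv_real_prod.lintegral_comp_emb
          measurableEquivRealProd.measurableEmbedding]
        rfl
    _ = (∫⁻ x, F x) * ∫⁻ y, G y := by
        rw [Measure.volume_eq_prod, lintegral_prod_mul hFm.aemeasurable hGm.aemeasurable]
    _ < ⊤ := by
        refine ENNReal.mul_lt_top ?_ ?_
        · have := ((integrable_exp_neg_mul_abs (κ := 2 * κ) (by positivity)).const_mul (K ^ 2))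
          have h2 := this.2
          rw [hasFiniteIntegral_iff_ofReal (Eventually.of_forall fun x => by positivity)] at h2
          exact h2
        · rw [hG, lintegral_indicator_one measurableSet_Icc]
          exact measure_Icc_lt_top

/-- The right circle comes from the construction, the left one from oddness, and the Neumann
conditions from conjugation symmetry combined with periodicity. -/
theorem PeriodicPotential.isPotential {φ : ℂ → ℝ} {g : ℂ → ℂ} {b : ℝ} (hε : 0 < ε) (hδ : 0 < δ)
    (h : PeriodicPotential (2 + δ) (1 + ε / 2) φ g b) (hconj : ∀ z, φ (conj z) = φ z) :
    IsPotential ε δ φ b := by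
  have hP : 2 < 2 + δ := by linarith
  have hc : 1 < 1 + ε / 2 := by linarith
  have hW := closedCell_subset_wideCell (c := 1 + ε / 2) hP
  have hcirc : ∀ θ : ℝ, ‖circleMap ((1 + ε / 2 : ℝ) : ℂ) 1 θ - ((1 + ε / 2 : ℝ) : ℂ)‖ = 1 :=
    fun θ => by simp [circleMap]
  have hfluxR : circleInt (centerR ε δ 0) (normalDeriv ε δ (centerR ε δ 0) φ) = 1 := by
    have hpt : ∀ θ : ℝ, normalDeriv ε δ (centerR ε δ 0) φ (circleMap (centerR ε δ 0) 1 θ) =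
        -(g (circleMap ((1 + ε / 2 : ℝ) : ℂ) 1 θ) *
          (circleMap ((1 + ε / 2 : ℝ) : ℂ) 1 θ - ((1 + ε / 2 : ℝ) : ℂ))).re := fun θ => by
      have hm := circle_subset_closedCell hP hc (hcirc θ)
      rw [normalDeriv, centerR_zero, bdryDeriv_eq hε hδ (h.hasFDerivAt _ (hW hm)) hm, ← neg_re,
        ← mul_neg, neg_sub]
    rw [circleInt]
    simp only [hpt]
    rw [intervalIntegral.integral_neg, h.flux, neg_neg]
  refine ⟨?_, ?_, ?_, ?_, ?_, ?_, hfluxR, ?_, h.finiteEnergy hδ⟩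
  · rw [stripDomain_eq]
    exact fun z hz => h.harmonic z (hW (openCell_subset_closedCell _ _ hz))
  · rw [closure_stripDomain hε hδ]
    exact fun z hz => ((h.harmonic z (hW hz)).1.of_le one_le_two).contDiffWithinAt
  · intro z hz
    have hm : z ∈ closedCell (2 + δ) (1 + ε / 2) := line_subset_closedCell hP (by
      rw [hz, abs_of_pos (by linarith)]; ring)
    rw [bdryDeriv_eq hε hδ (h.hasFDerivAt z (hW hm)) hm]
    -- On Im z = P/2, conjugating z + it and adding iP gives z - it.
    refine h.grad_mul_I_re_eq_zero (hW hm) fun t => ?_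
    rw [← hconj, ← h.periodic]
    congr 1
    apply Complex.ext
    · simp
    · simp [hz]; ring
  · intro z hz
    have hm : z ∈ closedCell (2 + δ) (1 + ε / 2) := line_subset_closedCell hP (by
      rw [hz, abs_of_neg (by linarith)]; ring)
    rw [bdryDeriv_eq hε hδ (h.hasFDerivAt z (hW hm)) hm, mul_neg, neg_re, neg_eq_zero]
    refine h.grad_mul_I_re_eq_zero (hW hm) fun t => ?_
    rw [← hconj (z + t * I), ← h.periodic (z - t * I)]
    congr 1
    apply Complex.ext
    · simp
    · simp [hz]; ring
  · intro z hz
    rw [centerR_zero, mem_sphere_iff_norm] at hz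
    exact h.value z hz
  · intro z hz
    rw [centerL_zero, mem_sphere_iff_norm, sub_neg_eq_add] at hz
    exact h.value_neg hP hc hz
  · set G : ℝ → ℝ := fun θ =>
      normalDeriv ε δ (centerR ε δ 0) φ (circleMap (centerR ε δ 0) 1 θ) with hG
    -- The point of the left circle at angle θ is minus the point of the right circle at angle θ +
    -- π. The gradient is even and the inner normal changes sign, so the normal derivative changes
    -- sign.
    have hpt : ∀ θ : ℝ, normalDeriv ε δ (centerL ε δ 0) φ (circleMap (centerL ε δ 0) 1 θ) =
        -G (θ + π) := fun θ => by
      have hneg : circleMap (centerL ε δ 0) 1 θ =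
          -circleMap ((1 + ε / 2 : ℝ) : ℂ) 1 (θ + π) := by
        rw [centerL_zero]
        simp only [circleMap, ofReal_add, add_mul, exp_add, exp_pi_mul_I]
        ring
      have hm := circle_subset_closedCell hP hc (hcirc (θ + π))
      have hm' := neg_mem_closedCell hm
      rw [hG]
      simp only [normalDeriv]
      rw [hneg, centerR_zero, centerL_zero, bdryDeriv_eq hε hδ (h.hasFDerivAt _ (hW hm)) hm,
        bdryDeriv_eq hε hδ (h.hasFDerivAt _ (hW hm')) hm', h.grad_neg hP hc hm, ← neg_re, ← mul_neg]
      congr 2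
      ring
    have hper : Function.Periodic G (2 * π) := fun θ => by
      simp only [hG, (periodic_circleMap (centerR ε δ 0) 1) θ]
    rw [circleInt]
    simp only [hpt]
    rw [intervalIntegral.integral_neg, neg_neg, intervalIntegral.integral_comp_add_right, zero_add,
      add_comm (2 * π), hper.intervalIntegral_add_eq π 0, zero_add]
    exact hfluxR

end

/-! ### Radial cutoffs concentrating on the unit circle. -/

section

variable {P c : ℝ} {s ρ r : ℝ}

/-- A smooth radial cutoff: `0` for `ρ ≤ 1 + s` and `1` for `ρ ≥ 1 + 2s`. -/
def cutoff (s ρ : ℝ) : ℝ := Real.smoothTransition ((ρ - 1 - s) / s)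

theorem contDiff_cutoff (s : ℝ) : ContDiff ℝ 1 (cutoff s) :=
  Real.smoothTransition.contDiff.comp (((contDiff_id.sub contDiff_const).sub contDiff_const).div_const s)

theorem cutoff_eq_zero (hs : 0 < s) (h : ρ ≤ 1 + s) : cutoff s ρ = 0 :=
  Real.smoothTransition.zero_of_nonpos (div_nonpos_of_nonpos_of_nonneg (by linarith) hs.le)

theorem cutoff_eq_one (hs : 0 < s) (h : 1 + 2 * s ≤ ρ) : cutoff s ρ = 1 :=
  Real.smoothTransition.one_of_one_le (by rw [le_div_iff₀ hs]; linarith)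

theorem monotone_cutoff (hs : 0 < s) : Monotone (cutoff s) := fun a b hab =>
  Real.smoothTransition.monotone (by gcongr)

theorem hasDerivAt_cutoff (s ρ : ℝ) : HasDerivAt (cutoff s) (deriv (cutoff s) ρ) ρ :=
  ((contDiff_cutoff s).differentiable one_ne_zero ρ).hasDerivAt

theorem continuous_deriv_cutoff (s : ℝ) : Continuous (deriv (cutoff s)) :=
  (contDiff_cutoff s).continuous_deriv le_rfl

theorem deriv_cutoff_nonneg (hs : 0 < s) (ρ : ℝ) : 0 ≤ deriv (cutoff s) ρ :=
  (hasDerivAt_cutoff s ρ).nonneg_of_monotone (monotone_cutoff hs)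

theorem deriv_cutoff_eq_zero_of_lt (hs : 0 < s) (h : ρ < 1 + s) : deriv (cutoff s) ρ = 0 := by
  have : cutoff s =ᶠ[𝓝 ρ] fun _ => 0 := by
    filter_upwards [Iio_mem_nhds h] with t ht using cutoff_eq_zero hs (le_of_lt ht)
  rw [this.deriv_eq, deriv_const]

theorem deriv_cutoff_eq_zero_of_gt (hs : 0 < s) (h : 1 + 2 * s < ρ) : deriv (cutoff s) ρ = 0 := by
  have : cutoff s =ᶠ[𝓝 ρ] fun _ => 1 := by
    filter_upwards [Ioi_mem_nhds h] with t ht using cutoff_eq_one hs (le_of_lt ht)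
  rw [this.deriv_eq, deriv_const]

theorem integral_deriv_cutoff (hs : 0 < s) (hr : 1 + 2 * s ≤ r) :
    ∫ ρ in (1 : ℝ)..r, deriv (cutoff s) ρ = 1 := by
  rw [intervalIntegral.integral_deriv_eq_sub
    (fun x _ => (hasDerivAt_cutoff s x).differentiableAt)
    ((continuous_deriv_cutoff s).intervalIntegrable _ _), cutoff_eq_one hs hr,
    cutoff_eq_zero hs (by linarith), sub_zero]

/-- Away from a, write |z - a| = exp (log |z - a|). At z = a the formula reads 0/0 = 0, which is
right because the cutoff vanishes near a. -/
theorem hasFDerivAt_cutoff_norm (hs : 0 < s) (a z : ℂ) :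
    HasFDerivAt (fun z => cutoff s ‖z - a‖)
      (reMul ((deriv (cutoff s) ‖z - a‖ * ‖z - a‖ : ℝ) / (z - a))) z := by
  by_cases hz : z = a
  · subst hz
    have : (fun w => cutoff s ‖w - z‖) =ᶠ[𝓝 z] fun _ => 0 := by
      filter_upwards [ball_mem_nhds z one_pos] with w hw
      rw [mem_ball, dist_eq_norm] at hw
      exact cutoff_eq_zero hs (by linarith)
    refine ((hasFDerivAt_const (0 : ℝ) z).congr_of_eventuallyEq this).congr_fderiv ?_
    ext v
    simp [reMul_apply]
  · have hz' : z - a ≠ 0 := sub_ne_zero.2 hz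
    have h1 := (hasFDerivAt_log_norm ((hasDerivAt_id z).sub_const a) hz').exp
    have h2 : HasFDerivAt (fun z => ‖z - a‖) (‖z - a‖ • reMul (1 / (z - a))) z := by
      refine (h1.congr_of_eventuallyEq ?_).congr_fderiv ?_
      · have : ∀ᶠ w in 𝓝 z, w - a ≠ 0 :=
          ((continuous_id.sub continuous_const).continuousAt).eventually_ne hz'
        filter_upwards [this] with w hw
        simp [Real.exp_log (norm_pos_iff.2 hw)]
      · simp [Real.exp_log (norm_pos_iff.2 hz')]
    refine ((hasDerivAt_cutoff s ‖z - a‖).comp_hasFDerivAt z h2).congr_fderiv ?_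
    refine ContinuousLinearMap.ext fun v => ?_
    simp only [smul_apply, reMul_apply, smul_eq_mul]
    rw [← re_ofReal_mul, ← re_ofReal_mul]
    congr 1
    push_cast
    ring

section Radial

variable {h : ℂ → ℝ} {w : ℝ → ℝ}

theorem isCompact_annulus (r : ℝ) : IsCompact {z : ℂ | 1 ≤ ‖z‖ ∧ ‖z‖ ≤ r} := by
  refine (isCompact_closedBall (0 : ℂ) r).of_isClosed_subset
    ((isClosed_le continuous_const continuous_norm).inter
      (isClosed_le continuous_norm continuous_const)) fun z hz => ?_
  rw [mem_closedBall_zero_iff]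
  exact hz.2

theorem integrable_radial_mul (hw : Continuous w) (h1 : ∀ ρ < 1, w ρ = 0) (h2 : ∀ ρ > r, w ρ = 0)
    (hh : ContinuousOn h {z | 1 ≤ ‖z‖ ∧ ‖z‖ ≤ r}) : Integrable fun z : ℂ => w ‖z‖ * h z := by
  have hi : IntegrableOn (fun z : ℂ => w ‖z‖ * h z) {z : ℂ | 1 ≤ ‖z‖ ∧ ‖z‖ ≤ r} :=
    ((hw.comp continuous_norm).continuousOn.mul hh).integrableOn_compact (isCompact_annulus r)
  refine hi.integrable_of_forall_notMem_eq_zero fun z hz => ?_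
  rw [mem_ofPred_eq, not_and_or, not_le, not_le] at hz
  rcases hz with hz | hz
  · rw [h1 _ hz, zero_mul]
  · rw [h2 _ hz, zero_mul]

/-- Clamping the radius to [1, r] gives a continuous function for all radii, equal to the original
wherever the weights used below are nonzero. -/
theorem continuous_circle_clamp (hr : 1 ≤ r) (hh : ContinuousOn h {z | 1 ≤ ‖z‖ ∧ ‖z‖ ≤ r}) :
    Continuous fun p : ℝ × ℝ => h (circleMap 0 (max 1 (min p.1 r)) p.2) := by
  refine hh.comp_continuous (f := fun p : ℝ × ℝ => circleMap 0 (max 1 (min p.1 r)) p.2) ?_ fun p => ?_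
  · unfold circleMap
    fun_prop
  · have : 0 ≤ max 1 (min p.1 r) := le_max_of_le_left zero_le_one
    simp [circleMap, abs_of_nonneg this, hr]

/-- Polar coordinates; the factor ρ is the Jacobian, and the support of w reduces the radial
integral to [1, r]. -/
theorem integral_radial_mul (hr : 1 ≤ r) (hw : Continuous w) (h1 : ∀ ρ < 1, w ρ = 0)
    (h2 : ∀ ρ > r, w ρ = 0) (hh : ContinuousOn h {z | 1 ≤ ‖z‖ ∧ ‖z‖ ≤ r}) :
    ∫ z : ℂ, w ‖z‖ * h z = ∫ ρ in (1 : ℝ)..r, w ρ *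
      (ρ * ∫ θ in (0 : ℝ)..(2 * π), h (circleMap 0 (max 1 (min ρ r)) θ)) := by
  have hC := continuous_circle_clamp hr hh
  set k : ℝ × ℝ → ℝ := fun p => w p.1 * (p.1 * h (circleMap 0 (max 1 (min p.1 r)) p.2)) with hk
  have hkc : Continuous k := (hw.comp continuous_fst).mul (continuous_fst.mul hC)
  have hzero : ∀ p : ℝ × ℝ, p.1 ∉ Icc 1 r → w p.1 = 0 := fun p hp => by
    rw [mem_Icc, not_and_or, not_le, not_le] at hp
    exact hp.elim (h1 _) (h2 _)
  rw [← Complex.integral_comp_polarCoord_symm]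
  have e1 : ∫ p in polarCoord.target, p.1 • (w ‖Complex.polarCoord.symm p‖ *
      h (Complex.polarCoord.symm p)) = ∫ p in polarCoord.target, k p := by
    refine setIntegral_congr_fun polarCoord.open_target.measurableSet fun p hp => ?_
    have hp0 : 0 < p.1 := hp.1
    simp only [hk, smul_eq_mul, norm_polarCoord_symm, abs_of_pos hp0]
    by_cases hm : p.1 ∈ Icc 1 r
    · rw [min_eq_left hm.2, max_eq_right hm.1]
      have : Complex.polarCoord.symm p = circleMap 0 p.1 p.2 := by
        rw [Complex.polarCoord_symm_apply, circleMap, zero_add, exp_mul_I, ofReal_cos, ofReal_sin]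
      rw [this]
      ring
    · rw [hzero p hm]
      ring
  have e2 : ∫ p in polarCoord.target, k p = ∫ p in Icc 1 r ×ˢ Ioo (-π) π, k p := by
    refine setIntegral_eq_of_subset_of_forall_sdiff_eq_zero
      polarCoord.open_target.measurableSet ?_ ?_
    · exact prod_mono (fun x (hx : x ∈ Icc 1 r) => zero_lt_one.trans_le hx.1) le_rfl
    · rintro p ⟨hp, hp'⟩
      have : p.1 ∉ Icc 1 r := fun hm => hp' ⟨hm, hp.2⟩
      simp only [hk, hzero p this, zero_mul]
  have hInt : IntegrableOn k (Icc 1 r ×ˢ Ioo (-π) π) (volume.prod volume) := by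
    rw [← Measure.volume_eq_prod]
    exact (hkc.continuousOn.integrableOn_compact
      (isCompact_Icc.prod isCompact_Icc)).mono_set (prod_mono le_rfl Ioo_subset_Icc_self)
  rw [e1, e2, Measure.volume_eq_prod, setIntegral_prod _ hInt, integral_Icc_eq_integral_Ioc,
    ← intervalIntegral.integral_of_le hr]
  refine intervalIntegral.integral_congr fun ρ _ => ?_
  simp only [hk]
  rw [integral_const_mul, integral_const_mul, ← integral_Ioc_eq_integral_Ioo,
    ← intervalIntegral.integral_of_le (by linarith [Real.pi_pos])]
  have hper : Function.Periodic (fun θ => h (circleMap 0 (max 1 (min ρ r)) θ)) (2 * π) := fun θ => by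
    simp only [periodic_circleMap 0 (max 1 (min ρ r)) θ]
  have := hper.intervalIntegral_add_eq (-π) 0
  rw [zero_add, show -π + 2 * π = π by ring] at this
  rw [this]

/-- Radial averages against a concentrating cutoff converge to the average on the unit circle. -/
theorem exists_integral_cutoff_near (hr : 1 < r) (hh : ContinuousOn h {z | 1 ≤ ‖z‖ ∧ ‖z‖ ≤ r})
    {η : ℝ} (hη : 0 < η) : ∃ s₀ > 0, ∀ s, 0 < s → s < s₀ →
      |(∫ z : ℂ, deriv (cutoff s) ‖z‖ * h z) - ∫ θ in (0 : ℝ)..(2 * π), h (circleMap 0 1 θ)| ≤ η := by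
  -- J is continuous and J(1) is the circle integral; the derivative of the cutoff is a nonnegative
  -- weight of mass 1.
  set J : ℝ → ℝ := fun ρ => ρ * ∫ θ in (0 : ℝ)..(2 * π), h (circleMap 0 (max 1 (min ρ r)) θ) with hJ
  have hJc : Continuous J := continuous_id.mul
    (intervalIntegral.continuous_parametric_intervalIntegral_of_continuous'
      (f := fun ρ θ => h (circleMap 0 (max 1 (min ρ r)) θ)) (continuous_circle_clamp hr.le hh) _ _)
  have hJ1 : J 1 = ∫ θ in (0 : ℝ)..(2 * π), h (circleMap 0 1 θ) := by
    simp only [hJ, min_eq_left hr.le, max_self, one_mul]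
  obtain ⟨d, hd, hJd⟩ := Metric.continuousAt_iff.1 (hJc.continuousAt (x := 1)) η hη
  -- The weight lives on [1 + s, 1 + 2s]; this choice keeps 2s below both d and r - 1.
  refine ⟨min (d / 3) ((r - 1) / 3), lt_min (by positivity) (by linarith), fun s hs hs0 => ?_⟩
  have hsd : s < d / 3 := hs0.trans_le (min_le_left _ _)
  have hsr : s < (r - 1) / 3 := hs0.trans_le (min_le_right _ _)
  have hw := continuous_deriv_cutoff s
  rw [← hJ1, integral_radial_mul hr.le hw
    (fun ρ hρ => deriv_cutoff_eq_zero_of_lt hs (by linarith))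
    (fun ρ hρ => deriv_cutoff_eq_zero_of_gt hs (by linarith)) hh]
  have e : J 1 = ∫ ρ in (1 : ℝ)..r, deriv (cutoff s) ρ * J 1 := by
    rw [intervalIntegral.integral_mul_const, integral_deriv_cutoff hs (by linarith), one_mul]
  change |(∫ ρ in (1 : ℝ)..r, deriv (cutoff s) ρ * J ρ) - J 1| ≤ η
  rw [e, ← intervalIntegral.integral_sub (f := fun ρ => deriv (cutoff s) ρ * J ρ)
    (g := fun ρ => deriv (cutoff s) ρ * J 1) ((hw.mul hJc).intervalIntegrable _ _)
    ((hw.mul continuous_const).intervalIntegrable _ _), ← Real.norm_eq_abs]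
  refine (intervalIntegral.norm_integral_le_of_norm_le (g := fun ρ => deriv (cutoff s) ρ * η) hr.le
    (Eventually.of_forall fun ρ hρ => ?_) ((hw.mul continuous_const).intervalIntegrable _ _)).trans ?_
  · rw [← mul_sub, norm_mul, Real.norm_of_nonneg (deriv_cutoff_nonneg hs ρ)]
    by_cases hρs : 1 + 2 * s < ρ
    · rw [deriv_cutoff_eq_zero_of_gt hs hρs, zero_mul, zero_mul]
    · refine mul_le_mul_of_nonneg_left (le_of_lt ?_) (deriv_cutoff_nonneg hs ρ)
      refine hJd ?_
      rw [Real.dist_eq, abs_of_pos (by linarith [hρ.1])]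
      linarith
  · rw [intervalIntegral.integral_mul_const, integral_deriv_cutoff hs (by linarith), one_mul]

end Radial

end

/-! ### The divergence theorem in the perforated cell. -/

section

variable {P c : ℝ} {s ρ r : ℝ}

/-- The outward flux of the field `(p, q)` through the unit circle around `a`. -/
def circleFlux (a : ℂ) (p q : ℂ → ℝ) : ℝ :=
  ∫ θ in (0 : ℝ)..(2 * π), (Real.cos θ * p (circleMap a 1 θ) + Real.sin θ * q (circleMap a 1 θ))

/-- The component of the field `(p, q)` in the radial direction from `a`, in terms of `ζ = z - a`. -/
def radialPart (a : ℂ) (p q : ℂ → ℝ) (ζ : ℂ) : ℝ :=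
  ((‖ζ‖ : ℂ) / ζ).re * p (a + ζ) + ((‖ζ‖ : ℂ) / ζ * I).re * q (a + ζ)

/-- On the unit circle |ζ|/ζ is cos θ - i sin θ. -/
theorem integral_radialPart (a : ℂ) (p q : ℂ → ℝ) :
    ∫ θ in (0 : ℝ)..(2 * π), radialPart a p q (circleMap 0 1 θ) = circleFlux a p q := by
  refine intervalIntegral.integral_congr fun θ _ => ?_
  have e : ((‖circleMap 0 1 θ‖ : ℝ) : ℂ) / circleMap 0 1 θ = Real.cos θ - Real.sin θ * I := by
    have h1 : ‖circleMap 0 1 θ‖ = 1 := by simp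
    rw [h1, circleMap_zero, ofReal_one, one_mul, one_div, ← exp_neg, ← neg_mul, ← ofReal_neg,
      exp_mul_I, ← ofReal_cos, ← ofReal_sin, Real.cos_neg, Real.sin_neg, ofReal_neg]
    ring
  have h2 : a + circleMap 0 1 θ = circleMap a 1 θ := by simp [circleMap]
  simp only [radialPart, e, h2]
  simp [-ofReal_cos, -ofReal_sin]

theorem continuousOn_radialPart {a : ℂ} {p q : ℂ → ℝ} {S : Set ℂ} (hp : ContinuousOn p S)
    (hq : ContinuousOn q S) (hS : ∀ ζ : ℂ, 1 ≤ ‖ζ‖ → ‖ζ‖ ≤ r → a + ζ ∈ S) :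
    ContinuousOn (radialPart a p q) {z | 1 ≤ ‖z‖ ∧ ‖z‖ ≤ r} := by
  have h1 : ContinuousOn (fun ζ : ℂ => (‖ζ‖ : ℂ) / ζ) {z | 1 ≤ ‖z‖ ∧ ‖z‖ ≤ r} := by
    refine (continuous_ofReal.comp continuous_norm).continuousOn.div continuousOn_id fun ζ hζ => ?_
    exact norm_pos_iff.1 (zero_lt_one.trans_le hζ.1)
  have hadd : ContinuousOn (fun ζ : ℂ => a + ζ) {z | 1 ≤ ‖z‖ ∧ ‖z‖ ≤ r} :=
    (continuous_const.add continuous_id).continuousOn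
  have hm : MapsTo (fun ζ : ℂ => a + ζ) {z | 1 ≤ ‖z‖ ∧ ‖z‖ ≤ r} S := fun ζ hζ => hS ζ hζ.1 hζ.2
  exact ((continuous_re.comp_continuousOn h1).mul (hp.comp hadd hm)).add
    ((continuous_re.comp_continuousOn (h1.mul continuousOn_const)).mul (hq.comp hadd hm))

/-- The integral over the plane of a function supported in a rectangle, as an iterated integral. -/
theorem integral_integral_eq_integral {T : ℂ → ℝ} (hT : Integrable T) {X Y : ℝ} (hX : 0 ≤ X)
    (hY : 0 ≤ Y) (h0 : ∀ z : ℂ, T z ≠ 0 → |z.re| < X ∧ |z.im| < Y) :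
    ∫ x in (-X)..X, ∫ y in (-Y)..Y, T (equivRealProdCLM.symm (x, y)) = ∫ z, T z := by
  have hi : Integrable (fun q : ℝ × ℝ => T (equivRealProdCLM.symm q)) :=
    (volume_preserving_equiv_real_prod.symm.integrable_comp_emb
      measurableEquivRealProd.symm.measurableEmbedding).2 hT
  have e1 : ∫ z, T z = ∫ q : ℝ × ℝ, T (equivRealProdCLM.symm q) :=
    (volume_preserving_equiv_real_prod.symm.integral_comp
      measurableEquivRealProd.symm.measurableEmbedding T).symm
  have e2 : ∫ q : ℝ × ℝ, T (equivRealProdCLM.symm q) =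
      ∫ q in Ioc (-X) X ×ˢ Ioc (-Y) Y, T (equivRealProdCLM.symm q) := by
    refine (setIntegral_eq_integral_of_forall_compl_eq_zero fun q hq => ?_).symm
    by_contra hne
    obtain ⟨hx, hy⟩ := h0 _ hne
    rw [abs_lt] at hx hy
    exact hq ⟨⟨hx.1, hx.2.le⟩, ⟨hy.1, hy.2.le⟩⟩
  rw [e1, e2, Measure.volume_eq_prod, setIntegral_prod]
  · rw [intervalIntegral.integral_of_le (by linarith)]
    simp only [intervalIntegral.integral_of_le (show -Y ≤ Y by linarith)]
  · rw [← Measure.volume_eq_prod]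
    exact hi.integrableOn

/-- A radius up to which the annuli around `±c` are disjoint and inside the cell. -/
theorem exists_annulus_radius (hP : 2 < P) (hc : 1 < c) : ∃ r, 1 < r ∧ r < 2 ∧
    ∀ z : ℂ, ‖z - c‖ ≤ r → |z.im| < P / 2 ∧ r < ‖z + c‖ := by
  have hm : 0 < min (min (P - 2) (2 * c - 2)) 1 := lt_min (lt_min (by linarith) (by linarith)) one_pos
  set m := min (min (P - 2) (2 * c - 2)) 1
  have h1 : m ≤ P - 2 := (min_le_left _ _).trans (min_le_left _ _)
  have h2 : m ≤ 2 * c - 2 := (min_le_left _ _).trans (min_le_right _ _)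
  have h3 : m ≤ 1 := min_le_right _ _
  refine ⟨1 + m / 4, by linarith, by linarith, fun z hz => ⟨?_, ?_⟩⟩
  · linarith [norm_sub_ge_abs_im z c]
  · have h4 := (abs_le.1 ((abs_re_le_norm _).trans hz)).1
    refine lt_of_lt_of_le ?_ (re_le_norm _)
    simp only [sub_re, ofReal_re, add_re] at h4 ⊢
    linarith

/-- The divergence theorem in the cell, truncated at `|x| ≤ X`. -/
theorem boundary_flux_eq (hP : 2 < P) (hc : 1 < c) {X : ℝ} (hX : c + 2 ≤ X) {p q : ℂ → ℝ}
    (hp : ContinuousOn p (closedCell P c)) (hq : ContinuousOn q (closedCell P c))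
    (hdp : ∀ z ∈ openCell P c, DifferentiableAt ℝ p z)
    (hdq : ∀ z ∈ openCell P c, DifferentiableAt ℝ q z)
    (hdiv : ∀ z ∈ openCell P c, fderiv ℝ p z 1 + fderiv ℝ q z I = 0) :
    (∫ x in (-X)..X, q (equivRealProdCLM.symm (x, P / 2))) -
      (∫ x in (-X)..X, q (equivRealProdCLM.symm (x, -(P / 2)))) +
      (∫ y in (-(P / 2))..(P / 2), p (equivRealProdCLM.symm (X, y))) -
      (∫ y in (-(P / 2))..(P / 2), p (equivRealProdCLM.symm (-X, y))) =
      circleFlux c p q + circleFlux (-c) p q := by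
  obtain ⟨r, hr1, hr2, hr⟩ := exists_annulus_radius hP hc
  have hr' : ∀ z : ℂ, ‖z + c‖ ≤ r → |z.im| < P / 2 ∧ r < ‖z - c‖ := fun z hz => by
    have := hr (-z) (by rwa [← norm_neg, neg_sub, sub_neg_eq_add, add_comm])
    rwa [neg_im, abs_neg, neg_add_eq_sub, norm_sub_rev] at this
  have hbig : ∀ z : ℂ, ‖z - c‖ ≤ r ∨ ‖z + c‖ ≤ r → |z.re| < X := by
    rintro z (hz | hz)
    · have h4 := abs_le.1 ((abs_re_le_norm _).trans hz)
      simp only [sub_re, ofReal_re] at h4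
      exact abs_lt.2 ⟨by linarith, by linarith⟩
    · have h4 := abs_le.1 ((abs_re_le_norm _).trans hz)
      simp only [add_re, ofReal_re] at h4
      exact abs_lt.2 ⟨by linarith, by linarith⟩
  have hcR := continuousOn_radialPart (a := c) (r := r) hp hq fun ζ h1 h2 => by
    have h3 := hr (c + ζ) (by rwa [add_sub_cancel_left])
    exact ⟨h3.1.le, by rwa [add_sub_cancel_left], (hr1.trans h3.2).le⟩
  have hcL := continuousOn_radialPart (a := -c) (r := r) hp hq fun ζ h1 h2 => by
    have h3 := hr' (-c + ζ) (by rwa [neg_add_eq_sub, sub_add_cancel])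
    exact ⟨h3.1.le, (hr1.trans h3.2).le, by rwa [neg_add_eq_sub, sub_add_cancel]⟩
  -- The field is only continuous up to the circles. It is multiplied by a cutoff that vanishes near
  -- the disks and is 1 on the sides of the rectangle, and the thickness s of the cutoff is sent to
  -- 0. The annuli are disjoint, so the sum of the two cutoffs minus 1 serves instead of their
  -- product, and its differential splits into two radial terms.
  refine eq_of_forall_dist_le fun η hη => ?_
  obtain ⟨s₁, hs₁, hR⟩ := exists_integral_cutoff_near hr1 hcR (half_pos hη)
  obtain ⟨s₂, hs₂, hL⟩ := exists_integral_cutoff_near hr1 hcL (half_pos hη)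
  obtain ⟨s, hs, hsm⟩ : ∃ s, 0 < s ∧ s < min (min s₁ s₂) ((r - 1) / 2) :=
    exists_between (lt_min (lt_min hs₁ hs₂) (by linarith))
  have hsr : 1 + 2 * s < r := by linarith [hsm.trans_le (min_le_right _ _)]
  specialize hR s hs (hsm.trans_le ((min_le_left _ _).trans (min_le_left _ _)))
  specialize hL s hs (hsm.trans_le ((min_le_left _ _).trans (min_le_right _ _)))
  rw [integral_radialPart] at hR hL
  set w := deriv (cutoff s) with hw
  have hwc : Continuous w := continuous_deriv_cutoff s
  have hw1 : ∀ ρ < 1, w ρ = 0 := fun ρ hρ => deriv_cutoff_eq_zero_of_lt hs (by linarith)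
  have hw2 : ∀ ρ > r, w ρ = 0 := fun ρ hρ => deriv_cutoff_eq_zero_of_gt hs (by linarith)
  -- the cutoff in the plane and the divergence of the truncated field
  set ψ : ℂ → ℝ := fun z => cutoff s ‖z - c‖ + cutoff s ‖z - (-c : ℂ)‖ - 1 with hψ
  set ψ' : ℂ → ℂ →L[ℝ] ℝ := fun z => reMul ((w ‖z - c‖ * ‖z - c‖ : ℝ) / (z - c)) +
    reMul ((w ‖z - (-c : ℂ)‖ * ‖z - (-c : ℂ)‖ : ℝ) / (z - (-c : ℂ))) with hψ'
  have hdψ : ∀ z, HasFDerivAt ψ (ψ' z) z := fun z =>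
    ((hasFDerivAt_cutoff_norm hs c z).add (hasFDerivAt_cutoff_norm hs (-c) z)).sub_const 1
  set T : ℂ → ℂ → ℝ := fun a z => w ‖z - a‖ * radialPart a p q (z - a) with hT
  have hT_eq : ∀ z, ψ' z 1 * p z + ψ' z I * q z = T c z + T (-c) z := fun z => by
    have e : ∀ a v : ℂ, (((w ‖z - a‖ * ‖z - a‖ : ℝ) : ℂ) / (z - a) * v).re =
        w ‖z - a‖ * (((‖z - a‖ : ℝ) : ℂ) / (z - a) * v).re := fun a v => by
      rw [ofReal_mul, mul_div_assoc, mul_assoc, re_ofReal_mul]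
    simp only [hψ', hT, radialPart, add_apply, reMul_apply, e, add_sub_cancel]
    simp only [mul_one]
    ring
  have hTi : ∀ a, ContinuousOn (radialPart a p q) {z | 1 ≤ ‖z‖ ∧ ‖z‖ ≤ r} → Integrable (T a) :=
    fun a ha => (integrable_radial_mul hwc hw1 hw2 ha).comp_sub_right a
  have hTint : ∀ a, ∫ z, T a z = ∫ z, w ‖z‖ * radialPart a p q z := fun a =>
    integral_sub_right_eq_self (fun z => w ‖z‖ * radialPart a p q z) a
  have hi := (hTi _ hcR).add (hTi _ hcL)
  have hzero : ∀ z : ℂ, (‖z - c‖ ≤ 1 ∨ ‖z + c‖ ≤ 1) → ψ =ᶠ[𝓝 z] fun _ => 0 := by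
    rintro z (hz | hz)
    · have hn : ∀ᶠ x : ℂ in 𝓝 z, ‖x - c‖ < 1 + s :=
        (continuous_id.sub continuous_const).norm.continuousAt.eventually_lt continuousAt_const
          (show ‖z - c‖ < 1 + s by linarith)
      filter_upwards [hn] with x hx
      have h2 := (hr x (by linarith)).2
      simp only [hψ, sub_neg_eq_add]
      rw [cutoff_eq_zero hs hx.le, cutoff_eq_one hs (by linarith)]
      norm_num
    · have hn : ∀ᶠ x : ℂ in 𝓝 z, ‖x + c‖ < 1 + s :=
        (continuous_id.add continuous_const).norm.continuousAt.eventually_lt continuousAt_const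
          (show ‖z + c‖ < 1 + s by linarith)
      filter_upwards [hn] with x hx
      have h2 := (hr' x (by linarith)).2
      simp only [hψ, sub_neg_eq_add]
      rw [cutoff_eq_zero hs hx.le, cutoff_eq_one hs (by linarith)]
      norm_num
  have hone : ∀ z : ℂ, r < ‖z - c‖ → r < ‖z + c‖ → ψ z = 1 := fun z h1 h2 => by
    simp only [hψ, sub_neg_eq_add]
    rw [cutoff_eq_one hs (by linarith), cutoff_eq_one hs (by linarith)]
    norm_num
  -- Outside the open cell the field may have no derivative. The value 0 is harmless there: within
  -- the open strip this means the closed disks, near which the cutoff vanishes identically.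
  set D : (ℂ → ℝ) → ℂ → ℂ →L[ℝ] ℝ := fun f => (openCell P c).indicator (fderiv ℝ f) with hD
  have hdF : ∀ f : ℂ → ℝ, (∀ z ∈ openCell P c, DifferentiableAt ℝ f z) → ∀ z : ℂ, |z.im| < P / 2 →
      HasFDerivAt (fun z => ψ z * f z) (ψ z • D f z + f z • ψ' z) z := by
    intro f hf z hz
    by_cases hm : z ∈ openCell P c
    · simp only [hD, indicator_of_mem hm]
      exact (hdψ z).mul (hf z hm).hasFDerivAt
    · have h0 : ψ =ᶠ[𝓝 z] fun _ => 0 := by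
        refine hzero z ?_
        by_contra hcon
        push Not at hcon
        exact hm ⟨hz, hcon⟩
      have h1 : ψ' z = 0 := (hdψ z).unique ((hasFDerivAt_const (0 : ℝ) z).congr_of_eventuallyEq h0)
      simp only [hD, indicator_of_notMem hm, h1, smul_zero, add_zero]
      refine (hasFDerivAt_const (0 : ℝ) z).congr_of_eventuallyEq ?_
      filter_upwards [h0] with x hx
      rw [hx, zero_mul]
  have hcF : ∀ f : ℂ → ℝ, ContinuousOn f (closedCell P c) →
      ContinuousOn (fun z => ψ z * f z) {z : ℂ | |z.im| ≤ P / 2} := by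
    intro f hf z hz
    by_cases hm : 1 < ‖z - c‖ ∧ 1 < ‖z + c‖
    · refine (hdψ z).continuousAt.continuousWithinAt.mul ?_
      refine (hf z ⟨hz, hm.1.le, hm.2.le⟩).mono_of_mem_nhdsWithin ?_
      have h1 : ∀ᶠ x : ℂ in 𝓝 z, 1 < ‖x - c‖ := continuousAt_const.eventually_lt
        (continuous_id.sub continuous_const).norm.continuousAt hm.1
      have h2 : ∀ᶠ x : ℂ in 𝓝 z, 1 < ‖x + c‖ := continuousAt_const.eventually_lt
        (continuous_id.add continuous_const).norm.continuousAt hm.2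
      filter_upwards [self_mem_nhdsWithin, nhdsWithin_le_nhds h1, nhdsWithin_le_nhds h2]
        with x a1 a2 a3 using ⟨a1, a2.le, a3.le⟩
    · have h0 : ψ =ᶠ[𝓝 z] fun _ => 0 := by
        refine hzero z ?_
        by_contra hcon
        push Not at hcon
        exact hm hcon
      have h1 : (fun z => ψ z * f z) =ᶠ[𝓝 z] fun _ => 0 := by
        filter_upwards [h0] with x hx
        rw [hx, zero_mul]
      exact (continuousAt_const.congr h1.symm).continuousWithinAt
  have hX0 : 0 < X := by linarith
  have hdivF : ∀ z, (ψ z • D p z + p z • ψ' z) 1 + (ψ z • D q z + q z • ψ' z) I =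
      T c z + T (-c) z := by
    intro z
    have h0 : D p z 1 + D q z I = 0 := by
      by_cases hm : z ∈ openCell P c
      · simp only [hD, indicator_of_mem hm]
        exact hdiv z hm
      · simp only [hD, indicator_of_notMem hm]
        simp
    rw [← hT_eq]
    simp only [add_apply, smul_apply, smul_eq_mul]
    linear_combination ψ z * h0
  set e := equivRealProdCLM.symm with he
  have hre : ∀ x : ℝ × ℝ, (e x).re = x.1 := fun x => rfl
  have him : ∀ x : ℝ × ℝ, (e x).im = x.2 := fun x => rfl
  have he1 : e (1, 0) = 1 := Complex.ext rfl rfl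
  have heI : e (0, 1) = I := Complex.ext rfl rfl
  have hrect : ∀ f : ℂ → ℝ, ContinuousOn f (closedCell P c) →
      ContinuousOn (fun x : ℝ × ℝ => ψ (e x) * f (e x)) ([[-X, X]] ×ˢ [[-(P / 2), P / 2]]) := by
    intro f hf
    refine (hcF f hf).comp e.continuous.continuousOn fun x hx => ?_
    rw [uIcc_of_le (by linarith : -(P / 2) ≤ P / 2)] at hx
    exact abs_le.2 hx.2
  have hdrect : ∀ f : ℂ → ℝ, (∀ z ∈ openCell P c, DifferentiableAt ℝ f z) →
      ∀ x ∈ Ioo (min (-X) X) (max (-X) X) ×ˢ Ioo (min (-(P / 2)) (P / 2)) (max (-(P / 2)) (P / 2)),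
      HasFDerivAt (fun x : ℝ × ℝ => ψ (e x) * f (e x))
        ((ψ (e x) • D f (e x) + f (e x) • ψ' (e x)).comp (e : ℝ × ℝ →L[ℝ] ℂ)) x := by
    intro f hf x hx
    rw [min_eq_left (by linarith : -(P / 2) ≤ P / 2),
      max_eq_right (by linarith : -(P / 2) ≤ P / 2)] at hx
    exact (hdF f hf (e x) (abs_lt.2 hx.2)).comp x e.hasFDerivAt
  have key := integral2_divergence_prod_of_hasFDerivAt
    (fun x => ψ (e x) * p (e x)) (fun x => ψ (e x) * q (e x)) _ _ (-X) (-(P / 2)) X (P / 2)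
    (hrect p hp) (hrect q hq) (hdrect p hdp) (hdrect q hdq) (by
      simp only [ContinuousLinearMap.comp_apply, ContinuousLinearEquiv.coe_coe, he1, heI, hdivF]
      exact ((volume_preserving_equiv_real_prod.symm.integrable_comp_emb
        measurableEquivRealProd.symm.measurableEmbedding).2 hi).integrableOn)
  simp only [ContinuousLinearMap.comp_apply, ContinuousLinearEquiv.coe_coe, he1, heI, hdivF] at key
  -- The divergence of the truncated field lives in the two annuli, so its integral over the
  -- rectangle is the integral over the plane.
  have hsupp : ∀ z : ℂ, (T c + T (-c)) z ≠ 0 → |z.re| < X ∧ |z.im| < P / 2 := by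
    intro z hz
    by_cases h1 : ‖z - c‖ ≤ r
    · exact ⟨hbig z (Or.inl h1), (hr z h1).1⟩
    by_cases h2 : ‖z + c‖ ≤ r
    · exact ⟨hbig z (Or.inr h2), (hr' z h2).1⟩
    exfalso
    apply hz
    simp only [hT, Pi.add_apply, sub_neg_eq_add]
    rw [hw2 _ (not_le.1 h1), hw2 _ (not_le.1 h2)]
    ring
  have hlhs := integral_integral_eq_integral hi hX0.le (by linarith : 0 ≤ P / 2) hsupp
  simp only [Pi.add_apply] at hlhs
  rw [← he, key, integral_add (hTi _ hcR) (hTi _ hcL), hTint, hTint] at hlhs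
  have hψtop : ∀ x y : ℝ, |y| = P / 2 ∨ |x| = X → ψ (e (x, y)) = 1 := by
    intro x y hxy
    refine hone _ ?_ ?_
    · by_contra hcon
      rcases hxy with h | h
      · exact (hr _ (not_lt.1 hcon)).1.ne h
      · exact (hbig _ (Or.inl (not_lt.1 hcon))).ne h
    · by_contra hcon
      rcases hxy with h | h
      · exact (hr' _ (not_lt.1 hcon)).1.ne h
      · exact (hbig _ (Or.inr (not_lt.1 hcon))).ne h
  have a1 : |P / 2| = P / 2 := abs_of_pos (by linarith)
  have a2 : |-(P / 2)| = P / 2 := by rw [abs_neg, a1]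
  have a3 : |X| = X := abs_of_pos hX0
  have a4 : |-X| = X := by rw [abs_neg, a3]
  simp only [hψtop _ _ (Or.inl a1), hψtop _ _ (Or.inl a2), hψtop _ _ (Or.inr a3),
    hψtop _ _ (Or.inr a4), one_mul] at hlhs
  rw [hlhs, Real.dist_eq]
  rw [abs_le] at hR hL ⊢
  constructor <;> linarith [hR.1, hR.2, hL.1, hL.2]

end

/-! ### Consequences of finite energy far out in the strip. -/

section

variable {P c : ℝ}

/-- Pointwise |h| ≤ t + h²/t. The parameter t plays the part of Cauchy–Schwarz: it is chosen first,
the energy is then made small relative to it. -/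
theorem integral_abs_le_of_energy {h : ℝ → ℝ} {a b t E : ℝ} (hab : a ≤ b)
    (hh : ContinuousOn h (Icc a b)) (ht : 0 < t) (hE0 : 0 ≤ E)
    (hE : ∫⁻ x in Ioc a b, ENNReal.ofReal (h x ^ 2) ≤ ENNReal.ofReal E) :
    ∫ x in a..b, |h x| ≤ t * (b - a) + E / t := by
  have hu : ContinuousOn h [[a, b]] := by rwa [uIcc_of_le hab]
  have hsq : ∫ x in a..b, h x ^ 2 ≤ E := by
    rw [intervalIntegral.integral_of_le hab, ← ENNReal.ofReal_le_ofReal_iff hE0,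
      ofReal_integral_eq_lintegral_ofReal _ (Eventually.of_forall fun x => sq_nonneg _)]
    · exact hE
    · exact (intervalIntegrable_iff_integrableOn_Ioc_of_le hab).1 (hu.pow 2).intervalIntegrable
  have hi : IntervalIntegrable (fun x => t + h x ^ 2 / t) volume a b :=
    (continuousOn_const.add ((hu.pow 2).div_const t)).intervalIntegrable
  have h1 : ∫ x in a..b, |h x| ≤ ∫ x in a..b, (t + h x ^ 2 / t) := by
    refine intervalIntegral.integral_mono_on hab hu.abs.intervalIntegrable hi fun x _ => ?_
    have h2 : |h x| * t ≤ t ^ 2 + h x ^ 2 := by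
      nlinarith [sq_nonneg (|h x| - t), sq_abs (h x), sq_nonneg (|h x|), sq_nonneg t]
    rw [← sub_nonneg]
    have : t + h x ^ 2 / t - |h x| = (t ^ 2 + h x ^ 2 - |h x| * t) / t := by
      field_simp
    rw [this]
    exact div_nonneg (by linarith) ht.le
  refine h1.trans ?_
  have hi2 : IntervalIntegrable (fun x => h x ^ 2 / t) volume a b :=
    ((hu.pow 2).div_const t).intervalIntegrable
  rw [intervalIntegral.integral_add intervalIntegrable_const hi2, intervalIntegral.integral_const,
    intervalIntegral.integral_div, smul_eq_mul, mul_comm]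
  gcongr

theorem abs_sub_le_of_energy {f h : ℝ → ℝ} {a b t E : ℝ} (hab : a ≤ b)
    (hf : ∀ x ∈ Icc a b, HasDerivAt f (h x) x)
    (hh : ContinuousOn h (Icc a b)) (ht : 0 < t) (hE0 : 0 ≤ E)
    (hE : ∫⁻ x in Ioc a b, ENNReal.ofReal (h x ^ 2) ≤ ENNReal.ofReal E) :
    |f b - f a| ≤ t * (b - a) + E / t := by
  have hu : ContinuousOn h [[a, b]] := by rwa [uIcc_of_le hab]
  rw [← intervalIntegral.integral_eq_sub_of_hasDerivAt (fun x hx => hf x (by rwa [uIcc_of_le hab] at hx))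
    hu.intervalIntegrable]
  exact (intervalIntegral.abs_integral_le_integral_abs hab).trans
    (integral_abs_le_of_energy hab hh ht hE0 hE)

/-- A function of finite integral is small at arbitrarily large `±X`. -/
theorem exists_le_of_lintegral_lt_top {E : ℝ → ENNReal} (hE : Measurable E) {a : ℝ}
    (hi : ∫⁻ x in {x | a < |x|}, E x < ⊤) {η : ENNReal} (hη : 0 < η) (X₀ : ℝ) :
    ∃ X ≥ X₀, E X ≤ η ∧ E (-X) ≤ η := by
  by_contra! hcon
  set M := max (max X₀ a) 0
  have h1 : ∫⁻ x in Ioi M, E x ≤ ∫⁻ x in {x | a < |x|}, E x :=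
    lintegral_mono_set fun x (hx : M < x) =>
      show a < |x| from ((le_max_right _ _).trans (le_max_left _ _)).trans_lt
        (hx.trans_le (le_abs_self x))
  have h2 : ∫⁻ x in Ioi M, E (-x) ≤ ∫⁻ x in {x | a < |x|}, E x := by
    have e : ∫⁻ x in Ioi M, E (-x) = ∫⁻ x in Iio (-M), E x := by
      have := (Measure.measurePreserving_neg (volume : Measure ℝ)).setLIntegral_comp_preimage
        (measurableSet_Iio (a := -M)) hE
      rw [← this]
      congr 2
      ext x
      simp
    rw [e]
    exact lintegral_mono_set fun x (hx : x < -M) =>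
      show a < |x| from ((le_max_right _ _).trans (le_max_left _ _)).trans_lt
        ((lt_neg.1 hx).trans_le (neg_le_abs x))
  have h3 : ∫⁻ x in Ioi M, (E x + E (-x)) < ⊤ := by
    rw [lintegral_add_left hE]
    exact ENNReal.add_lt_top.2 ⟨h1.trans_lt hi, h2.trans_lt hi⟩
  -- By the contrary assumption, for each x > M at least one of E(x), E(-x) exceeds η, so the
  -- integral over a half-line would be infinite.
  have h4 : ∫⁻ _ in Ioi M, η ≤ ∫⁻ x in Ioi M, (E x + E (-x)) := by
    refine setLIntegral_mono' measurableSet_Ioi fun x hx => ?_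
    by_cases hx1 : E x ≤ η
    · exact (hcon x (((le_max_left _ _).trans (le_max_left _ _)).trans (le_of_lt hx)) hx1).le.trans
        le_add_self
    · exact (not_le.1 hx1).le.trans le_self_add
  rw [setLIntegral_const, Real.volume_Ioi, ENNReal.mul_top hη.ne'] at h4
  exact absurd h3 (not_lt.2 h4)

/-- On the far lines the coordinates run inside the open cell. -/
theorem far_mem_openCell (hc : 1 < c) {x y : ℝ} (hx : c + 1 < |x|) (hy : |y| < P / 2) :
    equivRealProdCLM.symm (x, y) ∈ openCell P c := by
  have hre : (equivRealProdCLM.symm (x, y)).re = x := rfl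
  refine ⟨hy, lt_of_lt_of_le ?_ (abs_re_le_norm _), lt_of_lt_of_le ?_ (abs_re_le_norm _)⟩
  · have := abs_sub_abs_le_abs_sub x c
    rw [sub_re, hre, ofReal_re]
    rw [abs_of_pos (by linarith : 0 < c)] at this
    linarith
  · have := abs_sub_abs_le_abs_add x c
    rw [add_re, hre, ofReal_re]
    rw [abs_of_pos (by linarith : 0 < c)] at this
    linarith

theorem lintegral_far_lt_top (hc : 1 < c) {F : ℂ → ENNReal} (hF : Measurable F)
    (hE : ∫⁻ z in openCell P c, F z < ⊤) :
    ∫⁻ q in {x | c + 1 < |x|} ×ˢ Ioo (-(P / 2)) (P / 2), F (equivRealProdCLM.symm q) < ⊤ := by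
  refine lt_of_le_of_lt ?_ hE
  have := volume_preserving_equiv_real_prod.symm.setLIntegral_comp_preimage
    (isOpen_openCell P c).measurableSet hF
  rw [← this]
  exact lintegral_mono_set fun q hq => far_mem_openCell hc hq.1 (abs_lt.2 hq.2)

section Lines

variable {v : ℂ → ℝ}

theorem continuousAt_fderiv_of_harmonicAt {z : ℂ} (h : HarmonicAt v z) :
    ContinuousAt (fderiv ℝ v) z :=
  (h.1.fderiv_right (m := 1) (by norm_num)).continuousAt

theorem differentiableAt_of_harmonicAt {z : ℂ} (h : HarmonicAt v z) : DifferentiableAt ℝ v z :=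
  h.1.differentiableAt two_ne_zero

theorem hasDerivAt_horizontal (x y : ℝ) :
    HasDerivAt (fun x : ℝ => equivRealProdCLM.symm (x, y)) 1 x :=
  (equivRealProdCLM.symm : ℝ × ℝ →L[ℝ] ℂ).hasFDerivAt.comp_hasDerivAt x
    ((hasDerivAt_id x).prodMk (hasDerivAt_const x y))

theorem hasDerivAt_vertical (x y : ℝ) :
    HasDerivAt (fun y : ℝ => equivRealProdCLM.symm (x, y)) I y :=
  (equivRealProdCLM.symm : ℝ × ℝ →L[ℝ] ℂ).hasFDerivAt.comp_hasDerivAt y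
    ((hasDerivAt_const y x).prodMk (hasDerivAt_id y))

theorem sq_fderiv_apply_le (v : ℂ → ℝ) (z : ℂ) {w : ℂ} (hw : ‖w‖ = 1) :
    fderiv ℝ v z w ^ 2 ≤ ‖fderiv ℝ v z‖ ^ 2 := by
  rw [← sq_abs]
  gcongr
  simpa [hw] using (fderiv ℝ v z).le_opNorm w

/-- Along a curve `γ` with unit tangent `w`, the increment of `v` is controlled by the energy. -/
theorem abs_sub_le_of_lineEnergy {γ : ℝ → ℂ} {w : ℂ} (hw : ‖w‖ = 1)
    (hγ : ∀ x, HasDerivAt γ w x) {a b E : ℝ} (hab : a ≤ b)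
    (hv : ∀ x ∈ Icc a b, HarmonicAt v (γ x)) (hE0 : 0 ≤ E)
    (hE : ∫⁻ x in Ioc a b, ENNReal.ofReal (‖fderiv ℝ v (γ x)‖ ^ 2) ≤ ENNReal.ofReal E) :
    |v (γ b) - v (γ a)| ≤ (b - a) + E := by
  have := abs_sub_le_of_energy (f := fun x => v (γ x)) (h := fun x => fderiv ℝ v (γ x) w) (t := 1)
    hab (fun x hx => (differentiableAt_of_harmonicAt (hv x hx)).hasFDerivAt.comp_hasDerivAt x (hγ x))
    (fun x hx => (((continuousAt_fderiv_of_harmonicAt (hv x hx)).comp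
      (hγ x).continuousAt).clm_apply continuousAt_const).continuousWithinAt) one_pos hE0
    ((lintegral_mono fun x => ENNReal.ofReal_le_ofReal (sq_fderiv_apply_le v (γ x) hw)).trans hE)
  simpa using this

/-- Vertical lines arbitrarily far away on which `v` grows at most linearly and its normal
derivative is small in the mean. -/
theorem exists_far_lines (hP : 0 < P) (hc : 1 < c)
    (hv : ∀ z : ℂ, c + 1 < |z.re| → |z.im| ≤ P / 2 → HarmonicAt v z)
    (hE : ∫⁻ z in openCell P c, ENNReal.ofReal (‖fderiv ℝ v z‖ ^ 2) < ⊤) :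
    ∃ A, ∀ t > 0, ∀ X₀, ∃ X ≥ X₀, c + 2 ≤ X ∧ ∀ x, |x| = X →
      (∀ y, |y| ≤ P / 2 → |v (equivRealProdCLM.symm (x, y))| ≤ A + X) ∧
      ∫ y in (-(P / 2))..(P / 2), |fderiv ℝ v (equivRealProdCLM.symm (x, y)) 1| ≤ t := by
  set e := equivRealProdCLM.symm with he
  set F : ℂ → ENNReal := fun z => ENNReal.ofReal (‖fderiv ℝ v z‖ ^ 2) with hF
  have hFm : Measurable F := ((measurable_fderiv ℝ v).norm.pow_const 2).ennreal_ofReal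
  have hFe : Measurable fun q : ℝ × ℝ => F (e q) := hFm.comp e.continuous.measurable
  have hfar := lintegral_far_lt_top hc hFm hE
  rw [Measure.volume_eq_prod, ← Measure.prod_restrict] at hfar
  -- a horizontal line of finite energy
  obtain ⟨y₀, hy₀, hEy⟩ : ∃ y₀ ∈ Ioo (-(P / 2)) (P / 2), ∫⁻ x in {x | c + 1 < |x|}, F (e (x, y₀)) < ⊤ := by
    have h1 := hfar
    rw [lintegral_prod_symm' _ hFe] at h1
    have h2 := ae_lt_top hFe.lintegral_prod_left' h1.ne
    have h3 : ∀ᵐ y ∂(volume.restrict (Ioo (-(P / 2)) (P / 2))), y ∈ Ioo (-(P / 2)) (P / 2) :=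
      ae_restrict_mem measurableSet_Ioo
    have : NeBot (ae (volume.restrict (Ioo (-(P / 2)) (P / 2)))) := by
      rw [ae_restrict_neBot, Real.volume_Ioo]
      simpa using hP
    obtain ⟨y, hy⟩ := (h2.and h3).exists
    exact ⟨y, hy.2, hy.1⟩
  set Ey := (∫⁻ x in {x | c + 1 < |x|}, F (e (x, y₀))).toReal with hEy'
  have hEyof : ENNReal.ofReal Ey = ∫⁻ x in {x | c + 1 < |x|}, F (e (x, y₀)) :=
    ENNReal.ofReal_toReal hEy.ne
  have hEy0 : 0 ≤ Ey := ENNReal.toReal_nonneg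
  have hy₀' : |y₀| ≤ P / 2 := (abs_lt.2 hy₀).le
  rw [lintegral_prod _ hFe.aemeasurable] at hfar
  -- Base values at (±(c + 2), y₀), the energy of the horizontal line, and P + 1 for the increment
  -- along a vertical line of energy at most 1.
  set A := |v (e (c + 2, y₀))| + |v (e (-(c + 2), y₀))| + Ey + (P + 1) with hA
  refine ⟨A, fun t ht X₀ => ?_⟩
  -- Then t' P = t/2, and an energy at most t' t/2 contributes at most another t/2. The minimum with
  -- 1 serves the vertical increments.
  set t' := t / (2 * P) with ht'
  have ht'0 : 0 < t' := by positivity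
  set η := min 1 (t' * (t / 2)) with hη
  have hη0 : 0 < η := lt_min one_pos (by positivity)
  obtain ⟨X, hX, hX1, hX2⟩ := exists_le_of_lintegral_lt_top hFe.lintegral_prod_right' hfar
    (ENNReal.ofReal_pos.2 hη0) (max X₀ (c + 2))
  have hXc : c + 2 ≤ X := (le_max_right _ _).trans hX
  refine ⟨X, (le_max_left _ _).trans hX, hXc, fun x hx => ?_⟩
  have hline : ∫⁻ y in Ioc (-(P / 2)) (P / 2), F (e (x, y)) ≤ ENNReal.ofReal η := by
    rw [← Measure.restrict_congr_set Ioo_ae_eq_Ioc]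
    rcases (abs_eq (by linarith)).1 hx with rfl | rfl
    · exact hX1
    · exact hX2
  have hxfar : c + 1 < |x| := by linarith
  have hharm : ∀ y, |y| ≤ P / 2 → HarmonicAt v (e (x, y)) := fun y hy => hv _ hxfar hy
  -- along the horizontal line
  have hhor : |v (e (x, y₀))| ≤ |v (e (c + 2, y₀))| + |v (e (-(c + 2), y₀))| + X + Ey := by
    have n1 := abs_nonneg (v (e (c + 2, y₀)))
    have n2 := abs_nonneg (v (e (-(c + 2), y₀)))
    rcases (abs_eq (by linarith)).1 hx with rfl | rfl
    · have := abs_sub_le_of_lineEnergy (v := v) (γ := fun x => e (x, y₀)) norm_one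
        (fun x => hasDerivAt_horizontal x y₀) hXc (fun x hx => hv _
          (show c + 1 < |x| from lt_of_lt_of_le (by linarith [hx.1]) (le_abs_self x)) hy₀') hEy0
        (hEyof ▸ lintegral_mono_set fun x hx =>
          show c + 1 < |x| from lt_of_lt_of_le (by linarith [hx.1]) (le_abs_self x))
      have h2 := abs_sub_abs_le_abs_sub (v (e (x, y₀))) (v (e (c + 2, y₀)))
      linarith
    · have := abs_sub_le_of_lineEnergy (v := v) (γ := fun x => e (x, y₀)) norm_one
        (fun x => hasDerivAt_horizontal x y₀) (neg_le_neg hXc) (fun x hx => hv _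
          (show c + 1 < |x| from lt_of_lt_of_le (by linarith [hx.2]) (neg_le_abs x)) hy₀') hEy0
        (hEyof ▸ lintegral_mono_set fun x hx =>
          show c + 1 < |x| from lt_of_lt_of_le (by linarith [hx.2]) (neg_le_abs x))
      have h2 := abs_sub_abs_le_abs_sub (v (e (-X, y₀))) (v (e (-(c + 2), y₀)))
      rw [abs_sub_comm] at h2
      linarith
  have hvert : ∀ y₁ y₂, -(P / 2) ≤ y₁ → y₁ ≤ y₂ → y₂ ≤ P / 2 →
      |v (e (x, y₂)) - v (e (x, y₁))| ≤ P + 1 := by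
    intro y₁ y₂ h1 h12 h2
    have := abs_sub_le_of_lineEnergy (v := v) (γ := fun y => e (x, y)) norm_I
      (fun y => hasDerivAt_vertical x y) h12 (fun y hy => hharm y
        (abs_le.2 ⟨h1.trans hy.1, hy.2.trans h2⟩)) hη0.le (by
        refine le_trans ?_ hline
        exact lintegral_mono_set (Ioc_subset_Ioc h1 h2))
    linarith [min_le_left 1 (t' * (t / 2))]
  refine ⟨fun y hy => ?_, ?_⟩
  · rw [abs_le] at hy hy₀'
    have h1 : |v (e (x, y)) - v (e (x, y₀))| ≤ P + 1 := by
      rcases le_total y₀ y with h | h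
      · exact hvert y₀ y hy₀'.1 h hy.2
      · rw [abs_sub_comm]
        exact hvert y y₀ hy.1 h hy₀'.2
    have h2 := abs_sub_abs_le_abs_sub (v (e (x, y))) (v (e (x, y₀)))
    linarith
  · have h1 := integral_abs_le_of_energy (h := fun y => fderiv ℝ v (e (x, y)) 1) (t := t') (E := η)
      (by linarith : -(P / 2) ≤ P / 2) (fun y hy => ((ContinuousAt.comp (f := fun y : ℝ => e (x, y))
        (continuousAt_fderiv_of_harmonicAt (hharm y (abs_le.2 hy)))
          (hasDerivAt_vertical x y).continuousAt).clm_apply continuousAt_const).continuousWithinAt) ht'0 hη0.le (by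
        refine le_trans ?_ hline
        exact lintegral_mono fun y => ENNReal.ofReal_le_ofReal (sq_fderiv_apply_le v _ norm_one))
    refine h1.trans ?_
    have h2 : η / t' ≤ t / 2 := by
      rw [div_le_iff₀ ht'0, mul_comm]
      exact min_le_right _ _
    have h3 : t' * (P / 2 - -(P / 2)) = t / 2 := by
      rw [ht']
      field_simp
      ring
    linarith

end Lines

end

/-! ### Green's identity in the period cell. -/

section

variable {P c : ℝ} {ε δ : ℝ}

/-- The disks with n ≠ 0 lie in |Im z| ≥ (2 + δ) - 1 = 1 + δ. The conditions define an open set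
disjoint from all disks, hence disjoint from the closure of their union. -/
theorem mem_exterior (hδ : 0 < δ) {z : ℂ} (h1 : |z.im| < 1 + δ)
    (h2 : 1 < ‖z - ((1 + ε / 2 : ℝ) : ℂ)‖) (h3 : 1 < ‖z + ((1 + ε / 2 : ℝ) : ℂ)‖) :
    z ∈ exterior ε δ := by
  set W : Set ℂ := {z | |z.im| < 1 + δ ∧ 1 < ‖z - ((1 + ε / 2 : ℝ) : ℂ)‖ ∧
    1 < ‖z + ((1 + ε / 2 : ℝ) : ℂ)‖} with hW
  have hWo : IsOpen W := (isOpen_lt (continuous_im.abs) continuous_const).inter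
    ((isOpen_lt continuous_const (continuous_id.sub continuous_const).norm).inter
      (isOpen_lt continuous_const (continuous_id.add continuous_const).norm))
  have him : ∀ (w a : ℂ) (n : ℤ), w ∈ W → n ≠ 0 → a.im = n * (2 + δ) → ¬ ‖w - a‖ < 1 := by
    intro w a n hw hn ha hlt
    have e1 := (abs_im_le_norm _).trans_lt hlt
    rw [sub_im, ha] at e1
    have e2 : (1 : ℝ) ≤ |(n : ℝ)| := by exact_mod_cast Int.one_le_abs hn
    have e3 : |(n : ℝ) * (2 + δ)| = |(n : ℝ)| * (2 + δ) := by
      rw [abs_mul, abs_of_pos (by linarith : 0 < 2 + δ)]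
    have e4 := abs_sub_abs_le_abs_sub ((n : ℝ) * (2 + δ)) w.im
    rw [abs_sub_comm, e3] at e4
    have := hw.1
    nlinarith
  have hdisj : Disjoint W (⋃ n : ℤ, diskL ε δ n ∪ diskR ε δ n) := by
    rw [Set.disjoint_left]
    intro w hw hmem
    obtain ⟨n, hn⟩ := mem_iUnion.1 hmem
    by_cases hn0 : n = 0
    · subst hn0
      rcases hn with hn | hn
      · rw [diskL, centerL_zero, mem_ball, dist_eq_norm, sub_neg_eq_add] at hn
        exact absurd hw.2.2 (not_lt.2 hn.le)
      · rw [diskR, centerR_zero, mem_ball, dist_eq_norm] at hn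
        exact absurd hw.2.1 (not_lt.2 hn.le)
    · rcases hn with hn | hn
      · rw [diskL, mem_ball, dist_eq_norm] at hn
        exact him w _ n hw hn0 rfl hn
      · rw [diskR, mem_ball, dist_eq_norm] at hn
        exact him w _ n hw hn0 rfl hn
  exact Set.disjoint_left.1 (hdisj.closure_right hWo) ⟨h1, h2, h3⟩

theorem fderiv_eq_of_gradient_eq {f : ℂ → ℝ} {z w : ℂ} (h : ∇ f z = ∇ f w) :
    fderiv ℝ f z = fderiv ℝ f w :=
  (toDual ℝ ℂ).symm.injective h

/-- The component in the direction `w` of `v ∇φ - φ ∇v`, with gradients taken from within `S`. -/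
def greenField (S : Set ℂ) (v φ : ℂ → ℝ) (w z : ℂ) : ℝ :=
  v z * fderivWithin ℝ φ S z w - φ z * fderivWithin ℝ v S z w

theorem continuousOn_greenField {S : Set ℂ} (hS : UniqueDiffOn ℝ S) {v φ : ℂ → ℝ}
    (hv : ContDiffOn ℝ 1 v S) (hφ : ContDiffOn ℝ 1 φ S) (w : ℂ) :
    ContinuousOn (greenField S v φ w) S :=
  (hv.continuousOn.mul ((hφ.continuousOn_fderivWithin hS le_rfl).clm_apply continuousOn_const)).sub
    (hφ.continuousOn.mul ((hv.continuousOn_fderivWithin hS le_rfl).clm_apply continuousOn_const))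

/-- Second derivatives of a harmonic function. -/
theorem exists_hasFDerivAt_partials {f : ℂ → ℝ} {z : ℂ} (hf : HarmonicAt f z) :
    ∃ G, HasFDerivAt (fun z => fderiv ℝ f z 1) (reMul G) z ∧
      HasFDerivAt (fun z => fderiv ℝ f z I) (reMul (I * G)) z := by
  have h1 := (HarmonicAt.differentiableAt_complex_partial hf).hasDerivAt
  refine ⟨deriv (fun z => (fderiv ℝ f z 1 : ℂ) - I * fderiv ℝ f z I) z, ?_, ?_⟩
  · have := hasFDerivAt_re_of_hasDerivAt h1
    simpa using this
  · have := hasFDerivAt_re_of_hasDerivAt (h1.const_mul I)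
    simpa using this

theorem hasFDerivAt_mul_partial_sub {v φ : ℂ → ℝ} {z w a b : ℂ} (hv : DifferentiableAt ℝ v z)
    (hφ : DifferentiableAt ℝ φ z) (hvw : HasFDerivAt (fun z => fderiv ℝ v z w) (reMul a) z)
    (hφw : HasFDerivAt (fun z => fderiv ℝ φ z w) (reMul b) z) :
    HasFDerivAt (fun z => v z * fderiv ℝ φ z w - φ z * fderiv ℝ v z w)
      ((v z • reMul b + fderiv ℝ φ z w • fderiv ℝ v z) -
        (φ z • reMul a + fderiv ℝ v z w • fderiv ℝ φ z)) z :=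
  (hv.hasFDerivAt.mul hφw).sub (hφ.hasFDerivAt.mul hvw)

theorem greenField_eventuallyEq {S : Set ℂ} {v φ : ℂ → ℝ} {z : ℂ} (hS : S ∈ 𝓝 z) (w : ℂ) :
    greenField S v φ w =ᶠ[𝓝 z] fun z => v z * fderiv ℝ φ z w - φ z * fderiv ℝ v z w := by
  filter_upwards [eventually_mem_nhds_iff.2 hS] with x hx
  rw [greenField, fderivWithin_of_mem_nhds hx, fderivWithin_of_mem_nhds hx]

/-- The field `v ∇φ - φ ∇v` of two harmonic functions is divergence free. -/
theorem differentiableAt_greenField {S : Set ℂ} {v φ : ℂ → ℝ} {z : ℂ} (hS : S ∈ 𝓝 z)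
    (hv : HarmonicAt v z) (hφ : HarmonicAt φ z) :
    DifferentiableAt ℝ (greenField S v φ 1) z ∧ DifferentiableAt ℝ (greenField S v φ I) z ∧
      fderiv ℝ (greenField S v φ 1) z 1 + fderiv ℝ (greenField S v φ I) z I = 0 := by
  obtain ⟨a, ha1, haI⟩ := exists_hasFDerivAt_partials hv
  obtain ⟨b, hb1, hbI⟩ := exists_hasFDerivAt_partials hφ
  have dv := differentiableAt_of_harmonicAt hv
  have dφ := differentiableAt_of_harmonicAt hφ
  have h1 := (hasFDerivAt_mul_partial_sub dv dφ ha1 hb1).congr_of_eventuallyEq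
    (greenField_eventuallyEq hS 1)
  have hI := (hasFDerivAt_mul_partial_sub dv dφ haI hbI).congr_of_eventuallyEq
    (greenField_eventuallyEq hS I)
  refine ⟨h1.differentiableAt, hI.differentiableAt, ?_⟩
  rw [h1.fderiv, hI.fderiv]
  simp only [sub_apply, add_apply, smul_apply, reMul_apply, smul_eq_mul, mul_one]
  have e : ∀ a : ℂ, (I * a * I).re = -a.re := fun a => by
    rw [mul_right_comm, I_mul_I, neg_one_mul, neg_re]
  rw [e, e]
  ring

theorem tendsto_linear_mul_exp_neg (A : ℝ) {κ : ℝ} (hκ : 0 < κ) :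
    Tendsto (fun X : ℝ => (A + X) * Real.exp (-(κ * X))) atTop (𝓝 0) := by
  have h0 := tendsto_rpow_mul_exp_neg_mul_atTop_nhds_zero 0 κ hκ
  have h1 := tendsto_rpow_mul_exp_neg_mul_atTop_nhds_zero 1 κ hκ
  have := (h0.const_mul A).add h1
  rw [mul_zero, zero_add] at this
  refine this.congr fun X => ?_
  rw [Real.rpow_zero, Real.rpow_one, one_mul, neg_mul]
  ring

/-- Green's identity in the cell: the fluxes through the two circles cancel. -/
theorem circleFlux_greenField_add (hε : 0 < ε) (hδ : 0 < δ) {φ v : ℂ → ℝ} {g : ℂ → ℂ} {b : ℝ}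
    (h : PeriodicPotential (2 + δ) (1 + ε / 2) φ g b) (hpot : IsPotential ε δ φ b)
    (hv : ContDiffOn ℝ 1 v (closedCell (2 + δ) (1 + ε / 2)))
    (hharm : ∀ z : ℂ, |z.im| < 1 + δ → 1 < ‖z - ((1 + ε / 2 : ℝ) : ℂ)‖ →
      1 < ‖z + ((1 + ε / 2 : ℝ) : ℂ)‖ → HarmonicAt v z)
    (hper : ∀ z : ℂ, z.im = -((2 + δ) / 2) → fderiv ℝ v z = fderiv ℝ v (z + (2 + δ : ℝ) * I))
    (hE : ∫⁻ z in openCell (2 + δ) (1 + ε / 2), ENNReal.ofReal (‖fderiv ℝ v z‖ ^ 2) < ⊤) :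
    circleFlux ((1 + ε / 2 : ℝ) : ℂ) (greenField (closedCell (2 + δ) (1 + ε / 2)) v φ 1)
        (greenField (closedCell (2 + δ) (1 + ε / 2)) v φ I) +
      circleFlux (-((1 + ε / 2 : ℝ) : ℂ)) (greenField (closedCell (2 + δ) (1 + ε / 2)) v φ 1)
        (greenField (closedCell (2 + δ) (1 + ε / 2)) v φ I) = 0 := by
  have hbd : ∀ z w, bdryDeriv ε δ φ z w =
      fderivWithin ℝ φ (closedCell (2 + δ) (1 + ε / 2)) z w := fun z w => by
    rw [bdryDeriv, closure_stripDomain hε hδ]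
  have hreg := hpot.regular
  rw [closure_stripDomain hε hδ] at hreg
  have htop := hpot.neumannTop
  have hbot := hpot.neumannBottom
  simp only [hbd] at htop hbot
  have hP : 2 < 2 + δ := by linarith
  have hc : 1 < 1 + ε / 2 := by linarith
  set P := 2 + δ with hPdef
  set c := 1 + ε / 2 with hcdef
  set S := closedCell P c with hS
  have hSu : UniqueDiffOn ℝ S := uniqueDiffOn_closedCell hP hc
  have hW := closedCell_subset_wideCell (c := c) hP
  have hnhds : ∀ z ∈ openCell P c, S ∈ 𝓝 z := fun z hz =>
    mem_of_superset ((isOpen_openCell P c).mem_nhds hz) (openCell_subset_closedCell P c)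
  have hharmO : ∀ z ∈ openCell P c, HarmonicAt v z := fun z hz =>
    hharm z (hz.1.trans (by linarith)) hz.2.1 hz.2.2
  have hgreen := fun z (hz : z ∈ openCell P c) => differentiableAt_greenField (hnhds z hz)
    (hharmO z hz) (h.harmonic z (hW (openCell_subset_closedCell P c hz)))
  have hDφ : ∀ z ∈ S, ∀ w, fderivWithin ℝ φ S z w = (g z * w).re := fun z hz w => by
    rw [(h.hasFDerivAt z (hW hz)).hasFDerivWithinAt.fderivWithin (hSu z hz), reMul_apply]
  have hDv : ∀ z ∈ S, HarmonicAt v z → fderivWithin ℝ v S z = fderiv ℝ v z := fun z hz hh =>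
    (differentiableAt_of_harmonicAt hh).fderivWithin (hSu z hz)
  set e := equivRealProdCLM.symm with he
  have hre : ∀ x y : ℝ, (e (x, y)).re = x := fun x y => rfl
  have him : ∀ x y : ℝ, (e (x, y)).im = y := fun x y => rfl
  have hline : ∀ z : ℂ, |z.im| = P / 2 → HarmonicAt v z := fun z hz =>
    hharm z (by linarith) (by linarith [norm_sub_ge_abs_im z c])
      (by linarith [norm_add_ge_abs_im z c])
  -- the horizontal sides cancel
  have hhor : ∀ x : ℝ, greenField S v φ I (e (x, P / 2)) = greenField S v φ I (e (x, -(P / 2))) := by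
    intro x
    have a1 : |(e (x, P / 2)).im| = P / 2 := abs_of_pos (by rw [him]; linarith)
    have a2 : |(e (x, -(P / 2))).im| = P / 2 := by
      rw [him, abs_neg, abs_of_pos (by linarith)]
    have sh : e (x, -(P / 2)) + (P : ℝ) * I = e (x, P / 2) := by
      apply Complex.ext
      · simp [hre]
      · simp [him]; ring
    -- The term with v itself, which need not be periodic, drops out by the Neumann condition; only
    -- φ ∂v remains, and there both factors are periodic.
    have t1 := htop (e (x, P / 2)) (by rw [him, hPdef]; ring)
    have t2 := hbot (e (x, -(P / 2))) (by rw [him, hPdef]; ring)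
    rw [map_neg, neg_eq_zero] at t2
    rw [greenField, greenField, t1, t2, hDv _ (line_subset_closedCell hP a1) (hline _ a1),
      hDv _ (line_subset_closedCell hP a2) (hline _ a2), hper _ (him _ _), sh, ← h.periodic (e (x, -(P / 2))), sh]
    ring
  obtain ⟨K, κ, hκ, hK, hg⟩ := h.exists_norm_grad_le hP
  obtain ⟨B, hB0, hB⟩ := h.exists_abs_le hP hc
  have hfar : ∀ z : ℂ, c + 1 < |z.re| → 1 < ‖z - c‖ ∧ 1 < ‖z + c‖ := fun z hz => by
    have habs : |c| = c := abs_of_pos (by linarith)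
    refine ⟨lt_of_lt_of_le ?_ (abs_re_le_norm _), lt_of_lt_of_le ?_ (abs_re_le_norm _)⟩
    · have := abs_sub_abs_le_abs_sub z.re c
      rw [sub_re, ofReal_re]
      linarith
    · have := abs_sub_abs_le_abs_add z.re c
      rw [add_re, ofReal_re]
      linarith
  have hfarH : ∀ z : ℂ, c + 1 < |z.re| → |z.im| ≤ P / 2 → HarmonicAt v z := fun z hz hz' =>
    hharm z (by linarith) (hfar z hz).1 (hfar z hz).2
  obtain ⟨A, hA⟩ := exists_far_lines (by linarith) hc hfarH hE
  -- the vertical sides are small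
  have hvert : ∀ X t : ℝ, c + 2 ≤ X → ∀ x, |x| = X →
      ((∀ y, |y| ≤ P / 2 → |v (e (x, y))| ≤ A + X) ∧
        ∫ y in (-(P / 2))..(P / 2), |fderiv ℝ v (e (x, y)) 1| ≤ t) →
      |∫ y in (-(P / 2))..(P / 2), greenField S v φ 1 (e (x, y))| ≤
        P * K * ((A + X) * Real.exp (-(κ * X))) + B * t := by
    rintro X t hX x hx ⟨h1, h2⟩
    have hxf : c + 1 < |x| := by linarith
    have hcont : ContinuousOn (fun y : ℝ => fderiv ℝ v (e (x, y)) 1) [[-(P / 2), P / 2]] := by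
      intro y hy
      rw [uIcc_of_le (by linarith)] at hy
      exact ((ContinuousAt.comp (f := fun y : ℝ => e (x, y))
        (continuousAt_fderiv_of_harmonicAt (hfarH _ hxf (abs_le.2 hy)))
          (hasDerivAt_vertical x y).continuousAt).clm_apply continuousAt_const).continuousWithinAt
    have hi1 : IntervalIntegrable (fun y : ℝ => B * |fderiv ℝ v (e (x, y)) 1|) volume
        (-(P / 2)) (P / 2) := (continuousOn_const.mul hcont.abs).intervalIntegrable
    have hi2 : IntervalIntegrable (fun _ : ℝ => (A + X) * (K * Real.exp (-(κ * X)))) volume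
        (-(P / 2)) (P / 2) := intervalIntegrable_const
    have hle := intervalIntegral.norm_integral_le_of_norm_le (a := -(P / 2)) (b := P / 2)
      (f := fun y => greenField S v φ 1 (e (x, y))) (by linarith)
      (Eventually.of_forall fun y hy => ?_) (hi2.add hi1)
    · rw [← Real.norm_eq_abs]
      refine hle.trans ?_
      rw [intervalIntegral.integral_add hi2 hi1, intervalIntegral.integral_const,
        intervalIntegral.integral_const_mul, smul_eq_mul]
      have := mul_le_mul_of_nonneg_left h2 hB0
      linarith
    · have hy' : |y| ≤ P / 2 := abs_le.2 ⟨hy.1.le, hy.2⟩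
      have hzS : e (x, y) ∈ S := ⟨hy', (hfar _ hxf).1.le, (hfar _ hxf).2.le⟩
      simp only [greenField]
      rw [hDφ _ hzS, hDv _ hzS (hfarH _ hxf hy'), mul_one]
      refine (norm_sub_le _ _).trans (add_le_add ?_ ?_)
      · rw [norm_mul, Real.norm_eq_abs, Real.norm_eq_abs]
        have hg' := hg _ hzS
        rw [hre, hx] at hg'
        exact mul_le_mul (h1 y hy') ((abs_re_le_norm _).trans hg') (abs_nonneg _)
          ((abs_nonneg _).trans (h1 y hy'))
      · rw [norm_mul, Real.norm_eq_abs, Real.norm_eq_abs]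
        exact mul_le_mul_of_nonneg_right (hB _ hzS) (abs_nonneg _)
  refine eq_of_forall_dist_le fun η hη => ?_
  have hlim : Tendsto (fun X : ℝ => 2 * (P * K * ((A + X) * Real.exp (-(κ * X)))))
      atTop (𝓝 0) := by
    have := ((tendsto_linear_mul_exp_neg A hκ).const_mul (P * K)).const_mul 2
    simpa using this
  obtain ⟨X₀, hX₀⟩ := eventually_atTop.1 (hlim.eventually (gt_mem_nhds (half_pos hη)))
  -- Each vertical side contributes at most η/4 through φ ∂v, since |φ| ≤ B; X₀ makes the two
  -- exponential terms together less than η/2.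
  obtain ⟨X, hX, hXc, hl⟩ := hA (η / (4 * (B + 1))) (by positivity) X₀
  have hXabs : |X| = X := abs_of_pos (by linarith)
  have b1 := hvert X _ hXc X hXabs (hl X hXabs)
  have b2 := hvert X _ hXc (-X) (by rw [abs_neg, hXabs]) (hl (-X) (by rw [abs_neg, hXabs]))
  have b3 := hX₀ X hX
  have b4 : B * (η / (4 * (B + 1))) ≤ η / 4 := by
    rw [← mul_div_assoc, div_le_div_iff₀ (by positivity) (by norm_num)]
    nlinarith
  have key := boundary_flux_eq hP hc hXc (continuousOn_greenField hSu hv hreg 1)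
    (continuousOn_greenField hSu hv hreg I) (fun z hz => (hgreen z hz).1)
    (fun z hz => (hgreen z hz).2.1) (fun z hz => (hgreen z hz).2.2)
  rw [← he] at key
  simp only [hhor, sub_self, zero_add] at key
  rw [Real.dist_eq, sub_zero, ← key]
  refine (abs_sub _ _).trans ?_
  linarith

end

/-! ### Fluxes through the circles and the formula for the potential difference. -/

section

variable {ε δ : ℝ}

/-- The field of the divergence theorem is taken along the outward radius, whereas ν points into the
disk; hence the minus sign. -/
theorem greenField_add_eq (S : Set ℂ) (v φ : ℂ → ℝ) (a : ℂ) (θ : ℝ) :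
    Real.cos θ * greenField S v φ 1 (circleMap a 1 θ) +
      Real.sin θ * greenField S v φ I (circleMap a 1 θ) =
    -(v (circleMap a 1 θ) * fderivWithin ℝ φ S (circleMap a 1 θ) (a - circleMap a 1 θ) -
      φ (circleMap a 1 θ) * fderivWithin ℝ v S (circleMap a 1 θ) (a - circleMap a 1 θ)) := by
  have e : a - circleMap a 1 θ = -(Real.cos θ • (1 : ℂ) + Real.sin θ • I) := by
    rw [circleMap, sub_add_cancel_left, ofReal_one, one_mul, exp_mul_I, real_smul, real_smul,
      mul_one, ofReal_cos, ofReal_sin]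
  simp only [e, map_neg, map_add, map_smul, smul_eq_mul, greenField]
  ring

theorem continuous_normalDeriv_circleMap (hε : 0 < ε) (hδ : 0 < δ) {f : ℂ → ℝ} {a : ℂ}
    (hf : ContDiffOn ℝ 1 f (closure (stripDomain ε δ)))
    (ha : ∀ θ, circleMap a 1 θ ∈ closure (stripDomain ε δ)) :
    Continuous fun θ => normalDeriv ε δ a f (circleMap a 1 θ) := by
  have hu : UniqueDiffOn ℝ (closure (stripDomain ε δ)) := by
    rw [closure_stripDomain hε hδ]
    exact uniqueDiffOn_closedCell (by linarith) (by linarith)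
  exact ((hf.continuousOn_fderivWithin hu le_rfl).comp_continuous (continuous_circleMap a 1) ha).clm_apply
    (continuous_const.sub (continuous_circleMap a 1))

/-- An entire harmonic function has zero flux through every circle of the configuration. -/
theorem circleInt_normalDeriv_of_harmonic (hε : 0 < ε) (hδ : 0 < δ) {H : ℂ → ℝ} {a : ℂ}
    (hH : HarmonicOnNhd H univ) (ha : ∀ θ, circleMap a 1 θ ∈ closure (stripDomain ε δ)) :
    circleInt a (normalDeriv ε δ a H) = 0 := by
  obtain ⟨F, hF, hFH⟩ := hH.exists_analyticOnNhd_univ_re_eq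
  have hd : ∀ z, HasDerivAt F (deriv F z) z := fun z => (hF z (mem_univ z)).differentiableAt.hasDerivAt
  have hHd : ∀ z, HasFDerivAt H (reMul (deriv F z)) z := fun z => by
    rw [← hFH]
    exact hasFDerivAt_re_of_hasDerivAt (hd z)
  have hadd : ∀ θ, circleMap a 1 θ = a + circleMap 0 1 θ := fun θ => by simp [circleMap]
  have hpt : ∀ θ, normalDeriv ε δ a H (circleMap a 1 θ) =
      -(deriv F (a + circleMap 0 1 θ) * circleMap 0 1 θ).re := fun θ => by
    have hm := ha θ
    rw [closure_stripDomain hε hδ] at hm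
    rw [normalDeriv, bdryDeriv_eq hε hδ (hHd _) hm, hadd, sub_add_cancel_left, mul_neg, neg_re]
  have hcont : Continuous fun θ => deriv F (a + circleMap 0 1 θ) * circleMap 0 1 θ := by
    have h1 : Continuous (deriv F) := continuous_iff_continuousAt.2 fun z =>
      (hF z (mem_univ z)).deriv.continuousAt
    exact (h1.comp (continuous_const.add (continuous_circleMap 0 1))).mul (continuous_circleMap 0 1)
  have hz := integral_deriv_mul_circleMap (f := fun ζ => F (a + ζ)) (f' := fun ζ => deriv F (a + ζ))
    fun ζ _ => (hd (a + ζ)).comp_const_add a ζ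
  have hre := reCLM.intervalIntegral_comp_comm (μ := volume) (hcont.intervalIntegrable 0 (2 * π))
  rw [hz, map_zero] at hre
  rw [circleInt]
  simp only [hpt]
  rw [intervalIntegral.integral_neg, neg_eq_zero]
  exact hre

/-- The flux of `v ∇φ - φ ∇v` with `v = u - H` through a circle on which `u` and `φ` are constant
and through which `u` has no flux. -/
theorem circleFlux_greenField (hε : 0 < ε) (hδ : 0 < δ) {φ u H : ℂ → ℝ} {a : ℂ} {k β : ℝ}
    (hφ : ContDiffOn ℝ 1 φ (closure (stripDomain ε δ)))
    (hu : ContDiffOn ℝ 1 u (closure (stripDomain ε δ)))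
    (hH : HarmonicOnNhd H univ) (ha : ∀ θ, circleMap a 1 θ ∈ closure (stripDomain ε δ))
    (huk : ∀ z ∈ sphere a 1, u z = k) (hφβ : ∀ z ∈ sphere a 1, φ z = β)
    (hflux : circleInt a (normalDeriv ε δ a u) = 0) :
    circleFlux a (greenField (closure (stripDomain ε δ)) (fun z => u z - H z) φ 1)
        (greenField (closure (stripDomain ε δ)) (fun z => u z - H z) φ I) =
      circleInt a (fun z => H z * normalDeriv ε δ a φ z) -
        k * circleInt a (normalDeriv ε δ a φ) := by
  have hS : UniqueDiffOn ℝ (closure (stripDomain ε δ)) := by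
    rw [closure_stripDomain hε hδ]
    exact uniqueDiffOn_closedCell (by linarith) (by linarith)
  have hHd : ContDiff ℝ 1 H :=
    contDiff_iff_contDiffAt.2 fun z => ((hH z (mem_univ z)).1.of_le one_le_two)
  have hpt : ∀ θ, Real.cos θ * greenField (closure (stripDomain ε δ)) (fun z => u z - H z) φ 1
        (circleMap a 1 θ) + Real.sin θ * greenField (closure (stripDomain ε δ))
          (fun z => u z - H z) φ I (circleMap a 1 θ) =
      H (circleMap a 1 θ) * normalDeriv ε δ a φ (circleMap a 1 θ) -
        k * normalDeriv ε δ a φ (circleMap a 1 θ) +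
        (β * normalDeriv ε δ a u (circleMap a 1 θ) -
          β * normalDeriv ε δ a H (circleMap a 1 θ)) := fun θ => by
    have hm := circleMap_mem_sphere a zero_le_one θ
    have hsub : fderivWithin ℝ (fun z => u z - H z) (closure (stripDomain ε δ)) (circleMap a 1 θ) =
        fderivWithin ℝ u (closure (stripDomain ε δ)) (circleMap a 1 θ) -
          fderivWithin ℝ H (closure (stripDomain ε δ)) (circleMap a 1 θ) :=
      fderivWithin_fun_sub (hS _ (ha θ)) (hu.differentiableOn one_ne_zero _ (ha θ))
        (hHd.differentiable one_ne_zero _).differentiableWithinAt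
    rw [greenField_add_eq, huk _ hm, hφβ _ hm, hsub]
    simp only [normalDeriv, bdryDeriv, sub_apply]
    ring
  have cφ := continuous_normalDeriv_circleMap hε hδ hφ ha
  have cu := continuous_normalDeriv_circleMap hε hδ hu ha
  have cH := continuous_normalDeriv_circleMap hε hδ hHd.contDiffOn ha
  have cH0 : Continuous fun θ => H (circleMap a 1 θ) :=
    hHd.continuous.comp (continuous_circleMap a 1)
  have hfluxH := circleInt_normalDeriv_of_harmonic hε hδ hH ha
  simp only [circleInt] at hflux hfluxH ⊢
  rw [circleFlux]
  simp only [hpt]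
  rw [intervalIntegral.integral_add, intervalIntegral.integral_sub, intervalIntegral.integral_sub,
    intervalIntegral.integral_const_mul, intervalIntegral.integral_const_mul,
    intervalIntegral.integral_const_mul, hflux, hfluxH]
  · ring
  all_goals exact Continuous.intervalIntegrable (by fun_prop) _ _

/-- The potential difference of any solution. -/
theorem IsSolution.sub_eq (hε : 0 < ε) (hδ : 0 < δ) {φ : ℂ → ℝ} {g : ℂ → ℂ} {b : ℝ}
    (h : PeriodicPotential (2 + δ) (1 + ε / 2) φ g b) (hpot : IsPotential ε δ φ b)
    {H u : ℂ → ℝ} {cL cR : ℝ} (hH : Admissible δ H) (hu : IsSolution ε δ H u cL cR) :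
    cR - cL = circleInt (centerL ε δ 0) (fun z => H z * normalDeriv ε δ (centerL ε δ 0) φ z) +
      circleInt (centerR ε δ 0) (fun z => H z * normalDeriv ε δ (centerR ε δ 0) φ z) := by
  have hP : 2 < 2 + δ := by linarith
  have hc : 1 < 1 + ε / 2 := by linarith
  have hHd : ContDiff ℝ 1 H :=
    contDiff_iff_contDiffAt.2 fun z => ((hH.harmonic z (mem_univ z)).1.of_le one_le_two)
  have haR : ∀ θ, circleMap (centerR ε δ 0) 1 θ ∈ closure (stripDomain ε δ) := fun θ => by
    rw [closure_stripDomain hε hδ, centerR_zero]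
    exact circle_subset_closedCell hP hc (by simp [circleMap])
  have haL : ∀ θ, circleMap (centerL ε δ 0) 1 θ ∈ closure (stripDomain ε δ) := fun θ => by
    rw [closure_stripDomain hε hδ, centerL_zero]
    exact circle_neg_subset_closedCell hP hc (by rw [circleMap, neg_add_eq_sub, sub_add_cancel]; simp)
  have hharm : ∀ z ∈ exterior ε δ, HarmonicAt (fun z => u z - H z) z := fun z hz =>
    (hu.harmonic z hz).sub (hH.harmonic z (mem_univ z))
  have hflux := circleFlux_greenField_add hε hδ (v := fun z => u z - H z) h hpot
    (by
      rw [← closure_stripDomain hε hδ]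
      exact hu.regular.sub hHd.contDiffOn)
    (fun z h1 h2 h3 => hharm z (mem_exterior hδ h1 h2 h3))
    (fun z hz => by
      have hmem : ∀ w : ℂ, |w.im| = (2 + δ) / 2 → w ∈ exterior ε δ := fun w hw =>
        mem_exterior hδ (by linarith) (by linarith [norm_sub_ge_abs_im w (1 + ε / 2)])
          (by linarith [norm_add_ge_abs_im w (1 + ε / 2)])
      have m1 : z ∈ exterior ε δ := hmem z (by rw [hz, abs_neg, abs_of_pos (by linarith)])
      have m2 : z + ((2 + δ : ℝ) : ℂ) * I ∈ exterior ε δ := hmem _ (by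
        have : (z + ((2 + δ : ℝ) : ℂ) * I).im = (2 + δ) / 2 := by
          simp only [add_im, hz, mul_im, ofReal_re, I_im, ofReal_im, I_re]
          ring
        rw [this, abs_of_pos (by linarith)])
      have dH : ∀ z, DifferentiableAt ℝ H z := hHd.differentiable one_ne_zero
      rw [fderiv_fun_sub (differentiableAt_of_harmonicAt (hu.harmonic _ m1)) (dH _),
        fderiv_fun_sub (differentiableAt_of_harmonicAt (hu.harmonic _ m2)) (dH _),
        fderiv_eq_of_gradient_eq (hu.periodic z m1),
        fderiv_eq_of_gradient_eq (hH.periodic z (mem_univ z))])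
    (by
      have := hu.energy
      rw [FiniteEnergy, stripDomain_eq] at this
      simpa only [norm_gradient_eq] using this)
  rw [← closure_stripDomain hε hδ, ← centerL_zero ε δ, ← centerR_zero ε δ,
    circleFlux_greenField hε hδ hpot.regular hu.regular hH.harmonic haR hu.valueR hpot.valueR
      hu.fluxR,
    circleFlux_greenField hε hδ hpot.regular hu.regular hH.harmonic haL hu.valueL hpot.valueL
      hu.fluxL, hpot.fluxR] at hflux
  -- With fluxes -1 and 1 of φ, the vanishing sum of the circle fluxes reads ∫ H ∂_ν φ - cR + cL =
  -- 0.
  have hL : circleInt (centerL ε δ 0) (normalDeriv ε δ (centerL ε δ 0) φ) = -1 := by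
    linarith [hpot.fluxL]
  rw [hL] at hflux
  linarith

end

end TwoRows

end

theorem proposition2p4 (ε δ : ℝ) (hε : 0 < ε) (hδ : 0 < δ) :
    ∃ (c₀ : ℝ) (φ : ℂ → ℝ), TwoRows.IsPotential ε δ φ c₀ ∧
      ∀ H : ℂ → ℝ, TwoRows.Admissible δ H →
        ∀ (u : ℂ → ℝ) (cL cR : ℝ), TwoRows.IsSolution ε δ H u cL cR →
          cR - cL =
            TwoRows.circleInt (TwoRows.centerL ε δ 0)
                (fun z => H z * TwoRows.normalDeriv ε δ (TwoRows.centerL ε δ 0) φ z) +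
              TwoRows.circleInt (TwoRows.centerR ε δ 0)
                (fun z => H z * TwoRows.normalDeriv ε δ (TwoRows.centerR ε δ 0) φ z) := by
  obtain ⟨φ, g, b, h, hconj⟩ := TwoRows.exists_periodicPotential (P := 2 + δ) (c := 1 + ε / 2)
    (by linarith) (by linarith)
  have hpot := h.isPotential hε hδ hconj
  exact ⟨b, φ, hpot, fun H hH u cL cR hu => hu.sub_eq hε hδ h hpot hH⟩
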